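/- Let $k$ be a field, $H$ a Hopf algebra over $k$ with bijective antipode $S$, $A$ a left $H$-module algebra (action $h\otimes a\mapsto h\rightharpoonup a$) and $B$ a left $H$-comodule algebra (coaction $b\mapsto\sum b_{-1}\otimes b_0\in H\otimes B$). Let $A\#B$ be the Takeuchi smash product: the algebra with underlying space $A\otimes_k B$ and multiplication $(a\#b)(a'\#b')=\sum a(b_{-1}\rightharpoonup a')\#b_0b'$. In particular $A\#H$ is the usual smash product. (1) Let $M$ be a left $A\#H$-module. For a left $B$-module $X$ let $M\#X$ be the left $A\#B$-module with underlying space $M\otimes_k X$ and action $(a\#b)(m\otimes x)=\sum (a\#b_{-1})m\otimes b_0x$. For a left $A\#B$-module $T$ let $B$ act on $\mathrm{Hom}_A(M,T)$ by $(b\rightharpoonup f)(m)=\sum b_0f(S^{-1}(b_{-1})m)$, and let $\mathrm{Ext}^q_A(M,T)$ carry the $B$-module structure of the $q$-th cohomology of $\mathrm{Hom}_A(M,I^\bullet)$, where $I^\bullet$ is an injective resolution of $T$ by $A\#B$-modules; this cohomology is, as a $k$-space and naturally in $T$, the usual $\mathrm{Ext}^q_A(M,T)$ of $A$-modules. Then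 the functor $M\#-$ is left adjoint to $\mathrm{Hom}_A(M,-)$, the adjunction bijection $\mathrm{Hom}_{A\#B}(M\#X,T)\to\mathrm{Hom}_B(X,\mathrm{Hom}_A(M,T))$ being $f\mapsto(x\mapsto(m\mapsto f(m\otimes x)))$, and for all $X$ and $T$ there is a convergent first quadrant cohomological spectral sequence of $k$-vector spaces $$E_2^{p,q}=\mathrm{Ext}^p_B(X,\mathrm{Ext}^q_A(M,T))\Rightarrow\mathrm{Ext}^{p+q}_{A\#B}(M\#X,T).$$ (2) Let $Y$ be a right $B$-module with a left $H$-coaction $y\mapsto\sum y_{-1}\otimes y_0$ such that $\sum (yb)_{-1}\otimes(yb)_0=\sum y_{-1}b_{-1}\otimes y_0b_0$. For a right $A$-module $N$ let $N\#Y$ be the right $A\#B$-module with underlying space $N\otimes_k Y$ and action $(n\otimes y)(a\#b)=\sum n(y_{-1}\rightharpoonup a)\otimes y_0b$. For a right $A\#B$-module $T$ let $A$ act from the right on $\mathrm{Hom}_{B^{op}}(Y,T)$ by $(fa)(y)=\sum f(y_0)(S^{-1}(y_{-1})\rightharpoonup a)$, and let $\mathrm{Ext}^q_{B^{op}}(Y,T)$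 carry the right $A$-module structure of the $q$-th cohomology of $\mathrm{Hom}_{B^{op}}(Y,I^\bullet)$, where $I^\bullet$ is an injective resolution of $T$ by right $A\#B$-modules; this cohomology is, as a $k$-space and naturally in $T$, the usual $\mathrm{Ext}^q_{B^{op}}(Y,T)$ of right $B$-modules. Then the functor $-\#Y$ is left adjoint to $\mathrm{Hom}_{B^{op}}(Y,-)$, the adjunction bijection $\mathrm{Hom}_{(A\#B)^{op}}(N\#Y,T)\to\mathrm{Hom}_{A^{op}}(N,\mathrm{Hom}_{B^{op}}(Y,T))$ being $f\mapsto(n\mapsto(y\mapsto f(n\otimes y)))$, and for all $N$ and $T$ there is a convergent first quadrant cohomological spectral sequence of $k$-vector spaces $$E_2^{p,q}=\mathrm{Ext}^p_{A^{op}}(N,\mathrm{Ext}^q_{B^{op}}(Y,T))\Rightarrow\mathrm{Ext}^{p+q}_{(A\#B)^{op}}(N\#Y,T).$$ Here a first quadrant spectral sequence $E_r^{p,q}$ ($r\ge2$, $p,q\ge0$, differentials of bidegree $(r,1-r)$) converges to $(V^n)_{n\ge0}$ if each $V^n$ has a filtration $V^n=F^0\supseteq F^1\supseteq\dots\supseteq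 F^{n+1}=0$ with $F^pV^{p+q}/F^{p+1}V^{p+q}\cong E_\infty^{p,q}$, where $E_\infty^{p,q}$ is $E_r^{p,q}$ for any $r>\max(p,q+1)$. -/

import Mathlib

open CategoryTheory TensorProduct
open scoped ModuleCat

universe u

set_option linter.unusedSectionVars false

/-- A left `H`-module algebra `A`: `act h a` is `h ⇀ a`, and
`h ⇀ (a b) = ∑ (h₁ ⇀ a) (h₂ ⇀ b)`, `h ⇀ 1 = ε(h) 1`. -/
class HModuleAlgebra (k H A : Type u) [Field k] [Ring H] [HopfAlgebra k H]
    [Ring A] [Algebra k A] where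
  act : H →ₐ[k] Module.End k A
  act_mul : ∀ (h : H) (a b : A), act h (a * b) =
    LinearMap.mul' k A (TensorProduct.map (act.toLinearMap.flip a) (act.toLinearMap.flip b)
      (Coalgebra.comul (R := k) h))
  act_one : ∀ h : H, act h 1 = algebraMap k A (Coalgebra.counit h)

/-- A left `H`-comodule algebra `B`: a coassociative counital coaction `coact : B → H ⊗ B`
(written `b ↦ ∑ b₋₁ ⊗ b₀`) that is a morphism of algebras. -/
class HComoduleAlgebra (k H B : Type u) [Field k] [Ring H] [HopfAlgebra k H]
    [Ring B] [Algebra k B] where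
  coact : B →ₐ[k] H ⊗[k] B
  coact_coassoc : ∀ b : B,
    TensorProduct.assoc k H H B ((Coalgebra.comul (R := k)).rTensor B (coact b)) =
      coact.toLinearMap.lTensor H (coact b)
  coact_counit : ∀ b : B,
    TensorProduct.lid k B ((Coalgebra.counit (R := k) (A := H)).rTensor B (coact b)) = b

/-- `H` is a left comodule algebra over itself through its comultiplication. -/
instance HComoduleAlgebra.self (k H : Type u) [Field k] [Ring H] [HopfAlgebra k H] :
    HComoduleAlgebra k H H where
  coact := Bialgebra.comulAlgHom k H
  coact_coassoc b := Coalgebra.coassoc_apply b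
  coact_counit b := by
    change TensorProduct.lid k H ((Coalgebra.counit (R := k) (A := H)).rTensor H
      (Coalgebra.comul (R := k) b)) = b
    rw [Coalgebra.rTensor_counit_comul]; simp

/-- The antipode of `H` is bijective. -/
class HasBijectiveAntipode (k H : Type u) [Field k] [Ring H] [HopfAlgebra k H] : Prop where
  bijective : Function.Bijective (HopfAlgebra.antipode k (A := H))

/-- The Takeuchi smash product `A # B`, with underlying space `A ⊗ B`. -/
def TakeuchiSmash (k H A B : Type u) [Field k] [Ring H] [HopfAlgebra k H]
    [Ring A] [Algebra k A] [HModuleAlgebra k H A] [Ring B] [Algebra k B]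
    [HComoduleAlgebra k H B] : Type u :=
  A ⊗[k] B

namespace TakeuchiSmash

section

variable (k H A B : Type u) [Field k] [Ring H] [HopfAlgebra k H]
  [Ring A] [Algebra k A] [HModuleAlgebra k H A] [Ring B] [Algebra k B] [HComoduleAlgebra k H B]

/-- `rT a (h ⊗ b) = (h ⇀ a) ⊗ b`. -/
noncomputable def rT (a : A) : H ⊗[k] B →ₗ[k] A ⊗[k] B :=
  ((HModuleAlgebra.act (k := k) (H := H) (A := A)).toLinearMap.flip a).rTensor B

/-- `twist b a = ∑ (b₋₁ ⇀ a) ⊗ b₀`. -/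
noncomputable def twist : B →ₗ[k] A →ₗ[k] A ⊗[k] B :=
  ((LinearMap.rTensorHom B ∘ₗ
    (HModuleAlgebra.act (k := k) (H := H) (A := A)).toLinearMap.flip).flip) ∘ₗ
    (HComoduleAlgebra.coact (k := k) (H := H) (B := B)).toLinearMap

/-- Left multiplication by `a # 1`. -/
noncomputable def opL : A →ₗ[k] Module.End k (A ⊗[k] B) :=
  LinearMap.mul k (A ⊗[k] B) ∘ₗ
    (Algebra.TensorProduct.includeLeft : A →ₐ[k] A ⊗[k] B).toLinearMap

/-- Left multiplication by `1 # b`: `a' # b' ↦ ∑ (b₋₁ ⇀ a') # b₀ b'`. -/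
noncomputable def opT : B →ₗ[k] Module.End k (A ⊗[k] B) where
  toFun b := TensorProduct.lift ((LinearMap.mul k (A ⊗[k] B)).compl₁₂ (twist k H A B b)
    (Algebra.TensorProduct.includeRight : B →ₐ[k] A ⊗[k] B).toLinearMap)
  map_add' x y := by ext; simp
  map_smul' c x := by ext; simp

/-- The linear map `A ⊗ B → E`, `a ⊗ b ↦ α(a) β(b)`. -/
noncomputable def pair {k A B E : Type u} [Field k] [Ring A] [Algebra k A] [Ring B] [Algebra k B]
    [Ring E] [Algebra k E] (α : A →ₗ[k] E) (β : B →ₗ[k] E) : A ⊗[k] B →ₗ[k] E :=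
  TensorProduct.lift ((LinearMap.mul k E).compl₁₂ α β)

/-- The multiplication `(a # b)(a' # b') = ∑ a (b₋₁ ⇀ a') # b₀ b'`. -/
noncomputable def smashMul : A ⊗[k] B →ₗ[k] A ⊗[k] B →ₗ[k] A ⊗[k] B :=
  pair (opL k A B) (opT k H A B)

variable {k H A B}

@[simp] lemma pair_tmul {E : Type u} [Ring E] [Algebra k E] (α : A →ₗ[k] E) (β : B →ₗ[k] E)
    (a : A) (b : B) : pair α β (a ⊗ₜ b) = α a * β b := by simp [pair]

@[simp] lemma rT_tmul (a : A) (h : H) (b : B) :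
    rT k H A B a (h ⊗ₜ b) = HModuleAlgebra.act (k := k) h a ⊗ₜ b := by simp [rT]

lemma twist_eq (b : B) (a : A) : twist k H A B b a =
    rT k H A B a (HComoduleAlgebra.coact (k := k) (H := H) b) := by
  simp [twist, rT]

@[simp] lemma opL_apply (a : A) (x : A ⊗[k] B) : opL k A B a x = (a ⊗ₜ 1) * x := by
  simp [opL]

@[simp] lemma opT_tmul (b : B) (a : A) (c : B) :
    opT k H A B b (a ⊗ₜ c) = twist k H A B b a * (1 ⊗ₜ c) := by
  simp [opT]

lemma opT_mul_right (b : B) (x : A ⊗[k] B) (c : B) :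
    opT k H A B b (x * (1 ⊗ₜ c)) = opT k H A B b x * (1 ⊗ₜ c) := by
  induction x with
  | zero => simp
  | add x y hx hy => simp [add_mul, hx, hy]
  | tmul a d => simp [mul_assoc]

lemma smashMul_tmul (a : A) (b : B) (a' : A) (b' : B) :
    smashMul k H A B (a ⊗ₜ b) (a' ⊗ₜ b') =
      (a ⊗ₜ 1) * (twist k H A B b a' * (1 ⊗ₜ b')) := by
  simp [smashMul]

lemma pair_left_mul {E : Type u} [Ring E] [Algebra k E] (α : A →ₐ[k] E) (β : B →ₗ[k] E)
    (a : A) (x : A ⊗[k] B) :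
    pair α.toLinearMap β ((a ⊗ₜ 1) * x) = α a * pair α.toLinearMap β x := by
  induction x with
  | zero => simp
  | add x y hx hy => simp [mul_add, hx, hy]
  | tmul c d => simp [mul_assoc]

lemma pair_right_mul {E : Type u} [Ring E] [Algebra k E] (α : A →ₗ[k] E) (β : B →ₐ[k] E)
    (b : B) (x : A ⊗[k] B) :
    pair α β.toLinearMap (x * (1 ⊗ₜ b)) = pair α β.toLinearMap x * β b := by
  induction x with
  | zero => simp
  | add x y hx hy => simp [add_mul, hx, hy]
  | tmul c d => simp [mul_assoc]

/-- If `β(b) α(a) = ∑ α(b₋₁ ⇀ a) β(b₀)`, then `a # b ↦ α(a) β(b)` is multiplicative. -/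
lemma pair_smashMul {E : Type u} [Ring E] [Algebra k E] (α : A →ₐ[k] E) (β : B →ₐ[k] E)
    (hc : ∀ a b, β b * α a = pair α.toLinearMap β.toLinearMap (twist k H A B b a))
    (x y : A ⊗[k] B) :
    pair α.toLinearMap β.toLinearMap (smashMul k H A B x y) =
      pair α.toLinearMap β.toLinearMap x * pair α.toLinearMap β.toLinearMap y := by
  induction x with
  | zero => simp
  | add x y hx hy => simp [add_mul, hx, hy]
  | tmul a b =>
    induction y with
    | zero => simp
    | add x y hx hy => simp only [map_add, mul_add, hx, hy]
    | tmul a' b' =>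
      rw [smashMul_tmul, pair_left_mul, pair_right_mul, ← hc]
      simp [mul_assoc]

/-- `opL` as a morphism of algebras. -/
noncomputable def opLHom : A →ₐ[k] Module.End k (A ⊗[k] B) :=
  AlgHom.ofLinearMap (opL k A B)
    (by ext; simp [← Algebra.TensorProduct.one_def])
    (by intro x y; ext; simp [mul_assoc])

lemma rT_mul (a : A) (u v : H ⊗[k] B) :
    rT k H A B a (u * v) =
      TensorProduct.lift ((LinearMap.mul k (A ⊗[k] B)).compl₁₂ ((LinearMap.rTensorHom B ∘ₗ
        (HModuleAlgebra.act (k := k) (H := H) (A := A)).toLinearMap.flip).flip u)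
        (Algebra.TensorProduct.includeRight : B →ₐ[k] A ⊗[k] B).toLinearMap)
      (rT k H A B a v) := by
  induction v with
  | zero => simp
  | add x y hx hy => simp only [map_add, mul_add, hx, hy]
  | tmul g c =>
    induction u with
    | zero => simp
    | add x y hx hy =>
      simp only [map_add, add_mul, hx, hy]
      simp
    | tmul h d => simp

/-- `opT` as a morphism of algebras. -/
noncomputable def opTHom : B →ₐ[k] Module.End k (A ⊗[k] B) :=
  AlgHom.ofLinearMap (opT k H A B)
    (by ext; simp [twist_eq, Algebra.TensorProduct.one_def])
    (by
      intro x y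
      ext a c
      have : twist k H A B (x * y) a = opT k H A B x (twist k H A B y a) := by
        rw [twist_eq, twist_eq, map_mul, rT_mul]; rfl
      simp [this, opT_mul_right])

/-- `∑ (h₁ ⇀ a)(h₂ ⇀ a') ⊗ b`. -/
noncomputable def phi (a a' : A) : H ⊗[k] (H ⊗[k] B) →ₗ[k] A ⊗[k] B :=
  TensorProduct.lift (((LinearMap.mul k (A ⊗[k] B)) ∘ₗ
    (Algebra.TensorProduct.includeLeft : A →ₐ[k] A ⊗[k] B).toLinearMap ∘ₗ
    ((HModuleAlgebra.act (k := k) (H := H) (A := A)).toLinearMap.flip a)).compl₂ (rT k H A B a'))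

lemma phi_assoc (a a' : A) (h : H ⊗[k] H) (b : B) :
    phi (k := k) (B := B) a a' (TensorProduct.assoc k H H B (h ⊗ₜ b)) =
      LinearMap.mul' k A (TensorProduct.map
        ((HModuleAlgebra.act (k := k) (H := H) (A := A)).toLinearMap.flip a)
        ((HModuleAlgebra.act (k := k) (H := H) (A := A)).toLinearMap.flip a') h) ⊗ₜ b := by
  induction h with
  | zero => simp
  | add x y hx hy => simp only [TensorProduct.add_tmul, map_add, hx, hy]
  | tmul g g' => simp [phi]

/-- `∑ b₋₁ ⇀ (a a') ⊗ b₀ = ∑ (b₋₂ ⇀ a)(b₋₁ ⇀ a') ⊗ b₀`. -/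
lemma twist_mul (b : B) (a a' : A) : twist k H A B b (a * a') =
    phi a a' ((HComoduleAlgebra.coact (k := k) (H := H)).toLinearMap.lTensor H
      (HComoduleAlgebra.coact (k := k) (H := H) b)) := by
  rw [← HComoduleAlgebra.coact_coassoc, twist_eq]
  generalize (HComoduleAlgebra.coact (k := k) (H := H) b) = u
  induction u with
  | zero => simp
  | add x y hx hy => simp only [map_add, hx, hy]
  | tmul h c => simp [phi_assoc, HModuleAlgebra.act_mul]

lemma opT_comm (a : A) (b : B) : opT k H A B b * opL k A B a =
    smashMul k H A B (twist k H A B b a) := by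
  ext a' c
  simp only [TensorProduct.AlgebraTensorModule.curry_apply, TensorProduct.curry_apply,
    LinearMap.coe_restrictScalars, Module.End.mul_apply, opL_apply,
    Algebra.TensorProduct.tmul_mul_tmul, one_mul, opT_tmul, twist_mul]
  rw [twist_eq]
  generalize (HComoduleAlgebra.coact (k := k) (H := H) b) = u
  induction u with
  | zero => simp
  | add x y hx hy => simp only [map_add, add_mul, hx, hy, LinearMap.add_apply]
  | tmul h d => simp [phi, smashMul, twist_eq, mul_assoc]

lemma smashMul_assoc (x y z : A ⊗[k] B) :
    smashMul k H A B (smashMul k H A B x y) z = smashMul k H A B x (smashMul k H A B y z) :=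
  LinearMap.congr_fun (pair_smashMul (k := k) (H := H) (A := A) (B := B) opLHom opTHom
    (fun a b => opT_comm a b) x y) z

lemma one_smashMul (x : A ⊗[k] B) : smashMul k H A B (1 ⊗ₜ 1) x = x := by
  have h := pair_tmul (opLHom (k := k) (A := A) (B := B)).toLinearMap
    (opTHom (k := k) (H := H) (A := A) (B := B)).toLinearMap 1 1
  simp only [AlgHom.toLinearMap_apply, map_one, mul_one] at h
  exact LinearMap.congr_fun h x

lemma smashMul_one (x : A ⊗[k] B) : smashMul k H A B x (1 ⊗ₜ 1) = x := by
  induction x with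
  | zero => simp
  | add x y hx hy => simp [hx, hy]
  | tmul a b =>
    have : twist k H A B b 1 = 1 ⊗ₜ b := by
      conv_rhs => rw [← HComoduleAlgebra.coact_counit (k := k) (H := H) b]
      rw [twist_eq]
      generalize (HComoduleAlgebra.coact (k := k) (H := H) b) = u
      induction u with
      | zero => simp
      | add x y hx hy => simp only [map_add, hx, hy, TensorProduct.tmul_add]
      | tmul h d =>
        simp [HModuleAlgebra.act_one, Algebra.algebraMap_eq_smul_one, TensorProduct.smul_tmul]
    simp [smashMul_tmul, this]

end

section

variable {k H A B : Type u} [Field k] [Ring H] [HopfAlgebra k H]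
  [Ring A] [Algebra k A] [HModuleAlgebra k H A] [Ring B] [Algebra k B] [HComoduleAlgebra k H B]

noncomputable instance : AddCommGroup (TakeuchiSmash k H A B) :=
  inferInstanceAs (AddCommGroup (A ⊗[k] B))

noncomputable instance : Module k (TakeuchiSmash k H A B) :=
  inferInstanceAs (Module k (A ⊗[k] B))

noncomputable instance : Ring (TakeuchiSmash k H A B) where
  __ := (inferInstance : AddCommGroup (TakeuchiSmash k H A B))
  mul x y := smashMul k H A B x y
  one := ((1 : A) ⊗ₜ[k] (1 : B) : A ⊗[k] B)
  left_distrib x y z := map_add (smashMul k H A B x) y z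
  right_distrib x y z := LinearMap.map_add₂ (smashMul k H A B) x y z
  zero_mul x := LinearMap.map_zero₂ (smashMul k H A B) x
  mul_zero x := map_zero (smashMul k H A B x)
  mul_assoc x y z := smashMul_assoc x y z
  one_mul x := one_smashMul x
  mul_one x := smashMul_one x

noncomputable instance : Algebra k (TakeuchiSmash k H A B) :=
  Algebra.ofModule
    (fun c x y => LinearMap.map_smul₂ (smashMul k H A B) c x y)
    (fun c x y => map_smul (smashMul k H A B x) c y)

variable (k H A B) in
/-- The identity `A ⊗ B = A # B` of underlying spaces, `a ⊗ b ↦ a # b`. -/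
noncomputable def ofTensor : A ⊗[k] B ≃ₗ[k] TakeuchiSmash k H A B :=
  LinearEquiv.refl k (A ⊗[k] B)

/-- The algebra map `A # B → E`, `a # b ↦ α(a) β(b)`, for algebra maps `α`, `β` such that
`β(b) α(a) = ∑ α(b₋₁ ⇀ a) β(b₀)`. -/
noncomputable def lift {E : Type u} [Ring E] [Algebra k E] (α : A →ₐ[k] E) (β : B →ₐ[k] E)
    (hc : ∀ a b, β b * α a = pair α.toLinearMap β.toLinearMap (twist k H A B b a)) :
    TakeuchiSmash k H A B →ₐ[k] E :=
  AlgHom.ofLinearMap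
    (pair α.toLinearMap β.toLinearMap ∘ₗ (ofTensor k H A B).symm.toLinearMap)
    ((pair_tmul α.toLinearMap β.toLinearMap 1 1).trans (by simp))
    (pair_smashMul α β hc)

variable (k H A B)

/-- `a ↦ a # 1`. -/
noncomputable def inl : A →ₐ[k] TakeuchiSmash k H A B :=
  AlgHom.ofLinearMap
    ((ofTensor k H A B).toLinearMap ∘ₗ
      (Algebra.TensorProduct.includeLeft : A →ₐ[k] A ⊗[k] B).toLinearMap)
    rfl
    (fun x y => by
      change (x * y) ⊗ₜ[k] (1 : B) = smashMul k H A B (x ⊗ₜ 1) (y ⊗ₜ 1)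
      simp [smashMul_tmul, twist_eq, Algebra.TensorProduct.one_def])

/-- `b ↦ 1 # b`. -/
noncomputable def inr : B →ₐ[k] TakeuchiSmash k H A B :=
  AlgHom.ofLinearMap
    ((ofTensor k H A B).toLinearMap ∘ₗ
      (Algebra.TensorProduct.includeRight : B →ₐ[k] A ⊗[k] B).toLinearMap)
    rfl
    (fun x y => by
      change (1 : A) ⊗ₜ[k] (x * y) = smashMul k H A B (1 ⊗ₜ x) (1 ⊗ₜ y)
      have : twist k H A B x 1 = 1 ⊗ₜ x := by
        have := smashMul_one (k := k) (H := H) ((1 : A) ⊗ₜ[k] x)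
        rwa [smashMul_tmul, ← Algebra.TensorProduct.one_def, one_mul, mul_one] at this
      simp [smashMul_tmul, this])

end

end TakeuchiSmash

namespace HopfAux

variable {k H : Type u} [Field k] [Ring H] [HopfAlgebra k H]

open Coalgebra HopfAlgebra WithConv

lemma antipode_tmul_comul (y : H) :
    LinearMap.mul' k (H ⊗[k] H) (TensorProduct.map
      ((TensorProduct.mk k H H).flip 1 ∘ₗ antipode k) comul (comul (R := k) y)) = 1 ⊗ₜ y := by
  let Φ : H ⊗[k] (H ⊗[k] H) →ₗ[k] H ⊗[k] H :=
    LinearMap.mul' k (H ⊗[k] H) ∘ₗ TensorProduct.map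
      ((TensorProduct.mk k H H).flip 1 ∘ₗ antipode k) LinearMap.id
  have h1 : LinearMap.mul' k (H ⊗[k] H) (TensorProduct.map
      ((TensorProduct.mk k H H).flip 1 ∘ₗ antipode k) comul (comul (R := k) y)) =
      Φ (comul.lTensor H (comul (R := k) y)) := by
    simp only [Φ, LinearMap.comp_apply, LinearMap.lTensor]
    rw [TensorProduct.map_map]
    simp
  have h2 : ∀ u : H ⊗[k] H, ∀ z : H, Φ (TensorProduct.assoc k H H H (u ⊗ₜ z)) =
      LinearMap.mul' k H ((antipode k).rTensor H u) ⊗ₜ z := by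
    intro u z
    induction u with
    | zero => simp
    | add x y hx hy => simp only [TensorProduct.add_tmul, map_add, hx, hy]
    | tmul g g' => simp [Φ]
  rw [h1, ← coassoc_apply]
  conv_rhs => rw [← (TensorProduct.lid k H).apply_symm_apply y]
  have h3 : (TensorProduct.lid k H).symm y = counit.rTensor H (comul (R := k) y) := by
    rw [rTensor_counit_comul]; simp
  rw [h3]
  generalize comul (R := k) y = w
  induction w with
  | zero => simp
  | add x y hx hy => simp only [map_add, hx, hy, TensorProduct.tmul_add]
  | tmul g z =>
    simp [h2, Algebra.algebraMap_eq_smul_one, TensorProduct.smul_tmul]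

/-- The antipode reverses the comultiplication. -/
lemma comul_antipode (h : H) : comul (R := k) (antipode k h) =
    TensorProduct.map (antipode k) (antipode k) (TensorProduct.comm k H H (comul (R := k) h)) := by
  have key : toConv (TensorProduct.map (antipode k) (antipode k) ∘ₗ
      (TensorProduct.comm k H H).toLinearMap ∘ₗ comul (R := k) (A := H)) *
      toConv (comul (R := k) (A := H)) = 1 := by
    ext y
    rw [LinearMap.convMul_apply, LinearMap.convOne_apply]
    simp only
    let Φ : H ⊗[k] (H ⊗[k] H) →ₗ[k] H ⊗[k] H :=
      TensorProduct.lift (LinearMap.mk₂ k (fun p w =>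
        ((1 : H) ⊗ₜ[k] antipode k p) * LinearMap.mul' k (H ⊗[k] H) (TensorProduct.map
        ((TensorProduct.mk k H H).flip 1 ∘ₗ antipode k) comul w))
        (by intros; simp [TensorProduct.tmul_add, add_mul]) (by intros; simp)
        (by intros; simp [mul_add]) (by intros; simp))
    have h1 : ∀ u : H ⊗[k] H, ∀ z : H, Φ (TensorProduct.assoc k H H H (u ⊗ₜ z)) =
        TensorProduct.map (antipode k) (antipode k) (TensorProduct.comm k H H u) *
          comul (R := k) z := by
      intro u z
      induction u with
      | zero => simp
      | add x y hx hy => simp only [TensorProduct.add_tmul, map_add, hx, hy, add_mul]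
      | tmul g g' => simp [Φ, ← mul_assoc]
    have h2 : LinearMap.mul' k (H ⊗[k] H) (TensorProduct.map
        (TensorProduct.map (antipode k) (antipode k) ∘ₗ
          (TensorProduct.comm k H H).toLinearMap ∘ₗ comul (R := k) (A := H)) comul
          (comul (R := k) y)) = Φ (TensorProduct.assoc k H H H
            (comul.rTensor H (comul (R := k) y))) := by
      generalize comul (R := k) y = w
      induction w with
      | zero => simp
      | add x y hx hy => simp only [map_add, hx, hy]
      | tmul g z => simp [h1]
    rw [h2, coassoc_apply]
    have h3 : Φ (comul.lTensor H (comul (R := k) y)) =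
        1 ⊗ₜ LinearMap.mul' k H ((antipode k).rTensor H (comul (R := k) y)) := by
      generalize comul (R := k) y = w
      induction w with
      | zero => simp
      | add x y hx hy => simp only [map_add, hx, hy, TensorProduct.tmul_add]
      | tmul g z => simp [Φ, antipode_tmul_comul]
    rw [h3, mul_antipode_rTensor_comul_apply]
    simp [Algebra.algebraMap_eq_smul_one, Algebra.TensorProduct.one_def]
  have := left_inv_eq_right_inv key LinearMap.comul_right_inv
  exact (LinearMap.congr_fun (congrArg WithConv.ofConv this) h).symm

variable [HasBijectiveAntipode k H]

variable (k) in
/-- The inverse `S⁻¹` of the antipode. -/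
noncomputable def sinv : H →ₗ[k] H :=
  ((LinearEquiv.ofBijective (antipode k (A := H)) HasBijectiveAntipode.bijective).symm :
    H →ₗ[k] H)

@[simp] lemma antipode_sinv (h : H) : antipode k (sinv k h) = h :=
  (LinearEquiv.ofBijective (antipode k (A := H)) HasBijectiveAntipode.bijective).apply_symm_apply h

@[simp] lemma sinv_antipode (h : H) : sinv k (antipode k h) = h :=
  (LinearEquiv.ofBijective (antipode k (A := H)) HasBijectiveAntipode.bijective).symm_apply_apply h

lemma sinv_mul (x y : H) : sinv k (x * y) = sinv k y * sinv k x := by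
  apply (HasBijectiveAntipode.bijective (k := k) (H := H)).1
  rw [antipode_mul_antidistrib]; simp

@[simp] lemma sinv_one : sinv k (1 : H) = 1 := by
  apply (HasBijectiveAntipode.bijective (k := k) (H := H)).1
  simp

lemma counit_sinv (h : H) : counit (R := k) (sinv k h) = counit (R := k) h := by
  conv_rhs => rw [← antipode_sinv (k := k) h, counit_antipode]

lemma comul_sinv (h : H) : comul (R := k) (sinv k h) =
    TensorProduct.comm k H H (TensorProduct.map (sinv k) (sinv k) (comul (R := k) h)) := by
  have h1 : (sinv k ∘ₗ antipode k : H →ₗ[k] H) = LinearMap.id := by ext; simp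
  conv_rhs => rw [← antipode_sinv (k := k) h, comul_antipode, TensorProduct.map_map, h1]
  simp

/-- `∑ h₂ S⁻¹(h₁) = ε(h) 1`. -/
lemma mul_sinv (h : H) : LinearMap.mul' k H (TensorProduct.comm k H H
    ((sinv k).rTensor H (comul (R := k) h))) = algebraMap k H (counit h) := by
  apply (HasBijectiveAntipode.bijective (k := k) (H := H)).1
  have : ∀ w : H ⊗[k] H, antipode k (LinearMap.mul' k H (TensorProduct.comm k H H
      ((sinv k).rTensor H w))) = LinearMap.mul' k H ((antipode k).lTensor H w) := by
    intro w
    induction w with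
    | zero => simp
    | add x y hx hy => simp only [map_add, hx, hy]
    | tmul g z => simp [antipode_mul_antidistrib]
  rw [this, mul_antipode_lTensor_comul_apply]
  simp [Algebra.algebraMap_eq_smul_one]

end HopfAux

namespace TakeuchiSmash

open HopfAux

section relations

variable {k H A B : Type u} [Field k] [Ring H] [HopfAlgebra k H]
  [Ring A] [Algebra k A] [HModuleAlgebra k H A] [Ring B] [Algebra k B] [HComoduleAlgebra k H B]

/-- The linear map `A ⊗ B → A # B` is the identity. -/
lemma pair_inl_inr (x : A ⊗[k] B) :
    pair (inl k H A B).toLinearMap (inr k H A B).toLinearMap x =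
      ofTensor k H A B x := by
  induction x with
  | zero => simp
  | add x y hx hy => rw [map_add, map_add, hx, hy]
  | tmul a b =>
    rw [pair_tmul]
    change smashMul k H A B (a ⊗ₜ 1) (1 ⊗ₜ b) = a ⊗ₜ b
    have : twist k H A B 1 1 = 1 ⊗ₜ 1 := by
      rw [twist_eq]; simp [Algebra.TensorProduct.one_def]
    simp [smashMul_tmul, this]

lemma inr_mul_inl (a : A) (b : B) : inr k H A B b * inl k H A B a =
    pair (inl k H A B).toLinearMap (inr k H A B).toLinearMap (twist k H A B b a) := by
  rw [pair_inl_inr]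
  change smashMul k H A B (1 ⊗ₜ b) (a ⊗ₜ 1) = twist k H A B b a
  simp [smashMul_tmul, ← Algebra.TensorProduct.one_def]

variable [HasBijectiveAntipode k H]

/-- In `A # B`: `∑ (1 # b₀)((S⁻¹ b₋₁ ⇀ a) # 1) = a # b`. -/
lemma sum_inr_mul_inl (a : A) (b : B) :
    TensorProduct.lift ((LinearMap.mul k (TakeuchiSmash k H A B)).flip.compl₁₂
      ((inl k H A B).toLinearMap ∘ₗ
        (HModuleAlgebra.act (k := k) (H := H) (A := A)).toLinearMap.flip a ∘ₗ sinv k)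
      (inr k H A B).toLinearMap) (HComoduleAlgebra.coact (k := k) (H := H) b) =
    inl k H A B a * inr k H A B b := by
  let Φ : H ⊗[k] (H ⊗[k] B) →ₗ[k] TakeuchiSmash k H A B :=
    TensorProduct.lift (LinearMap.mk₂ k (fun h w =>
      pair (inl k H A B).toLinearMap (inr k H A B).toLinearMap
        (rT k H A B (HModuleAlgebra.act (k := k) (sinv k h) a) w))
      (by intro x y w; induction w with
        | zero => simp
        | add x y hx hy =>
          simp only [map_add] at hx hy ⊢
          rw [hx, hy]; abel
        | tmul g z => simp [add_mul])
      (by intro c x w; induction w with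
        | zero => simp
        | add x y hx hy => simp only [map_add, hx, hy, smul_add]
        | tmul g z => simp)
      (by intros; simp) (by intros; simp))
  have h1 : ∀ u : H ⊗[k] B, TensorProduct.lift
      ((LinearMap.mul k (TakeuchiSmash k H A B)).flip.compl₁₂
      ((inl k H A B).toLinearMap ∘ₗ
        (HModuleAlgebra.act (k := k) (H := H) (A := A)).toLinearMap.flip a ∘ₗ sinv k)
      (inr k H A B).toLinearMap) u =
      Φ ((HComoduleAlgebra.coact (k := k) (H := H)).toLinearMap.lTensor H u) := by
    intro u
    induction u with
    | zero => simp
    | add x y hx hy => simp only [map_add, hx, hy]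
    | tmul h d => simp [Φ, inr_mul_inl, twist_eq]
  have h2 : ∀ w : H ⊗[k] H, ∀ d : B, Φ (TensorProduct.assoc k H H B (w ⊗ₜ d)) =
      inl k H A B (HModuleAlgebra.act (k := k) (LinearMap.mul' k H (TensorProduct.comm k H H
        ((sinv k).rTensor H w))) a) * inr k H A B d := by
    intro w d
    induction w with
    | zero => simp
    | add x y hx hy =>
      simp only [TensorProduct.add_tmul, map_add, hx, hy, LinearMap.add_apply, add_mul]
    | tmul g g' => simp [Φ]
  have h3 : ∀ u : H ⊗[k] B, Φ (TensorProduct.assoc k H H B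
      ((Coalgebra.comul (R := k)).rTensor B u)) =
      inl k H A B a * inr k H A B (TensorProduct.lid k B
        ((Coalgebra.counit (R := k) (A := H)).rTensor B u)) := by
    intro u
    induction u with
    | zero => simp
    | add x y hx hy => simp only [map_add, hx, hy, mul_add]
    | tmul h d =>
      rw [LinearMap.rTensor_tmul, h2, mul_sinv]
      simp [Algebra.algebraMap_eq_smul_one]
  rw [h1, ← HComoduleAlgebra.coact_coassoc, h3, HComoduleAlgebra.coact_counit]

/-- In `A # H`: `(1 # S⁻¹ h)(a # 1) = ∑ ((S⁻¹ h₂ ⇀ a) # 1)(1 # S⁻¹ h₁)`. -/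
lemma inr_sinv_mul_inl (a : A) (h : H) :
    inr k H A H (sinv k h) * inl k H A H a =
      TensorProduct.lift ((LinearMap.mul k (TakeuchiSmash k H A H)).flip.compl₁₂
        ((inr k H A H).toLinearMap ∘ₗ sinv k)
        ((inl k H A H).toLinearMap ∘ₗ
          (HModuleAlgebra.act (k := k) (H := H) (A := A)).toLinearMap.flip a ∘ₗ sinv k))
        (Coalgebra.comul (R := k) h) := by
  rw [inr_mul_inl, twist_eq]
  change pair _ _ (rT k H A H a (Coalgebra.comul (R := k) (sinv k h))) = _
  rw [comul_sinv]
  generalize Coalgebra.comul (R := k) h = w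
  induction w with
  | zero => simp
  | add x y hx hy => simp only [map_add, hx, hy]
  | tmul g z => simp

end relations

/-! ### Left modules -/

section left

variable (k H A B : Type u) [Field k] [Ring H] [HopfAlgebra k H]
  [Ring A] [Algebra k A] [HModuleAlgebra k H A] [Ring B] [Algebra k B] [HComoduleAlgebra k H B]

/-- The algebra map `A # B → (A # H) ⊗ B`, `a # b ↦ ∑ (a # b₋₁) ⊗ b₀`. -/
noncomputable def toTensor :
    TakeuchiSmash k H A B →ₐ[k] TakeuchiSmash k H A H ⊗[k] B :=
  lift (Algebra.TensorProduct.includeLeft.comp (inl k H A H))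
    ((Algebra.TensorProduct.map (inr k H A H) (AlgHom.id k B)).comp HComoduleAlgebra.coact)
    (by
      intro a b
      let Φ : H ⊗[k] (H ⊗[k] B) →ₗ[k] TakeuchiSmash k H A H ⊗[k] B :=
        TensorProduct.lift ((LinearMap.mul k (TakeuchiSmash k H A H ⊗[k] B)).compl₁₂
          ((Algebra.TensorProduct.includeLeft.comp (inl k H A H)).toLinearMap ∘ₗ
            (HModuleAlgebra.act (k := k) (H := H) (A := A)).toLinearMap.flip a)
          (Algebra.TensorProduct.map (inr k H A H) (AlgHom.id k B)).toLinearMap)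
      have h1 : ∀ u : H ⊗[k] B, pair
          (Algebra.TensorProduct.includeLeft.comp (inl k H A H)).toLinearMap
          ((Algebra.TensorProduct.map (inr k H A H) (AlgHom.id k B)).comp
            HComoduleAlgebra.coact).toLinearMap (rT k H A B a u) =
          Φ ((HComoduleAlgebra.coact (k := k) (H := H)).toLinearMap.lTensor H u) := by
        intro u
        induction u with
        | zero => simp
        | add x y hx hy => simp only [map_add, hx, hy]
        | tmul h d => simp [Φ]
      have h2 : ∀ w : H ⊗[k] H, ∀ d : B, Φ (TensorProduct.assoc k H H B (w ⊗ₜ d)) =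
          pair (inl k H A H).toLinearMap (inr k H A H).toLinearMap (rT k H A H a w) ⊗ₜ d := by
        intro w d
        induction w with
        | zero => simp
        | add x y hx hy => simp only [TensorProduct.add_tmul, map_add, hx, hy]
        | tmul g g' => simp [Φ]
      rw [twist_eq, h1, ← HComoduleAlgebra.coact_coassoc]
      simp only [AlgHom.comp_apply]
      generalize HComoduleAlgebra.coact (k := k) (H := H) b = u
      induction u with
      | zero => simp
      | add x y hx hy => simp only [map_add, add_mul, hx, hy]
      | tmul h d =>
        rw [LinearMap.rTensor_tmul, h2]
        have := inr_mul_inl (k := k) (H := H) a h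
        rw [twist_eq] at this
        change _ = pair _ _ (rT k H A H a (Coalgebra.comul (R := k) h)) at this
        simp [← this])

/-- The action of `A # B` on `M ⊗ X`, for `M` a left `A # H`-module and `X` a left `B`-module:
`(a # b)(m ⊗ x) = ∑ (a # b₋₁) m ⊗ b₀ x`. -/
noncomputable def tensorRep (M X : Type u)
    [AddCommGroup M] [Module k M] [Module (TakeuchiSmash k H A H) M]
    [IsScalarTower k (TakeuchiSmash k H A H) M]
    [AddCommGroup X] [Module k X] [Module B X] [IsScalarTower k B X] :
    TakeuchiSmash k H A B →ₐ[k] Module.End k (M ⊗[k] X) :=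
  (Module.endTensorEndAlgHom (R := k) (S := k) (A := k) (M := M) (N := X)).comp
    ((Algebra.TensorProduct.map (Algebra.lsmul k k M) (Algebra.lsmul k k X)).comp
      (toTensor k H A B))

/-- `Hom_A(M, T)`, for `M` a left `A # H`-module and `T` a left `A # B`-module. -/
def homA (M T : Type u)
    [AddCommGroup M] [Module k M] [Module (TakeuchiSmash k H A H) M]
    [AddCommGroup T] [Module k T] [Module (TakeuchiSmash k H A B) T]
    [IsScalarTower k (TakeuchiSmash k H A B) T] :
    Submodule k (M →ₗ[k] T) where
  carrier := {f | ∀ (a : A) (m : M), f (inl k H A H a • m) = inl k H A B a • f m}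
  add_mem' hf hg a m := by simp [hf a m, hg a m]
  zero_mem' a m := by simp
  smul_mem' c f hf a m := by
    simp only [LinearMap.smul_apply, hf a m]
    rw [← algebraMap_smul (TakeuchiSmash k H A B) c, ← algebraMap_smul (TakeuchiSmash k H A B) c,
      ← mul_smul, ← mul_smul, Algebra.commutes]

/-- The left `A # B`-module `M # X`, with underlying space `M ⊗ X`. -/
def SmashModule (M X : Type u)
    [AddCommGroup M] [Module k M] [Module (TakeuchiSmash k H A H) M]
    [IsScalarTower k (TakeuchiSmash k H A H) M]
    [AddCommGroup X] [Module k X] [Module B X] [IsScalarTower k B X] : Type u :=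
  M ⊗[k] X

/-- The left `B`-module `Hom_A(M, T)`. -/
def HomModule (M T : Type u)
    [AddCommGroup M] [Module k M] [Module (TakeuchiSmash k H A H) M]
    [IsScalarTower k (TakeuchiSmash k H A H) M]
    [AddCommGroup T] [Module k T] [Module (TakeuchiSmash k H A B) T]
    [IsScalarTower k (TakeuchiSmash k H A B) T] : Type u :=
  homA k H A B M T

section

variable (M X T : Type u)
    [AddCommGroup M] [Module k M] [Module (TakeuchiSmash k H A H) M]
    [IsScalarTower k (TakeuchiSmash k H A H) M]
    [AddCommGroup X] [Module k X] [Module B X] [IsScalarTower k B X]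
    [AddCommGroup T] [Module k T] [Module (TakeuchiSmash k H A B) T]
    [IsScalarTower k (TakeuchiSmash k H A B) T]

noncomputable instance : AddCommGroup (SmashModule k H A B M X) :=
  inferInstanceAs (AddCommGroup (M ⊗[k] X))

noncomputable instance : Module (TakeuchiSmash k H A B) (SmashModule k H A B M X) :=
  Module.compHom (M ⊗[k] X) (tensorRep k H A B M X).toRingHom

noncomputable instance : AddCommGroup (HomModule k H A B M T) :=
  inferInstanceAs (AddCommGroup (homA k H A B M T))

end

/-- The functor `M # -` from left `B`-modules to left `A # B`-modules. -/
noncomputable def smashFunctor (M : ModuleCat.{u} (TakeuchiSmash k H A H)) :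
    ModuleCat.{u} B ⥤ ModuleCat.{u} (TakeuchiSmash k H A B) where
  obj X := ModuleCat.of _ (SmashModule k H A B M X)
  map {X X'} f := ModuleCat.ofHom
    { toFun := (f.hom.restrictScalars k).lTensor M
      map_add' := map_add _
      map_smul' := fun s v => by
        have key : ∀ v : M ⊗[k] X,
            (f.hom.restrictScalars k).lTensor M (tensorRep k H A B M X s v) =
              tensorRep k H A B M X' s ((f.hom.restrictScalars k).lTensor M v) := by
          intro v
          simp only [tensorRep, AlgHom.comp_apply]
          generalize toTensor k H A B s = w
          induction w with
          | zero => simp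
          | add x y hx hy => simp only [map_add, hx, hy, LinearMap.add_apply]
          | tmul p b =>
            induction v with
            | zero => simp
            | add x y hx hy => simp only [map_add, hx, hy]
            | tmul m x => simp [Module.endTensorEndAlgHom_apply]
        exact key v }
  map_id X := ModuleCat.hom_ext (LinearMap.ext fun v =>
    LinearMap.congr_fun (LinearMap.lTensor_id M X (R := k)) v)
  map_comp f g := ModuleCat.hom_ext (LinearMap.ext fun v =>
    LinearMap.congr_fun (LinearMap.lTensor_comp M (g.hom.restrictScalars k)
      (f.hom.restrictScalars k)) v)

variable [HasBijectiveAntipode k H]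

/-- The action of `H ⊗ B` on `Hom_k(M, T)`: `((h ⊗ b) f)(m) = b f(S⁻¹(h) m)`. -/
noncomputable def homRepAux (M T : Type u)
    [AddCommGroup M] [Module k M] [Module (TakeuchiSmash k H A H) M]
    [IsScalarTower k (TakeuchiSmash k H A H) M]
    [AddCommGroup T] [Module k T] [Module (TakeuchiSmash k H A B) T]
    [IsScalarTower k (TakeuchiSmash k H A B) T] :
    H ⊗[k] B →ₐ[k] Module.End k (M →ₗ[k] T) :=
  Algebra.TensorProduct.lift
    (AlgHom.ofLinearMap
      ((LinearMap.llcomp k M M T).flip ∘ₗ (Algebra.lsmul k k M).toLinearMap ∘ₗ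
        (inr k H A H).toLinearMap ∘ₗ sinv k)
      (by ext; simp) (by intros; ext; simp [sinv_mul]))
    (AlgHom.ofLinearMap
      (LinearMap.llcomp k M T T ∘ₗ (Algebra.lsmul k k T).toLinearMap ∘ₗ
        (inr k H A B).toLinearMap)
      (by ext; simp) (by intros; ext; simp))
    (fun h b => by
      change _ = _
      ext; simp)

variable {k H A B} in
@[simp] lemma homRepAux_tmul (M T : Type u)
    [AddCommGroup M] [Module k M] [Module (TakeuchiSmash k H A H) M]
    [IsScalarTower k (TakeuchiSmash k H A H) M]
    [AddCommGroup T] [Module k T] [Module (TakeuchiSmash k H A B) T]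
    [IsScalarTower k (TakeuchiSmash k H A B) T] (h : H) (b : B) (f : M →ₗ[k] T) (m : M) :
    homRepAux k H A B M T (h ⊗ₜ b) f m = inr k H A B b • f (inr k H A H (sinv k h) • m) := by
  simp [homRepAux]

lemma homRepAux_mem (M T : Type u)
    [AddCommGroup M] [Module k M] [Module (TakeuchiSmash k H A H) M]
    [IsScalarTower k (TakeuchiSmash k H A H) M]
    [AddCommGroup T] [Module k T] [Module (TakeuchiSmash k H A B) T]
    [IsScalarTower k (TakeuchiSmash k H A B) T] (b : B) (f : M →ₗ[k] T)
    (hf : f ∈ homA k H A B M T) :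
    homRepAux k H A B M T (HComoduleAlgebra.coact b) f ∈ homA k H A B M T := by
  intro a m
  let Φ : H ⊗[k] (H ⊗[k] B) →ₗ[k] T :=
    TensorProduct.lift (LinearMap.mk₂ k (fun h w =>
      TensorProduct.lift ((LinearMap.mul k (TakeuchiSmash k H A B)).flip.compl₁₂
        ((inl k H A B).toLinearMap ∘ₗ
        (HModuleAlgebra.act (k := k) (H := H) (A := A)).toLinearMap.flip a ∘ₗ sinv k)
        (inr k H A B).toLinearMap) w • f (inr k H A H (sinv k h) • m))
      (by intros; simp [add_smul]) (by intro c h w; simp [smul_comm _ c])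
      (by intros; simp only [map_add, add_smul]) (by intros; simp))
  have h1 : ∀ u : H ⊗[k] B, inl k H A B a • homRepAux k H A B M T u f m =
      Φ ((HComoduleAlgebra.coact (k := k) (H := H)).toLinearMap.lTensor H u) := by
    intro u
    induction u with
    | zero => simp
    | add x y hx hy => simp only [map_add, ← hx, ← hy, LinearMap.add_apply, smul_add]
    | tmul h d =>
      rw [homRepAux_tmul, LinearMap.lTensor_tmul]
      simp only [Φ, TensorProduct.lift.tmul, LinearMap.mk₂_apply, AlgHom.toLinearMap_apply]
      rw [sum_inr_mul_inl, mul_smul]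
  have h2 : ∀ w : H ⊗[k] H, ∀ d : B, Φ (TensorProduct.assoc k H H B (w ⊗ₜ d)) =
      inr k H A B d • f (TensorProduct.lift
        ((LinearMap.mul k (TakeuchiSmash k H A H)).flip.compl₁₂
        ((inr k H A H).toLinearMap ∘ₗ sinv k)
        ((inl k H A H).toLinearMap ∘ₗ
          (HModuleAlgebra.act (k := k) (H := H) (A := A)).toLinearMap.flip a ∘ₗ sinv k)) w • m) := by
    intro w d
    induction w with
    | zero => simp
    | add x y hx hy => simp only [TensorProduct.add_tmul, map_add, hx, hy, add_smul, smul_add]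
    | tmul g g' => simp [Φ, mul_smul, hf _ _]
  rw [h1, ← HComoduleAlgebra.coact_coassoc]
  generalize HComoduleAlgebra.coact (k := k) (H := H) b = u
  induction u with
  | zero => simp
  | add x y hx hy => simp only [map_add, hx, hy, LinearMap.add_apply]
  | tmul h d => rw [LinearMap.rTensor_tmul, h2, ← inr_sinv_mul_inl, mul_smul, homRepAux_tmul]

/-- The action of `B` on `Hom_A(M, T)`: `(b ⇀ f)(m) = ∑ b₀ f(S⁻¹(b₋₁) ⇀ m)`. -/
noncomputable def homRep (M T : Type u)
    [AddCommGroup M] [Module k M] [Module (TakeuchiSmash k H A H) M]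
    [IsScalarTower k (TakeuchiSmash k H A H) M]
    [AddCommGroup T] [Module k T] [Module (TakeuchiSmash k H A B) T]
    [IsScalarTower k (TakeuchiSmash k H A B) T] :
    B →ₐ[k] Module.End k (homA k H A B M T) :=
  AlgHom.ofLinearMap
    { toFun := fun b => (homRepAux k H A B M T (HComoduleAlgebra.coact b)).restrict
        (fun f hf => homRepAux_mem k H A B M T b f hf)
      map_add' := by intros; ext; simp
      map_smul' := by intros; ext; simp }
    (by ext; simp) (by intros; ext; simp)

noncomputable instance (M T : Type u)
    [AddCommGroup M] [Module k M] [Module (TakeuchiSmash k H A H) M]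
    [IsScalarTower k (TakeuchiSmash k H A H) M]
    [AddCommGroup T] [Module k T] [Module (TakeuchiSmash k H A B) T]
    [IsScalarTower k (TakeuchiSmash k H A B) T] : Module B (HomModule k H A B M T) :=
  Module.compHom (homA k H A B M T) (homRep k H A B M T).toRingHom

/-- The functor `Hom_A(M, -)` from left `A # B`-modules to left `B`-modules. -/
noncomputable def homFunctor (M : ModuleCat.{u} (TakeuchiSmash k H A H)) :
    ModuleCat.{u} (TakeuchiSmash k H A B) ⥤ ModuleCat.{u} B where
  obj T := ModuleCat.of _ (HomModule k H A B M T)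
  map {T T'} g := ModuleCat.ofHom
    { toFun := fun f => ⟨g.hom.restrictScalars k ∘ₗ f.1, fun a m => by simp [f.2 a m]⟩
      map_add' := fun f f' => Subtype.ext (LinearMap.comp_add f.1 f'.1 (g.hom.restrictScalars k))
      map_smul' := fun b f => by
        apply Subtype.ext
        change g.hom.restrictScalars k ∘ₗ homRepAux k H A B M T (HComoduleAlgebra.coact b) f.1 =
          homRepAux k H A B M T' (HComoduleAlgebra.coact b) (g.hom.restrictScalars k ∘ₗ f.1)
        generalize HComoduleAlgebra.coact (k := k) (H := H) b = u
        induction u with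
        | zero => simp
        | add x y hx hy => simp only [map_add, ← hx, ← hy, LinearMap.add_apply, LinearMap.comp_add]
        | tmul h d => ext; simp }

instance (M : ModuleCat.{u} (TakeuchiSmash k H A H)) : (homFunctor k H A B M).Additive where
  map_add {_ _ f g} := ModuleCat.hom_ext (LinearMap.ext fun v =>
    Subtype.ext (LinearMap.add_comp v.1 (g.hom.restrictScalars k) (f.hom.restrictScalars k)))

/-- `Ext_A^q(M, -)` with its left `B`-module structure, from left `A # B`-modules to left
`B`-modules: the `q`-th cohomology of the complex of `B`-modules `Hom_A(M, I^•)`, for an injective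
resolution `I^•` of `T` in the category of left `A # B`-modules. -/
noncomputable def extModule (M : ModuleCat.{u} (TakeuchiSmash k H A H)) (q : ℕ) :
    ModuleCat.{u} (TakeuchiSmash k H A B) ⥤ ModuleCat.{u} B :=
  (homFunctor k H A B M).rightDerived q

end left

end TakeuchiSmash

/-- Right multiplication `r ↦ (v ↦ v r)` on a right `R`-module `V`. -/
noncomputable def rmul (k R V : Type u) [Field k] [Ring R] [Algebra k R] [AddCommGroup V]
    [Module k V] [Module Rᵐᵒᵖ V] [IsScalarTower k Rᵐᵒᵖ V] : R →ₗ[k] Module.End k V :=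
  (Algebra.lsmul k k V : Rᵐᵒᵖ →ₐ[k] Module.End k V).toLinearMap ∘ₗ
    (MulOpposite.opLinearEquiv k : R ≃ₗ[k] Rᵐᵒᵖ).toLinearMap

@[simp] lemma rmul_apply (k R V : Type u) [Field k] [Ring R] [Algebra k R] [AddCommGroup V]
    [Module k V] [Module Rᵐᵒᵖ V] [IsScalarTower k Rᵐᵒᵖ V] (r : R) (v : V) :
    rmul k R V r v = MulOpposite.op r • v := rfl

/-- An object `Y` of `^H M_B`: a right `B`-module with a left `H`-coaction (written
`y ↦ ∑ y₋₁ ⊗ y₀`) such that `∑ (y b)₋₁ ⊗ (y b)₀ = ∑ y₋₁ b₋₁ ⊗ y₀ b₀`. -/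
class RightHopfModule (k H B Y : Type u) [Field k] [Ring H] [HopfAlgebra k H]
    [Ring B] [Algebra k B] [HComoduleAlgebra k H B]
    [AddCommGroup Y] [Module k Y] [Module Bᵐᵒᵖ Y] [IsScalarTower k Bᵐᵒᵖ Y] where
  coact : Y →ₗ[k] H ⊗[k] Y
  coact_coassoc : ∀ y : Y,
    TensorProduct.assoc k H H Y ((Coalgebra.comul (R := k)).rTensor Y (coact y)) =
      coact.lTensor H (coact y)
  coact_counit : ∀ y : Y,
    TensorProduct.lid k Y ((Coalgebra.counit (R := k) (A := H)).rTensor Y (coact y)) = y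
  coact_smul : ∀ (b : B) (y : Y), coact (MulOpposite.op b • y) =
    TensorProduct.map₂ (LinearMap.mul k H) (rmul k B Y).flip (coact y)
      (HComoduleAlgebra.coact (k := k) (H := H) b)

namespace TakeuchiSmash

open HopfAux MulOpposite

/-! ### Right modules -/

section right

variable (k H A B : Type u) [Field k] [Ring H] [HopfAlgebra k H]
  [Ring A] [Algebra k A] [HModuleAlgebra k H A] [Ring B] [Algebra k B] [HComoduleAlgebra k H B]

section rep

variable (N Y : Type u)
  [AddCommGroup N] [Module k N] [Module Aᵐᵒᵖ N] [IsScalarTower k Aᵐᵒᵖ N]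
  [AddCommGroup Y] [Module k Y] [Module Bᵐᵒᵖ Y] [IsScalarTower k Bᵐᵒᵖ Y]
  [RightHopfModule k H B Y]

/-- `h ⊗ y ↦ n (h ⇀ a) ⊗ y`. -/
noncomputable def rightAux (n : N) (a : A) : H ⊗[k] Y →ₗ[k] N ⊗[k] Y :=
  ((rmul k A N).flip n ∘ₗ
    (HModuleAlgebra.act (k := k) (H := H) (A := A)).toLinearMap.flip a).rTensor Y

variable {k H A N Y} in
@[simp] lemma rightAux_tmul (n : N) (a : A) (h : H) (y : Y) :
    rightAux k H A N Y n a (h ⊗ₜ y) = (op (HModuleAlgebra.act (k := k) h a) • n) ⊗ₜ y := by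
  simp [rightAux]

/-- `(n ⊗ y) a = ∑ n (y₋₁ ⇀ a) ⊗ y₀`. -/
noncomputable def rightActA : A →ₗ[k] Module.End k (N ⊗[k] Y) where
  toFun a := TensorProduct.lift (LinearMap.mk₂ k
    (fun n y => rightAux k H A N Y n a (RightHopfModule.coact (H := H) (B := B) y))
    (by intros; simp [rightAux, LinearMap.add_comp, LinearMap.rTensor_add])
    (by intros; simp [rightAux, LinearMap.smul_comp, LinearMap.rTensor_smul])
    (by intros; simp) (by intros; simp))
  map_add' x y := by
    ext n z
    simp [rightAux, LinearMap.comp_add, LinearMap.rTensor_add]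
  map_smul' c x := by
    ext n z
    simp [rightAux, LinearMap.comp_smul, LinearMap.rTensor_smul]

variable {k H A B N Y} in
@[simp] lemma rightActA_tmul (a : A) (n : N) (y : Y) :
    rightActA k H A B N Y a (n ⊗ₜ y) =
      rightAux k H A N Y n a (RightHopfModule.coact (H := H) (B := B) y) := rfl

lemma rightActA_mul (a a' : A) : rightActA k H A B N Y (a * a') =
    rightActA k H A B N Y a' * rightActA k H A B N Y a := by
  ext n y
  let Φ : H ⊗[k] (H ⊗[k] Y) →ₗ[k] N ⊗[k] Y :=
    TensorProduct.lift (LinearMap.mk₂ k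
      (fun h w => rightAux k H A N Y (op (HModuleAlgebra.act (k := k) h a) • n) a' w)
      (by intros; simp [rightAux, add_smul, LinearMap.add_comp, LinearMap.rTensor_add])
      (by intros; simp [rightAux, LinearMap.smul_comp, LinearMap.rTensor_smul])
      (by intros; simp) (by intros; simp))
  have h1 : ∀ u : H ⊗[k] Y, rightActA k H A B N Y a' (rightAux k H A N Y n a u) =
      Φ ((RightHopfModule.coact (k := k) (H := H) (B := B)).lTensor H u) := by
    intro u
    induction u with
    | zero => simp
    | add x y hx hy => simp only [map_add, hx, hy]
    | tmul h d => rw [rightAux_tmul, rightActA_tmul, LinearMap.lTensor_tmul]; rfl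
  have h2 : ∀ w : H ⊗[k] H, ∀ d : Y, Φ (TensorProduct.assoc k H H Y (w ⊗ₜ d)) =
      (op (LinearMap.mul' k A (TensorProduct.map
        ((HModuleAlgebra.act (k := k) (H := H) (A := A)).toLinearMap.flip a)
        ((HModuleAlgebra.act (k := k) (H := H) (A := A)).toLinearMap.flip a') w)) • n) ⊗ₜ d := by
    intro w d
    induction w with
    | zero => simp
    | add x y hx hy =>
      simp only [TensorProduct.add_tmul, map_add, hx, hy, MulOpposite.op_add, add_smul]
    | tmul g g' =>
      change rightAux k H A N Y (op (HModuleAlgebra.act (k := k) g a) • n) a' (g' ⊗ₜ d) = _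
      simp [mul_smul]
  simp only [TensorProduct.AlgebraTensorModule.curry_apply, TensorProduct.curry_apply,
    LinearMap.coe_restrictScalars, Module.End.mul_apply, rightActA_tmul]
  rw [h1, ← RightHopfModule.coact_coassoc]
  generalize RightHopfModule.coact (k := k) (H := H) (B := B) y = u
  induction u with
  | zero => simp
  | add x y hx hy => simp only [map_add, hx, hy]
  | tmul h d => rw [LinearMap.rTensor_tmul, h2, ← HModuleAlgebra.act_mul]; simp

lemma rightActA_one : rightActA k H A B N Y 1 = 1 := by
  ext n y
  have : ∀ u : H ⊗[k] Y, rightAux k H A N Y n 1 u =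
      n ⊗ₜ TensorProduct.lid k Y ((Coalgebra.counit (R := k) (A := H)).rTensor Y u) := by
    intro u
    induction u with
    | zero => simp
    | add x y hx hy => simp only [map_add, hx, hy, TensorProduct.tmul_add]
    | tmul h d =>
      simp [HModuleAlgebra.act_one, Algebra.algebraMap_eq_smul_one, TensorProduct.smul_tmul]
  simp [this, RightHopfModule.coact_counit]

/-- The right action of `A # B` on `N ⊗ Y`, for `N` a right `A`-module and `Y` in `^H M_B`:
`(n ⊗ y)(a # b) = ∑ n (y₋₁ ⇀ a) ⊗ y₀ b`. -/
noncomputable def rightTensorRep :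
    (TakeuchiSmash k H A B)ᵐᵒᵖ →ₐ[k] Module.End k (N ⊗[k] Y) :=
  AlgHom.opComm (lift
    (AlgHom.ofLinearMap ((opLinearEquiv k).toLinearMap ∘ₗ rightActA k H A B N Y)
      (by simp [rightActA_one])
      (by intros; simp [rightActA_mul]))
    (AlgHom.ofLinearMap ((opLinearEquiv k).toLinearMap ∘ₗ
        LinearMap.lTensorHom N ∘ₗ rmul k B Y)
      (by
        apply unop_injective
        ext; simp)
      (by
        intros
        apply unop_injective
        ext; simp [mul_smul]))
    (by
      intro a b
      apply unop_injective
      ext n y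
      have h1 : ∀ u : H ⊗[k] B,
          (pair ((opLinearEquiv k).toLinearMap ∘ₗ rightActA k H A B N Y)
            ((opLinearEquiv k).toLinearMap ∘ₗ LinearMap.lTensorHom N ∘ₗ rmul k B Y)
            (rT k H A B a u)).unop (n ⊗ₜ y) =
          rightAux k H A N Y n a (TensorProduct.map₂ (LinearMap.mul k H) (rmul k B Y).flip
            (RightHopfModule.coact (H := H) (B := B) y) u) := by
        intro u
        induction u with
        | zero => simp
        | add x y hx hy => simp only [map_add, MulOpposite.unop_add, LinearMap.add_apply, hx, hy]
        | tmul h d =>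
          simp only [rT_tmul, pair_tmul, LinearMap.comp_apply, LinearEquiv.coe_coe,
            coe_opLinearEquiv, unop_mul, unop_op, Module.End.mul_apply, rightActA_tmul]
          generalize RightHopfModule.coact (k := k) (H := H) (B := B) y = w
          induction w with
          | zero => simp
          | add x y hx hy => simp only [map_add, LinearMap.add_apply, hx, hy]
          | tmul g z => simp
      rw [twist_eq]
      refine Eq.trans ?_ (h1 _).symm
      rw [← RightHopfModule.coact_smul]
      rfl))

end rep

/-- The right `A # B`-module `N # Y`, with underlying space `N ⊗ Y`. -/
def RightSmashModule (N Y : Type u)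
    [AddCommGroup N] [Module k N] [Module Aᵐᵒᵖ N] [IsScalarTower k Aᵐᵒᵖ N]
    [AddCommGroup Y] [Module k Y] [Module Bᵐᵒᵖ Y] [IsScalarTower k Bᵐᵒᵖ Y]
    [RightHopfModule k H B Y] : Type u :=
  N ⊗[k] Y

noncomputable instance (N Y : Type u)
    [AddCommGroup N] [Module k N] [Module Aᵐᵒᵖ N] [IsScalarTower k Aᵐᵒᵖ N]
    [AddCommGroup Y] [Module k Y] [Module Bᵐᵒᵖ Y] [IsScalarTower k Bᵐᵒᵖ Y]
    [RightHopfModule k H B Y] : AddCommGroup (RightSmashModule k H A B N Y) :=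
  inferInstanceAs (AddCommGroup (N ⊗[k] Y))

noncomputable instance (N Y : Type u)
    [AddCommGroup N] [Module k N] [Module Aᵐᵒᵖ N] [IsScalarTower k Aᵐᵒᵖ N]
    [AddCommGroup Y] [Module k Y] [Module Bᵐᵒᵖ Y] [IsScalarTower k Bᵐᵒᵖ Y]
    [RightHopfModule k H B Y] :
    Module (TakeuchiSmash k H A B)ᵐᵒᵖ (RightSmashModule k H A B N Y) :=
  Module.compHom (N ⊗[k] Y) (rightTensorRep k H A B N Y).toRingHom

/-- The functor `- # Y` from right `A`-modules to right `A # B`-modules. -/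
noncomputable def rightSmashFunctor (Y : Type u)
    [AddCommGroup Y] [Module k Y] [Module Bᵐᵒᵖ Y] [IsScalarTower k Bᵐᵒᵖ Y]
    [RightHopfModule k H B Y] :
    ModuleCat.{u} Aᵐᵒᵖ ⥤ ModuleCat.{u} (TakeuchiSmash k H A B)ᵐᵒᵖ where
  obj N := ModuleCat.of _ (RightSmashModule k H A B N Y)
  map {N N'} f := ModuleCat.ofHom
    { toFun := (f.hom.restrictScalars k).rTensor Y
      map_add' := map_add _
      map_smul' := fun s v => by
        have h1 : ∀ (n : N) (a : A) (u : H ⊗[k] Y),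
            (f.hom.restrictScalars k).rTensor Y (rightAux k H A N Y n a u) =
              rightAux k H A N' Y (f.hom n) a u := by
          intro n a u
          induction u with
          | zero => simp
          | add x y hx hy => simp only [map_add, hx, hy]
          | tmul h d => simp
        have h2 : ∀ (x : A ⊗[k] B) (v : N ⊗[k] Y),
            (f.hom.restrictScalars k).rTensor Y (rightTensorRep k H A B N Y
              (op (ofTensor k H A B x)) v) =
              rightTensorRep k H A B N' Y (op (ofTensor k H A B x))
                ((f.hom.restrictScalars k).rTensor Y v) := by
          intro x v
          induction x with
          | zero =>
            change (f.hom.restrictScalars k).rTensor Y (rightTensorRep k H A B N Y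
              (op (0 : TakeuchiSmash k H A B)) v) = rightTensorRep k H A B N' Y
                (op (0 : TakeuchiSmash k H A B)) ((f.hom.restrictScalars k).rTensor Y v)
            simp
          | add x y hx hy =>
            have : (op (ofTensor k H A B (x + y))) =
              op (ofTensor k H A B x) + op (ofTensor k H A B y) := rfl
            rw [this, map_add, map_add, LinearMap.add_apply, LinearMap.add_apply, map_add, hx, hy]
          | tmul a b =>
            induction v with
            | zero => simp
            | add x y hx hy => simp only [map_add, hx, hy]
            | tmul n y =>
              have h3 : ∀ (N : ModuleCat.{u} Aᵐᵒᵖ) (n : N), rightTensorRep k H A B N Y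
                  (op (ofTensor k H A B (a ⊗ₜ b))) (n ⊗ₜ y) =
                  (rmul k B Y b).lTensor N (rightAux k H A N Y n a
                    (RightHopfModule.coact (H := H) (B := B) y)) := fun N n => rfl
              rw [h3, LinearMap.rTensor_tmul, h3, LinearMap.coe_restrictScalars, ← h1]
              generalize rightAux k H A N Y n a
                (RightHopfModule.coact (H := H) (B := B) y) = w
              induction w with
              | zero => simp
              | add x y hx hy => simp only [map_add, hx, hy]
              | tmul n z => simp
        exact h2 (unop s) v }
  map_id N := ModuleCat.hom_ext (LinearMap.ext fun v =>
    LinearMap.congr_fun (LinearMap.rTensor_id Y N (R := k)) v)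
  map_comp f g := ModuleCat.hom_ext (LinearMap.ext fun v =>
    LinearMap.congr_fun (LinearMap.rTensor_comp Y (g.hom.restrictScalars k)
      (f.hom.restrictScalars k)) v)

/-- `Hom_{B^op}(Y, T)`, for `Y` a right `B`-module and `T` a right `A # B`-module. -/
def homB (Y T : Type u)
    [AddCommGroup Y] [Module k Y] [Module Bᵐᵒᵖ Y]
    [AddCommGroup T] [Module k T] [Module (TakeuchiSmash k H A B)ᵐᵒᵖ T]
    [IsScalarTower k (TakeuchiSmash k H A B)ᵐᵒᵖ T] :
    Submodule k (Y →ₗ[k] T) where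
  carrier := {f | ∀ (b : B) (y : Y), f (op b • y) = op (inr k H A B b) • f y}
  add_mem' hf hg b y := by simp [hf b y, hg b y]
  zero_mem' b y := by simp
  smul_mem' c f hf b y := by
    simp only [LinearMap.smul_apply, hf b y]
    rw [smul_comm]

variable [HasBijectiveAntipode k H]

section homrep

variable (Y T : Type u)
  [AddCommGroup Y] [Module k Y] [Module Bᵐᵒᵖ Y] [IsScalarTower k Bᵐᵒᵖ Y]
  [RightHopfModule k H B Y]
  [AddCommGroup T] [Module k T] [Module (TakeuchiSmash k H A B)ᵐᵒᵖ T]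
  [IsScalarTower k (TakeuchiSmash k H A B)ᵐᵒᵖ T]

/-- `h ⊗ y ↦ f(y) (S⁻¹(h) ⇀ a)`. -/
noncomputable def rightHomAux (a : A) (f : Y →ₗ[k] T) : H ⊗[k] Y →ₗ[k] T :=
  TensorProduct.lift (LinearMap.lcomp k T f ∘ₗ rmul k (TakeuchiSmash k H A B) T ∘ₗ
    (inl k H A B).toLinearMap ∘ₗ
    (HModuleAlgebra.act (k := k) (H := H) (A := A)).toLinearMap.flip a ∘ₗ sinv k)

variable {k H A B Y T} in
@[simp] lemma rightHomAux_tmul (a : A) (f : Y →ₗ[k] T) (h : H) (y : Y) :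
    rightHomAux k H A B Y T a f (h ⊗ₜ y) =
      op (inl k H A B (HModuleAlgebra.act (k := k) (sinv k h) a)) • f y := by
  simp [rightHomAux]

/-- `(f a)(y) = ∑ f(y₀) (S⁻¹(y₋₁) ⇀ a)` on `Hom_k(Y, T)`. -/
noncomputable def rightHomRepAux : A →ₗ[k] Module.End k (Y →ₗ[k] T) :=
  LinearMap.mk₂ k (fun a f => rightHomAux k H A B Y T a f ∘ₗ
      RightHopfModule.coact (k := k) (H := H) (B := B))
    (fun a a' f => by
      rw [← LinearMap.add_comp]; congr 1; ext; simp [add_smul])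
    (fun c a f => by
      rw [← LinearMap.smul_comp]; congr 1; ext; simp)
    (fun a f f' => by
      rw [← LinearMap.add_comp]; congr 1; ext; simp)
    (fun c a f => by
      rw [← LinearMap.smul_comp]; congr 1; ext; simp [smul_comm _ c])

lemma rightHomRepAux_apply (a : A) (f : Y →ₗ[k] T) (y : Y) :
    rightHomRepAux k H A B Y T a f y =
      rightHomAux k H A B Y T a f (RightHopfModule.coact (k := k) (H := H) (B := B) y) := rfl

lemma rightHomRepAux_one : rightHomRepAux k H A B Y T 1 = 1 := by
  ext f y
  rw [rightHomRepAux_apply]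
  have : ∀ u : H ⊗[k] Y, rightHomAux k H A B Y T 1 f u =
      f (TensorProduct.lid k Y ((Coalgebra.counit (R := k) (A := H)).rTensor Y u)) := by
    intro u
    induction u with
    | zero => simp
    | add x y hx hy => simp only [map_add, hx, hy]
    | tmul h d =>
      simp [HModuleAlgebra.act_one, Algebra.algebraMap_eq_smul_one, counit_sinv]
  rw [this, RightHopfModule.coact_counit]; rfl

lemma rightHomRepAux_mul (a a' : A) : rightHomRepAux k H A B Y T (a * a') =
    rightHomRepAux k H A B Y T a' * rightHomRepAux k H A B Y T a := by
  ext f y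
  let Φ : H ⊗[k] (H ⊗[k] Y) →ₗ[k] T :=
    TensorProduct.lift (LinearMap.mk₂ k
      (fun h w => op (inl k H A B (HModuleAlgebra.act (k := k) (sinv k h) a')) •
        rightHomAux k H A B Y T a f w)
      (by intros; simp [add_smul]) (by intros; simp)
      (by intros; simp) (by intro c h w; simp [smul_comm _ c]))
  have h1 : ∀ u : H ⊗[k] Y, rightHomAux k H A B Y T a' (rightHomRepAux k H A B Y T a f) u =
      Φ ((RightHopfModule.coact (k := k) (H := H) (B := B)).lTensor H u) := by
    intro u
    induction u with
    | zero => simp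
    | add x y hx hy => simp only [map_add, hx, hy]
    | tmul h d => simp [Φ, rightHomRepAux_apply]
  have h2 : ∀ w : H ⊗[k] H, ∀ d : Y, Φ (TensorProduct.assoc k H H Y (w ⊗ₜ d)) =
      op (inl k H A B (LinearMap.mul' k A (TensorProduct.map
        ((HModuleAlgebra.act (k := k) (H := H) (A := A)).toLinearMap.flip a)
        ((HModuleAlgebra.act (k := k) (H := H) (A := A)).toLinearMap.flip a')
        (TensorProduct.comm k H H (TensorProduct.map (sinv k) (sinv k) w))))) • f d := by
    intro w d
    induction w with
    | zero => simp
    | add x y hx hy =>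
      simp only [TensorProduct.add_tmul, map_add, hx, hy, MulOpposite.op_add, add_smul]
    | tmul g g' => simp [Φ, mul_smul]
  rw [Module.End.mul_apply, rightHomRepAux_apply, rightHomRepAux_apply, h1,
    ← RightHopfModule.coact_coassoc]
  generalize RightHopfModule.coact (k := k) (H := H) (B := B) y = u
  induction u with
  | zero => simp
  | add x y hx hy => simp only [map_add, hx, hy]
  | tmul h d =>
    rw [LinearMap.rTensor_tmul, h2, ← comul_sinv, ← HModuleAlgebra.act_mul, rightHomAux_tmul]

lemma rightHomRepAux_mem (a : A) (f : Y →ₗ[k] T) (hf : f ∈ homB k H A B Y T) :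
    rightHomRepAux k H A B Y T a f ∈ homB k H A B Y T := by
  intro b y
  rw [rightHomRepAux_apply, rightHomRepAux_apply, RightHopfModule.coact_smul]
  generalize RightHopfModule.coact (k := k) (H := H) (B := B) y = u
  induction u with
  | zero => simp
  | add x y hx hy => simp only [map_add, LinearMap.add_apply, hx, hy, smul_add]
  | tmul g z =>
    rw [rightHomAux_tmul, ← mul_smul, ← op_mul, ← sum_inr_mul_inl]
    generalize HComoduleAlgebra.coact (k := k) (H := H) b = w
    induction w with
    | zero => simp
    | add x y hx hy => simp only [map_add, hx, hy, MulOpposite.op_add, add_smul]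
    | tmul h d => simp [hf _ _, sinv_mul, mul_smul]

/-- The right action of `A` on `Hom_{B^op}(Y, T)`: `(f a)(y) = ∑ f(y₀) (S⁻¹(y₋₁) ⇀ a)`. -/
noncomputable def rightHomRep : Aᵐᵒᵖ →ₐ[k] Module.End k (homB k H A B Y T) :=
  AlgHom.ofLinearMap
    { toFun := fun a => (rightHomRepAux k H A B Y T a.unop).restrict
        (fun f hf => rightHomRepAux_mem k H A B Y T a.unop f hf)
      map_add' := by intros; ext; simp
      map_smul' := by intros; ext; simp }
    (by ext; simp [rightHomRepAux_one]) (by intros; ext; simp [rightHomRepAux_mul])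

/-- The right `A`-module `Hom_{B^op}(Y, T)`. -/
def RightHomModule : Type u := homB k H A B Y T

noncomputable instance : AddCommGroup (RightHomModule k H A B Y T) :=
  inferInstanceAs (AddCommGroup (homB k H A B Y T))

noncomputable instance : Module Aᵐᵒᵖ (RightHomModule k H A B Y T) :=
  Module.compHom (homB k H A B Y T) (rightHomRep k H A B Y T).toRingHom

end homrep

/-- The functor `Hom_{B^op}(Y, -)` from right `A # B`-modules to right `A`-modules. -/
noncomputable def rightHomFunctor (Y : Type u)
    [AddCommGroup Y] [Module k Y] [Module Bᵐᵒᵖ Y] [IsScalarTower k Bᵐᵒᵖ Y]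
    [RightHopfModule k H B Y] :
    ModuleCat.{u} (TakeuchiSmash k H A B)ᵐᵒᵖ ⥤ ModuleCat.{u} Aᵐᵒᵖ where
  obj T := ModuleCat.of _ (RightHomModule k H A B Y T)
  map {T T'} g := ModuleCat.ofHom
    { toFun := fun f => ⟨g.hom.restrictScalars k ∘ₗ f.1, fun b y => by simp [f.2 b y]⟩
      map_add' := fun f f' => Subtype.ext (LinearMap.comp_add f.1 f'.1 (g.hom.restrictScalars k))
      map_smul' := fun a f => by
        apply Subtype.ext
        change g.hom.restrictScalars k ∘ₗ rightHomRepAux k H A B Y T a.unop f.1 =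
          rightHomRepAux k H A B Y T' a.unop (g.hom.restrictScalars k ∘ₗ f.1)
        ext y
        simp only [LinearMap.comp_apply, rightHomRepAux_apply]
        generalize RightHopfModule.coact (k := k) (H := H) (B := B) y = u
        induction u with
        | zero => simp
        | add x y hx hy => simp only [map_add, hx, hy]
        | tmul h d => simp }

instance (Y : Type u)
    [AddCommGroup Y] [Module k Y] [Module Bᵐᵒᵖ Y] [IsScalarTower k Bᵐᵒᵖ Y]
    [RightHopfModule k H B Y] : (rightHomFunctor k H A B Y).Additive where
  map_add {_ _ f g} := ModuleCat.hom_ext (LinearMap.ext fun v =>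
    Subtype.ext (LinearMap.add_comp v.1 (g.hom.restrictScalars k) (f.hom.restrictScalars k)))

/-- `Ext_{B^op}^q(Y, -)` with its right `A`-module structure, from right `A # B`-modules to right
`A`-modules: the `q`-th cohomology of the complex of right `A`-modules `Hom_{B^op}(Y, I^•)`, for an
injective resolution `I^•` of `T` in the category of right `A # B`-modules. -/
noncomputable def rightExtModule (Y : Type u)
    [AddCommGroup Y] [Module k Y] [Module Bᵐᵒᵖ Y] [IsScalarTower k Bᵐᵒᵖ Y]
    [RightHopfModule k H B Y] (q : ℕ) :
    ModuleCat.{u} (TakeuchiSmash k H A B)ᵐᵒᵖ ⥤ ModuleCat.{u} Aᵐᵒᵖ :=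
  (rightHomFunctor k H A B Y).rightDerived q

end right

end TakeuchiSmash

namespace TakeuchiSmash

variable (k H A B : Type u) [Field k] [Ring H] [HopfAlgebra k H]
  [Ring A] [Algebra k A] [HModuleAlgebra k H A] [Ring B] [Algebra k B] [HComoduleAlgebra k H B]

/-- The element `m # x` of `M # X`. -/
noncomputable def smashTmul (M : ModuleCat.{u} (TakeuchiSmash k H A H)) (X : ModuleCat.{u} B) (m : M) (x : X) :
    (smashFunctor k H A B M).obj X :=
  (m ⊗ₜ[k] x : M ⊗[k] X)

/-- The value at `m` of an element of `Hom_A(M, T)`. -/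
noncomputable def homEval [HasBijectiveAntipode k H] (M : ModuleCat.{u} (TakeuchiSmash k H A H))
    (T : ModuleCat.{u} (TakeuchiSmash k H A B)) (f : (homFunctor k H A B M).obj T) (m : M) : T :=
  Subtype.val (p := (· ∈ homA k H A B M T)) f m

/-- The element `n # y` of `N # Y`. -/
noncomputable def rightSmashTmul (Y : Type u) [AddCommGroup Y] [Module k Y] [Module Bᵐᵒᵖ Y]
    [IsScalarTower k Bᵐᵒᵖ Y] [RightHopfModule k H B Y]
    (N : ModuleCat.{u} Aᵐᵒᵖ) (n : N) (y : Y) : (rightSmashFunctor k H A B Y).obj N :=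
  (n ⊗ₜ[k] y : N ⊗[k] Y)

/-- The value at `y` of an element of `Hom_{B^op}(Y, T)`. -/
noncomputable def rightHomEval [HasBijectiveAntipode k H] (Y : Type u) [AddCommGroup Y] [Module k Y]
    [Module Bᵐᵒᵖ Y] [IsScalarTower k Bᵐᵒᵖ Y] [RightHopfModule k H B Y]
    (T : ModuleCat.{u} (TakeuchiSmash k H A B)ᵐᵒᵖ)
    (f : (rightHomFunctor k H A B Y).obj T) (y : Y) : T :=
  Subtype.val (p := (· ∈ homB k H A B Y T)) f y

/-- The restriction of scalars from left `A # B`-modules to left `A`-modules, along `a ↦ a # 1`. -/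
noncomputable abbrev resA : ModuleCat.{u} (TakeuchiSmash k H A B) ⥤ ModuleCat.{u} A :=
  ModuleCat.restrictScalars (inl k H A B).toRingHom

/-- The restriction of scalars from right `A # B`-modules to right `B`-modules,
along `b ↦ 1 # b`. -/
noncomputable abbrev rightResB :
    ModuleCat.{u} (TakeuchiSmash k H A B)ᵐᵒᵖ ⥤ ModuleCat.{u} Bᵐᵒᵖ :=
  ModuleCat.restrictScalars (AlgHom.op (inr k H A B)).toRingHom

end TakeuchiSmash

/-- Convergence `E_2^{p,q} ⇒ V^{p+q}` of a first quadrant cohomological spectral sequence of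
`k`-vector spaces: every `V n` has a decreasing filtration `V n = F⁰ ⊇ F¹ ⊇ ⋯ ⊇ Fⁿ⁺¹ = 0` such
that `F^p V^{p+q} / F^{p+1} V^{p+q} ≅ E_∞^{p,q}`. Here `E_∞^{p,q}` is the stable value, that is,
`E_r^{p,q}` for any `r ≥ 2` with `r > p` and `r > q + 1`: from there on the differentials into and
out of the position `(p, q)` have source, respectively target, outside of the first quadrant. -/
def SpectralSequenceConverges {k : Type u} [Field k]
    (E : E₂CohomologicalSpectralSequenceNat (ModuleCat.{u} k))
    (V : ℕ → Type u) [∀ n, AddCommGroup (V n)] [∀ n, Module k (V n)] : Prop :=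
  ∃ F : ∀ n : ℕ, ℕ → Submodule k (V n),
    (∀ n, Antitone (F n)) ∧ (∀ n, F n 0 = ⊤) ∧ (∀ n, F n (n + 1) = ⊥) ∧
    ∀ (p q : ℕ) (r : ℤ) (hr : 2 ≤ r), (p : ℤ) < r → (q : ℤ) + 1 < r →
      Nonempty ((E.page r hr).X (p, q) ≅
        ModuleCat.of k (F (p + q) p ⧸ (F (p + q) (p + 1)).submoduleOf (F (p + q) p)))

/-! Both halves are instances of the Grothendieck spectral sequence of an adjunction `F ⊣ G` between
abelian categories in which `F` preserves monomorphisms. Here `F` is `M # -` or `- # Y`, whose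
underlying functor is a tensor product over the field `k`, and `G` is the matching Hom functor.
Since `F` preserves monomorphisms, `G` preserves injectives. So if `I` is an injective resolution of
`T`, then `G(I)` is a complex of injectives with cohomology `R^q G(T)`. Write `K` for `G(I)` in the
derived category.

The truncations of `K` form a spectral object, to which the homological functor `Hom(X, -)` is
applied. Its graded pieces are the spaces of morphisms from `X` to shifts of a single cohomology
object, so `E_2^{p,q}` is `Ext^p(X, H^q K) = Ext^p(X, R^q G(T))`. Its abutment is `Hom(X, K[n])`.
The terms of `G(I)` are injective, so this is the space of cocycles `X ⟶ G(I^n)` modulo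
coboundaries. By adjunction these are the cocycles `F(X) ⟶ I^n` modulo coboundaries, that is
`Ext^n(F(X), T)`. As `K` lives in degrees `≥ 0`, the spectral object is first quadrant and
convergence is a matter of exact sequences (`spectralSequenceConverges`). The general result is
`Adjunction.exists_spectralSequence`.

The adjunctions are the tensor-Hom bijection. Linearity passes from one side to the other by two
cancellations in an `H`-comodule, `∑ v₋₁ S⁻¹(v₋₂) ⊗ v₀ = 1 ⊗ v` and `∑ S⁻¹(v₋₁) v₋₂ ⊗ v₀ = 1 ⊗ v`
(`cancel_mul_sinv`, `cancel_sinv_mul`).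

That `R^q Hom_A(M, -)` is the usual `Ext_A^q(M, -)` requires injective `A # B`-modules to remain
injective over `A`. This holds because `A # B` is free as a right `A`-module: `b ⊗ a ↦ (1 # b)(a #
1)` is bijective, with inverse `a # b ↦ ∑ b₀ ⊗ (S⁻¹(b₋₁) ⇀ a)`, by the same cancellations. The same
bijection shows that `A # B` is free as a left `B`-module, which serves right modules
(`preservesInjectiveObjects_restrictScalars`, `exists_rightDerived_equiv_ext`). -/

/-! ### Homological functors applied to spectral objects, and a quotient of images. -/

open Limits Pretriangulated ComposableArrows in
/-- The spectral object in an abelian category obtained by applying a homological functor to a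
spectral object in a triangulated category. -/
noncomputable def CategoryTheory.Triangulated.SpectralObject.mapHomological
    {C ι A : Type*} [Category* C] [Category* ι] [HasZeroObject C]
    [HasShift C ℤ] [Preadditive C] [∀ (n : ℤ), (shiftFunctor C n).Additive] [Pretriangulated C]
    [Category* A] [Abelian A] (X : Triangulated.SpectralObject C ι) (F : C ⥤ A)
    [F.IsHomological] [F.ShiftSequence ℤ] :
    Abelian.SpectralObject A ι where
  H n := X.ω₁ ⋙ F.shift n
  δ' n₀ n₁ h :=
    { app := fun D => F.homologySequenceδ (X.ω₂.obj D) n₀ n₁ h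
      naturality := fun D D' φ =>
        F.homologySequenceδ_naturality (X.ω₂.obj D) (X.ω₂.obj D') (X.ω₂.map φ) n₀ n₁ h }
  exact₁' n₀ n₁ h D :=
    (F.homologySequence_exact₁ _ (X.ω₂_obj_distinguished D) n₀ n₁ h).exact_toComposableArrows
  exact₂' n D :=
    (F.homologySequence_exact₂ _ (X.ω₂_obj_distinguished D) n).exact_toComposableArrows
  exact₃' n₀ n₁ h D :=
    (F.homologySequence_exact₃ _ (X.ω₂_obj_distinguished D) n₀ n₁ h).exact_toComposableArrows

/-- A quotient of `B` by `range i + range δ` is the quotient of the images of `B` and of `A` in a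
module `V` such that the kernel of `B → V` is the range of `δ`. -/
lemma nonempty_linearEquiv_range_quotient {k A B D V E : Type*} [Ring k]
    [AddCommGroup A] [Module k A] [AddCommGroup B] [Module k B] [AddCommGroup D] [Module k D]
    [AddCommGroup V] [Module k V] [AddCommGroup E] [Module k E]
    (i : A →ₗ[k] B) (δ : D →ₗ[k] B) (j : B →ₗ[k] V) (π : B →ₗ[k] E)
    (hπ : Function.Surjective π) (hπ' : LinearMap.ker π = LinearMap.range i ⊔ LinearMap.range δ)
    (hj : LinearMap.ker j = LinearMap.range δ) (R S : Submodule k V)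
    (hR : R = LinearMap.range j) (hS : S = LinearMap.range (j ∘ₗ i)) :
    Nonempty (E ≃ₗ[k] (R ⧸ S.submoduleOf R)) := by
  subst hR hS
  let g : B →ₗ[k] (LinearMap.range j ⧸ (LinearMap.range (j ∘ₗ i)).submoduleOf (LinearMap.range j)) :=
    Submodule.mkQ _ ∘ₗ j.rangeRestrict
  have hg : Function.Surjective g :=
    (Submodule.mkQ_surjective _).comp j.surjective_rangeRestrict
  -- Both `g` and `π` are onto, so it suffices that they have the same kernel: `j x` lies in the
  -- image of `j ∘ i` exactly when `x` lies in `range i + ker j`.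
  have hker : LinearMap.ker g = LinearMap.ker π := by
    ext x
    rw [hπ', LinearMap.mem_ker, LinearMap.comp_apply, Submodule.mkQ_apply,
      Submodule.Quotient.mk_eq_zero, Submodule.submoduleOf, Submodule.mem_comap,
      Submodule.mem_sup]
    constructor
    · rintro ⟨a, ha⟩
      have : x - i a ∈ LinearMap.ker j := by
        rw [LinearMap.mem_ker, map_sub, sub_eq_zero]; exact ha.symm
      rw [hj] at this
      exact ⟨i a, ⟨a, rfl⟩, x - i a, this, by abel⟩
    · rintro ⟨_, ⟨a, rfl⟩, y, hy, rfl⟩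
      rw [← hj, LinearMap.mem_ker] at hy
      exact ⟨a, by simp [hy]⟩
  exact ⟨(π.quotKerEquivOfSurjective hπ).symm ≪≫ₗ Submodule.quotEquivOfEq _ _ hker.symm ≪≫ₗ
    g.quotKerEquivOfSurjective hg⟩

/-! ### Convergence for a first quadrant spectral object. -/

namespace CategoryTheory.Abelian.SpectralObject

open Limits ComposableArrows

variable {k : Type u} [Field k] (Y : SpectralObject (ModuleCat.{u} k) EInt)

/-- The map `H^n(⊥ ≤ i) → H^n(⊥ ≤ ⊤)`. -/
noncomputable abbrev toAbutment (n : ℤ) (i : EInt) :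
    (Y.H n).obj (mk₁ (homOfLE (bot_le : ⊥ ≤ i))) ⟶
      (Y.H n).obj (mk₁ (homOfLE (bot_le : ⊥ ≤ (⊤ : EInt)))) :=
  (Y.H n).map (twoδ₂Toδ₁' ⊥ i ⊤ bot_le le_top)

lemma map_comp_toAbutment (n : ℤ) (i j : EInt) (hij : i ≤ j) :
    (Y.H n).map (twoδ₂Toδ₁' ⊥ i j bot_le hij) ≫ Y.toAbutment n j = Y.toAbutment n i := by
  rw [toAbutment, ← Functor.map_comp]
  congr 1

/-- Exactness of the long exact sequence of `⊥ ≤ i ≤ ⊤` at `H^n(⊥ ≤ i)`. -/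
lemma ker_toAbutment (n₀ n : ℤ) (h : n₀ + 1 = n) (i : EInt) :
    LinearMap.ker (Y.toAbutment n i).hom =
      LinearMap.range (Y.δ (homOfLE (bot_le : ⊥ ≤ i)) (homOfLE (le_top : i ≤ ⊤)) n₀ n h).hom :=
  ((Y.exact₁ (homOfLE (bot_le : ⊥ ≤ i)) (homOfLE (le_top : i ≤ ⊤)) _ rfl n₀ n
    h).moduleCat_range_eq_ker).symm

lemma range_toAbutment_antitone (n : ℤ) {i j : EInt} (hij : i ≤ j) :
    LinearMap.range (Y.toAbutment n i).hom ≤ LinearMap.range (Y.toAbutment n j).hom := by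
  rw [← Y.map_comp_toAbutment n i j hij, ModuleCat.hom_comp]
  exact LinearMap.range_comp_le_range _ _

lemma range_biprod_desc {A B D : ModuleCat.{u} k} (f : A ⟶ D) (g : B ⟶ D) :
    LinearMap.range (biprod.desc f g).hom = LinearMap.range f.hom ⊔ LinearMap.range g.hom := by
  ext x
  rw [Submodule.mem_sup]
  constructor
  · rintro ⟨z, rfl⟩
    refine ⟨_, ⟨(biprod.fst : A ⊞ B ⟶ _).hom z, rfl⟩, _,
      ⟨(biprod.snd : A ⊞ B ⟶ _).hom z, rfl⟩, ?_⟩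
    rw [biprod.desc_eq]
    rfl
  · rintro ⟨_, ⟨a, rfl⟩, _, ⟨b, rfl⟩, rfl⟩
    refine ⟨(biprod.inl : _ ⟶ A ⊞ B).hom a + (biprod.inr : _ ⟶ A ⊞ B).hom b, ?_⟩
    rw [map_add, ← ModuleCat.comp_apply, ← ModuleCat.comp_apply, biprod.inl_desc, biprod.inr_desc]

/-- With outer bounds `⊥` and `⊤`, the term `E` is the cokernel of `H^{n₁}(⊥ ≤ i) ⊞ H^{n₀}(j ≤ ⊤) ⟶
H^{n₁}(⊥ ≤ j)`. The image of the second summand is the kernel of the map to the abutment, so what is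
left is the image of `H(⊥ ≤ j)` modulo that of `H(⊥ ≤ i)`. The equivalence `e` and the equations
`hR`, `hS` move the result to any model of the abutment. -/
lemma nonempty_E_iso (n₀ n₁ n₂ : ℤ) (h₁ : n₀ + 1 = n₁) (h₂ : n₁ + 1 = n₂) (i j : EInt)
    (hij : i ≤ j) {V : Type u} [AddCommGroup V] [Module k V]
    (e : (Y.H n₁).obj (mk₁ (homOfLE (bot_le : ⊥ ≤ (⊤ : EInt)))) ≃ₗ[k] V) (R S : Submodule k V)
    (hR : R = LinearMap.range (e.toLinearMap ∘ₗ (Y.toAbutment n₁ j).hom))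
    (hS : S = LinearMap.range (e.toLinearMap ∘ₗ (Y.toAbutment n₁ i).hom)) :
    Nonempty (Y.E (homOfLE (bot_le : ⊥ ≤ i)) (homOfLE hij) (homOfLE (le_top : j ≤ ⊤)) n₀ n₁ n₂
      h₁ h₂ ≃ₗ[k] (R ⧸ S.submoduleOf R)) := by
  have hex := Y.cokernelSequenceE_exact (homOfLE (bot_le : ⊥ ≤ i)) (homOfLE hij)
    (homOfLE (le_top : j ≤ ⊤)) (homOfLE (bot_le : ⊥ ≤ j)) rfl n₀ n₁ n₂ h₁ h₂
  have hepi : Epi (Y.cokernelSequenceE (homOfLE (bot_le : ⊥ ≤ i)) (homOfLE hij)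
    (homOfLE (le_top : j ≤ ⊤)) (homOfLE (bot_le : ⊥ ≤ j)) rfl n₀ n₁ n₂ h₁ h₂).g := inferInstance
  refine nonempty_linearEquiv_range_quotient
    ((Y.H n₁).map (twoδ₂Toδ₁' ⊥ i j bot_le hij)).hom
    (Y.δ (homOfLE (bot_le : ⊥ ≤ j)) (homOfLE (le_top : j ≤ ⊤)) n₀ n₁ h₁).hom
    (e.toLinearMap ∘ₗ (Y.toAbutment n₁ j).hom) (Y.cokernelSequenceE (homOfLE (bot_le : ⊥ ≤ i))
      (homOfLE hij) (homOfLE (le_top : j ≤ ⊤)) (homOfLE (bot_le : ⊥ ≤ j)) rfl n₀ n₁ n₂ h₁ h₂).g.hom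
    ((ModuleCat.epi_iff_surjective _).1 hepi) ?_ ?_ R S hR ?_
  · exact hex.moduleCat_range_eq_ker.symm.trans (range_biprod_desc _ _)
  · rw [LinearMap.ker_comp_of_ker_eq_bot _ (LinearEquiv.ker e), Y.ker_toAbutment n₀ n₁ h₁ j]
  · rw [hS, ← Y.map_comp_toAbutment n₁ i j hij]
    rfl

/-- The spectral sequence of a first quadrant spectral object converges to
`n ↦ H^n(⊥ ≤ ⊤)`. -/
theorem spectralSequenceConverges [Y.IsFirstQuadrant]
    (V : ℕ → Type u) [∀ n, AddCommGroup (V n)] [∀ n, Module k (V n)]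
    (e : ∀ n : ℕ, (Y.H n).obj (mk₁ (homOfLE (bot_le : ⊥ ≤ (⊤ : EInt)))) ≃ₗ[k] V n) :
    SpectralSequenceConverges Y.E₂SpectralSequenceNat V := by
  -- `F^p V^n` is the image of the part below `n - p + 1`, that is, of the degrees `≤ n - p`. With
  -- `n = p + q` the bound is `q + 1`, and for `F^{p+1}` it is `q`.
  let i (n p : ℕ) : EInt := (((n : ℤ) - p + 1 : ℤ) : EInt)
  refine ⟨fun n p => LinearMap.range ((e n).toLinearMap ∘ₗ (Y.toAbutment n (i n p)).hom),
    fun n p p' h => ?_, fun n => ?_, fun n => ?_, fun p q r hr hp hq => ?_⟩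
  · dsimp only
    rw [LinearMap.range_comp, LinearMap.range_comp]
    refine Submodule.map_mono (Y.range_toAbutment_antitone n ?_)
    rw [WithBotTop.coe_le_coe]
    lia
  -- The bound is `n + 1`, and `H^n(n + 1 ≤ ⊤) = 0`.
  · have : Epi (Y.toAbutment n (i n 0)) :=
      (Y.exact₂ (homOfLE (bot_le : ⊥ ≤ i n 0)) (homOfLE (le_top : i n 0 ≤ ⊤)) _ rfl n).epi_f
        ((Y.isZero₂_of_isFirstQuadrant (i n 0) ⊤ le_top n (by
          rw [WithBotTop.coe_lt_coe]; lia)).eq_of_tgt _ _)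
    dsimp only
    rw [LinearMap.range_comp, LinearMap.range_eq_top.2 ((ModuleCat.epi_iff_surjective _).1 this),
      Submodule.map_top, LinearEquiv.range]
  -- The bound is `0`, and `H^n(⊥ ≤ 0) = 0`.
  · have : (Y.toAbutment n (i n (n + 1))) = 0 :=
      (Y.isZero₁_of_isFirstQuadrant ⊥ (i n (n + 1)) bot_le (by
        rw [WithBotTop.coe_le_coe]; lia) n).eq_of_src _ _
    dsimp only
    rw [this]
    simp
  -- The term `E_r^{p,q}` belongs to the chain `q - r + 2 ≤ q ≤ q + 1 ≤ q + r - 1`. For large `r`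
  -- its outer bounds can be replaced by `⊥` and `⊤`.
  · have e₁ := Y.spectralSequencePageXIso coreE₂CohomologicalNat r hr (p, q)
      ((q - r + 2 : ℤ) : EInt) ((q : ℤ) : EInt) ((q + 1 : ℤ) : EInt) ((q + r - 1 : ℤ) : EInt)
      rfl rfl rfl rfl (p + q - 1) ((p + q : ℕ) : ℤ) (p + q + 1) (by simp) (by simp) (by simp)
    have h₀₁ : ((q - r + 2 : ℤ) : EInt) ≤ ((q : ℤ) : EInt) := by
      rw [WithBotTop.coe_le_coe]; lia
    have h₁₂ : ((q : ℤ) : EInt) ≤ ((q + 1 : ℤ) : EInt) := by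
      rw [WithBotTop.coe_le_coe]; lia
    have h₂₃ : ((q + 1 : ℤ) : EInt) ≤ ((q + r - 1 : ℤ) : EInt) := by
      rw [WithBotTop.coe_le_coe]; lia
    -- The lower bound can be moved to `⊥` because `q + 1 < r` gives `q - r + 2 ≤ 0`, where `H(⊥ ≤
    -- -)` vanishes.
    have e₂ := Y.isoMapFourδ₁Toδ₀' ⊥ ((q - r + 2 : ℤ) : EInt) ((q : ℤ) : EInt)
      ((q + 1 : ℤ) : EInt) ((q + r - 1 : ℤ) : EInt) bot_le h₀₁ h₁₂ h₂₃
      (p + q - 1) ((p + q : ℕ) : ℤ) (p + q + 1)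
      (Y.isZero₁_of_isFirstQuadrant _ _ _ (by rw [WithBotTop.coe_le_coe]; lia) _)
      (by simp) (by simp)
    -- The upper bound can be moved to `⊤` because `p < r` gives `p + q - 1 < q + r - 1`, so
    -- `H^{p+q-1}(q + r - 1 ≤ ⊤) = 0`.
    have e₃ := Y.isoMapFourδ₄Toδ₃' ⊥ ((q : ℤ) : EInt)
      ((q + 1 : ℤ) : EInt) ((q + r - 1 : ℤ) : EInt) ⊤ bot_le h₁₂ h₂₃ le_top
      (p + q - 1) ((p + q : ℕ) : ℤ) (p + q + 1)
      (Y.isZero₂_of_isFirstQuadrant _ _ _ _ (by rw [WithBotTop.coe_lt_coe]; lia))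
      (by simp) (by simp)
    have hi₁ : i (p + q) p = ((q + 1 : ℤ) : EInt) := by
      simp only [i]; congr 1; push_cast; ring
    have hi₂ : i (p + q) (p + 1) = ((q : ℤ) : EInt) := by
      simp only [i]; congr 1; push_cast; ring
    obtain ⟨e₄⟩ := Y.nonempty_E_iso (p + q - 1) ((p + q : ℕ) : ℤ) (p + q + 1) (by simp) (by simp)
      ((q : ℤ) : EInt) ((q + 1 : ℤ) : EInt) h₁₂ (e (p + q))
      (LinearMap.range ((e (p + q)).toLinearMap ∘ₗ (Y.toAbutment (p + q : ℕ) (i (p + q) p)).hom))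
      (LinearMap.range
        ((e (p + q)).toLinearMap ∘ₗ (Y.toAbutment (p + q : ℕ) (i (p + q) (p + 1))).hom))
      (by rw [hi₁]) (by rw [hi₂])
    exact ⟨e₁ ≪≫ e₂.symm ≪≫ e₃ ≪≫ e₄.toModuleIso⟩

end CategoryTheory.Abelian.SpectralObject

/-! ### Morphisms from a fixed object as a homological functor to small vector spaces. -/

namespace CategoryTheory

section

universe w w'

variable (k : Type u) [Field k] {D : Type w} [Category.{w'} D] [Preadditive D] [Linear k D]
  (X₀ : D) [∀ Y : D, Small.{u} (X₀ ⟶ Y)]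

/-- The functor `Y ↦ Hom(X₀, Y)` with values in a small category of vector spaces. -/
noncomputable def shrinkLinearCoyoneda : D ⥤ ModuleCat.{u} k where
  obj Y := ModuleCat.of k (Shrink.{u} (X₀ ⟶ Y))
  map g := ModuleCat.ofHom ((Shrink.linearEquiv k _).symm.toLinearMap ∘ₗ
    Linear.rightComp k X₀ g ∘ₗ (Shrink.linearEquiv k _).toLinearMap)
  map_id Y := by
    ext x
    simp
  map_comp f g := by
    ext x
    simp

/-- The values of `shrinkLinearCoyoneda` are the spaces of morphisms. -/
noncomputable def shrinkLinearCoyonedaEquiv (Y : D) :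
    (shrinkLinearCoyoneda k X₀).obj Y ≃ₗ[k] (X₀ ⟶ Y) :=
  Shrink.linearEquiv k _

lemma shrinkLinearCoyonedaEquiv_map {Y Y' : D} (g : Y ⟶ Y')
    (x : (shrinkLinearCoyoneda k X₀).obj Y) :
    shrinkLinearCoyonedaEquiv k X₀ Y' ((shrinkLinearCoyoneda k X₀).map g x) =
      shrinkLinearCoyonedaEquiv k X₀ Y x ≫ g := by
  change (Shrink.linearEquiv k _) ((Shrink.linearEquiv k _).symm _) = _
  rw [LinearEquiv.apply_symm_apply]
  rfl

lemma isZero_shrinkLinearCoyoneda_obj {Y : D} (h : ∀ f : X₀ ⟶ Y, f = 0) :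
    Limits.IsZero ((shrinkLinearCoyoneda k X₀).obj Y) := by
  have : Subsingleton ((shrinkLinearCoyoneda k X₀).obj Y) :=
    ⟨fun a b => (shrinkLinearCoyonedaEquiv k X₀ Y).injective
      ((h _).trans (h _).symm)⟩
  exact ModuleCat.isZero_of_subsingleton _

open Pretriangulated in
instance [Limits.HasZeroObject D] [HasShift D ℤ] [∀ n : ℤ, (shiftFunctor D n).Additive]
    [Pretriangulated D] : (shrinkLinearCoyoneda k X₀).IsHomological where
  map_zero Y Y' := by
    ext x
    apply (shrinkLinearCoyonedaEquiv k X₀ Y').injective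
    rw [shrinkLinearCoyonedaEquiv_map]
    simp
  exact T hT := by
    rw [ShortComplex.moduleCat_exact_iff]
    intro x hx
    have h1 : shrinkLinearCoyonedaEquiv k X₀ T.obj₂ x ≫ T.mor₂ = 0 :=
      (shrinkLinearCoyonedaEquiv_map k X₀ T.mor₂ x).symm.trans
        ((congrArg (shrinkLinearCoyonedaEquiv k X₀ T.obj₃) hx).trans (map_zero _))
    obtain ⟨f, hf⟩ := T.coyoneda_exact₂ hT _ h1
    refine ⟨(shrinkLinearCoyonedaEquiv k X₀ T.obj₁).symm f,
      (shrinkLinearCoyonedaEquiv k X₀ T.obj₂).injective ?_⟩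
    refine (shrinkLinearCoyonedaEquiv_map k X₀ T.mor₁ _).trans ?_
    exact (congrArg (· ≫ T.mor₁)
      ((shrinkLinearCoyonedaEquiv k X₀ T.obj₁).apply_symm_apply f)).trans hf.symm

end

end CategoryTheory

/-! ### Morphisms in the derived category, and cocycles of complexes of injectives. -/

namespace DerivedCategory

universe v w

variable {C : Type v} [Category.{u} C] [Abelian C]

/-- Morphisms in the derived category from an object with a projective resolution form a small
type. -/
lemma small_singleFunctor_obj_hom [HasDerivedCategory.{w} C] {X : C} (P : ProjectiveResolution X)
    (Y : DerivedCategory C) : Small.{u} ((singleFunctor C 0).obj X ⟶ Y) := by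
  let L := Q.objPreimage Y
  let e : Q.obj L ≅ Y := Q.objObjPreimageIso Y
  let e' : Q.obj P.cochainComplex ≅ (singleFunctor C 0).obj X :=
    asIso (Q.map P.π') ≪≫ ((singleFunctorIsoCompQ C 0).app X).symm
  have : Small.{u} (P.cochainComplex ⟶ L) := small_self _
  refine small_of_surjective.{u} (α := P.cochainComplex ⟶ L)
    (f := fun g => e'.inv ≫ Q.map g ≫ e.hom) ?_
  intro f
  -- The projective resolution is K-projective, so every morphism out of it in the derived category
  -- comes from a map in the homotopy category, hence from a chain map. Chain maps to `L` form a
  -- type in the universe `u`.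
  obtain ⟨g, hg⟩ := (CochainComplex.IsKProjective.Qh_map_bijective P.cochainComplex
    ((HomotopyCategory.quotient _ _).obj L)).2
    ((quotientCompQhIso C).hom.app _ ≫ e'.hom ≫ f ≫ e.inv ≫ (quotientCompQhIso C).inv.app _)
  obtain ⟨g, rfl⟩ := (HomotopyCategory.quotient _ _).map_surjective g
  refine ⟨g, ?_⟩
  have h := quotientCompQhIso_hom_naturality g
  rw [hg] at h
  dsimp only
  rw [Iso.inv_comp_eq, ← cancel_mono e.inv, ← cancel_epi ((quotientCompQhIso C).hom.app _)]
  simp only [Category.assoc, Iso.hom_inv_id, Category.comp_id]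
  rw [← h]
  simp

variable {k : Type u} [Field k] [Linear k C] {X : C} (J : CochainComplex C ℕ) (n : ℕ)

/-- The degree `n` part of the extension of `J` is `J.X n`. -/
noncomputable def extendXIsoNat : (J.extend ComplexShape.embeddingUpNat).X (n : ℤ) ≅ J.X n :=
  J.extendXIso _ rfl

lemma extend_d_nat (m : ℕ) : (J.extend ComplexShape.embeddingUpNat).d (n : ℤ) (m : ℤ) =
    (extendXIsoNat J n).hom ≫ J.d n m ≫ (extendXIsoNat J m).inv :=
  J.extend_d_eq ComplexShape.embeddingUpNat rfl rfl

lemma comp_extendXIso_inv_comp_d {f : X ⟶ J.X n} (hf : f ≫ J.d n (n + 1) = 0) :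
    (f ≫ (extendXIsoNat J n).inv) ≫
      (J.extend ComplexShape.embeddingUpNat).d (n : ℤ) ((n + 1 : ℕ) : ℤ) = 0 := by
  rw [extend_d_nat]
  simp [reassoc_of% hf]

/-- The morphism in the derived category given by a cocycle `X ⟶ J.X n`. -/
noncomputable def ofCocycle [HasDerivedCategory.{w} C] (f : X ⟶ J.X n)
    (hf : f ≫ J.d n (n + 1) = 0) :
    Q.obj ((CochainComplex.singleFunctor C 0).obj X) ⟶
      (Q.obj (J.extend ComplexShape.embeddingUpNat))⟦(n : ℤ)⟧ :=
  ShiftedHom.map (CochainComplex.HomComplex.Cocycle.equivHomShift.symm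
    (CochainComplex.HomComplex.Cocycle.fromSingleMk
      (f ≫ (extendXIsoNat J n).inv)
      (zero_add _) (n + 1 : ℕ) (by simp) (comp_extendXIso_inv_comp_d J n hf))) Q

lemma ofCocycle_add [HasDerivedCategory.{w} C] (f g : X ⟶ J.X n)
    (hf : f ≫ J.d n (n + 1) = 0) (hg : g ≫ J.d n (n + 1) = 0) :
    ofCocycle J n (f + g) (by simp [hf, hg]) = ofCocycle J n f hf + ofCocycle J n g hg := by
  simp only [ofCocycle, Preadditive.add_comp]
  rw [CochainComplex.HomComplex.Cocycle.fromSingleMk_add _ _ _ _ _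
    (comp_extendXIso_inv_comp_d J n hf) (comp_extendXIso_inv_comp_d J n hg)]
  simp [ShiftedHom.map]

lemma ofCocycle_smul [HasDerivedCategory.{w} C] (r : k) (f : X ⟶ J.X n)
    (hf : f ≫ J.d n (n + 1) = 0) :
    ofCocycle J n (r • f) (by simp [hf]) = r • ofCocycle J n f hf := by
  -- Multiplication by `r` is written as postcomposition with the chain map `r • 𝟙`, because the
  -- constructions of cocycles and shifted morphisms are natural in the target complex.
  have h : (r • f) ≫ (extendXIsoNat J n).inv =
      (f ≫ (extendXIsoNat J n).inv) ≫
        (r • 𝟙 (J.extend ComplexShape.embeddingUpNat)).f (n : ℤ) := by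
    simp
  simp only [ofCocycle, h]
  rw [CochainComplex.HomComplex.Cocycle.fromSingleMk_postcomp _ (zero_add _) _ (by simp)
      (comp_extendXIso_inv_comp_d J n hf),
    CochainComplex.HomComplex.Cocycle.equivHomShift_symm_postcomp]
  simp only [ShiftedHom.map, Functor.map_comp, Category.assoc]
  have h2 := (Q.commShiftIso (n : ℤ)).hom.naturality (r • 𝟙 (J.extend ComplexShape.embeddingUpNat))
  dsimp at h2
  rw [h2, Functor.map_smul, Functor.map_smul, Q.map_id, CategoryTheory.Functor.map_id, Linear.comp_smul,
    Category.comp_id, Linear.comp_smul]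

/-- The map from cohomology classes to morphisms in the derived category. -/
noncomputable def ofCohomologyClass [HasDerivedCategory.{w} C] {K L : CochainComplex C ℤ} {m : ℤ}
    (x : CochainComplex.HomComplex.CohomologyClass K L m) : Q.obj K ⟶ (Q.obj L)⟦m⟧ :=
  ((quotientCompQhIso C).app K).homCongr
    ((quotientCompQhIso C).app ((shiftFunctor (CochainComplex C ℤ) m).obj L) ≪≫
      (Q.commShiftIso m).app L)
    (Qh.map (CochainComplex.HomComplex.CohomologyClass.toHom x))

lemma ofCohomologyClass_mk [HasDerivedCategory.{w} C] {K L : CochainComplex C ℤ} {m : ℤ}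
    (z : CochainComplex.HomComplex.Cocycle K L m) :
    ofCohomologyClass (CochainComplex.HomComplex.CohomologyClass.mk z) =
      ShiftedHom.map (CochainComplex.HomComplex.Cocycle.equivHomShift.symm z) Q := by
  rw [ofCohomologyClass, CochainComplex.HomComplex.CohomologyClass.toHom_mk]
  change (quotientCompQhIso C).inv.app K ≫ Qh.map ((HomotopyCategory.quotient _ _).map _) ≫
    (quotientCompQhIso C).hom.app _ ≫ (Q.commShiftIso m).hom.app L = _
  rw [quotientCompQhIso_hom_naturality_assoc, Iso.inv_hom_id_app_assoc]
  rfl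

lemma ofCohomologyClass_zero [HasDerivedCategory.{w} C] {K L : CochainComplex C ℤ} {m : ℤ} :
    ofCohomologyClass (0 : CochainComplex.HomComplex.CohomologyClass K L m) = 0 := by
  rw [ofCohomologyClass, map_zero, Functor.map_zero]
  exact (congrArg (_ ≫ ·) Limits.zero_comp).trans Limits.comp_zero

/-- Cohomology classes of the Hom complex are morphisms in the homotopy category, and localization
is bijective on morphisms into the K-injective complex `L⟦m⟧`. -/
lemma bijective_ofCohomologyClass [HasDerivedCategory.{w} C] (K L : CochainComplex C ℤ) (m : ℤ)
    [L.IsKInjective] :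
    Function.Bijective
      (ofCohomologyClass : CochainComplex.HomComplex.CohomologyClass K L m → _) :=
  (Iso.homCongr _ _).bijective.comp ((CochainComplex.IsKInjective.Qh_map_bijective _ _).comp
    (CochainComplex.HomComplex.CohomologyClass.toHom_bijective K L m))

variable [∀ m, Injective (J.X m)]

/-- A bounded below complex of injectives is K-injective, so `α` is represented by a cocycle of the
Hom complex. As the source sits in degree `0` only, such a cocycle is a single map to `J.X n` killed
by the differential. -/
lemma ofCocycle_surjective [HasDerivedCategory.{w} C]
    (α : Q.obj ((CochainComplex.singleFunctor C 0).obj X) ⟶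
      (Q.obj (J.extend ComplexShape.embeddingUpNat))⟦(n : ℤ)⟧) :
    ∃ (f : X ⟶ J.X n) (hf : f ≫ J.d n (n + 1) = 0), ofCocycle J n f hf = α := by
  obtain ⟨x, rfl⟩ := (bijective_ofCohomologyClass
    ((CochainComplex.singleFunctor C 0).obj X) (J.extend ComplexShape.embeddingUpNat) n).2 α
  obtain ⟨x, rfl⟩ := x.mk_surjective
  obtain ⟨f, hf, rfl⟩ := CochainComplex.HomComplex.Cocycle.fromSingleMk_surjective x n
    (by simp) (n + 1 : ℕ) (by simp)
  refine ⟨f ≫ (extendXIsoNat J n).hom, ?_, ?_⟩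
  · rw [extend_d_nat] at hf
    rw [← cancel_mono (extendXIsoNat J (n + 1)).inv]
    simpa using hf
  · rw [ofCocycle, ofCohomologyClass_mk]
    simp only [Category.assoc, Iso.hom_inv_id, Category.comp_id]

/-- The class vanishes exactly when the cocycle is a coboundary. The alternative `f = 0` covers `n =
0`, where there is no term of `J` in the preceding degree. -/
lemma ofCocycle_eq_zero_iff [HasDerivedCategory.{w} C] (f : X ⟶ J.X n)
    (hf : f ≫ J.d n (n + 1) = 0) :
    ofCocycle J n f hf = 0 ↔
      f = 0 ∨ ∃ (m : ℕ) (_ : m + 1 = n) (g : X ⟶ J.X m), g ≫ J.d m n = f := by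
  let z := CochainComplex.HomComplex.Cocycle.fromSingleMk (f ≫ (extendXIsoNat J n).inv)
    (zero_add _) (n + 1 : ℕ) (by simp) (comp_extendXIso_inv_comp_d J n hf)
  have h : ofCocycle J n f hf = 0 ↔ CochainComplex.HomComplex.CohomologyClass.mk z = 0 := by
    rw [← (bijective_ofCohomologyClass _ _ _).1.eq_iff, ofCohomologyClass_zero,
      ofCohomologyClass_mk]
    rfl
  rw [h, CochainComplex.HomComplex.CohomologyClass.mk_eq_zero_iff,
    CochainComplex.HomComplex.Cocycle.fromSingleMk_mem_coboundaries_iff _ _ _ _ _ (n - 1 : ℤ)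
      (by simp)]
  constructor
  · rintro ⟨g, hg⟩
    -- For `n = 0` the preceding degree is `-1`, where the extension of `J` to `ℤ` is zero.
    obtain _ | m := n
    · left
      have : g = 0 := (J.isZero_extend_X ComplexShape.embeddingUpNat _ (by simp)).eq_of_tgt _ _
      rw [this, Limits.zero_comp] at hg
      rw [← cancel_mono (extendXIsoNat J 0).inv, ← hg, Limits.zero_comp]
    · right
      have hm : ((m + 1 : ℕ) : ℤ) - 1 = m := by simp
      revert g
      rw [hm]
      intro g hg
      refine ⟨m, rfl, g ≫ (extendXIsoNat J m).hom, ?_⟩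
      rw [← cancel_mono (extendXIsoNat J (m + 1)).inv, ← hg, extend_d_nat]
      simp
  · rintro (rfl | ⟨m, rfl, g, rfl⟩)
    · exact ⟨0, by simp⟩
    · have hm : ((m + 1 : ℕ) : ℤ) - 1 = m := by simp
      rw [hm]
      refine ⟨g ≫ (extendXIsoNat J m).inv, ?_⟩
      rw [extend_d_nat]
      simp

end DerivedCategory

/-! ### Truncations of an object and the spectral object of morphisms into them. -/

namespace DerivedCategory

open Limits Pretriangulated Triangulated ComposableArrows

universe v w

variable {C : Type v} [Category.{u} C] [Abelian C] [HasDerivedCategory.{w} C]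

lemma isIso_homologyFunctor_map_mor₁ {T : Triangle (DerivedCategory C)} (hT : T ∈ distTriang _)
    (n : ℤ) (h₀ : IsZero ((homologyFunctor C (n - 1)).obj T.obj₃))
    (h₁ : IsZero ((homologyFunctor C n).obj T.obj₃)) :
    IsIso ((homologyFunctor C n).map T.mor₁) := by
  have := (HomologySequence.epi_homologyMap_mor₁_iff T hT n).2 (h₁.eq_of_tgt _ _)
  have := (HomologySequence.mono_homologyMap_mor₁_iff T hT (n - 1) n (by lia)).2
    (h₀.eq_of_src _ _)
  exact isIso_of_mono_of_epi _

lemma isIso_homologyFunctor_map_mor₂ {T : Triangle (DerivedCategory C)} (hT : T ∈ distTriang _)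
    (n : ℤ) (h₀ : IsZero ((homologyFunctor C n).obj T.obj₁))
    (h₁ : IsZero ((homologyFunctor C (n + 1)).obj T.obj₁)) :
    IsIso ((homologyFunctor C n).map T.mor₂) := by
  have := (HomologySequence.epi_homologyMap_mor₂_iff T hT n (n + 1) rfl).2 (h₁.eq_of_tgt _ _)
  have := (HomologySequence.mono_homologyMap_mor₂_iff T hT n).2 (h₀.eq_of_src _ _)
  exact isIso_of_mono_of_epi _

/-- The truncation of a complex to the degree `q` is its cohomology in degree `q`. -/
lemma nonempty_truncGE_truncLT_iso (K : DerivedCategory C) (q : ℤ) :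
    Nonempty ((TStructure.t.truncGE q).obj ((TStructure.t.truncLT (q + 1)).obj K) ≅
      (singleFunctor C q).obj ((homologyFunctor C q).obj K)) := by
  let L := (TStructure.t.truncLT (q + 1)).obj K
  let N := (TStructure.t.truncGE q).obj L
  have hL : L.IsLE q := TStructure.t.isLE_truncLT_obj K (q + 1) q (by lia)
  have hN : N.IsLE q := inferInstance
  -- The third vertex of the triangle is `τ_{≥ q+1} K`, without cohomology in degrees `q - 1` and
  -- `q`.
  have h₁ : IsIso ((homologyFunctor C q).map ((TStructure.t.truncLTι (q + 1)).app K)) :=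
    isIso_homologyFunctor_map_mor₁ (TStructure.t.triangleLTGE_distinguished (q + 1) K) q
      (isZero_of_isGE _ (q + 1) _ (by lia) (hX := TStructure.t.isGE_truncGE_obj _ _ _ (by lia)))
      (isZero_of_isGE _ (q + 1) _ (by lia) (hX := TStructure.t.isGE_truncGE_obj _ _ _ (by lia)))
  -- The first vertex is `τ_{< q} L`, without cohomology in degrees `q` and `q + 1`.
  have h₂ : IsIso ((homologyFunctor C q).map ((TStructure.t.truncGEπ q).app L)) :=
    isIso_homologyFunctor_map_mor₂ (TStructure.t.triangleLTGE_distinguished q L) q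
      (isZero_of_isLE _ (q - 1) _ (by lia) (hX := TStructure.t.isLE_truncLT_obj _ _ _ (by lia)))
      (isZero_of_isLE _ (q - 1) _ (by lia) (hX := TStructure.t.isLE_truncLT_obj _ _ _ (by lia)))
  -- `N` is both `≥ q` and `≤ q`, hence a single object placed in degree `q`. Taking `H^q` of the
  -- zigzag from `N` to `K` determines that object.
  obtain ⟨A, ⟨e⟩⟩ := exists_iso_singleFunctor_obj_of_isGE_of_isLE N q
  have e' : A ≅ (homologyFunctor C q).obj K :=
    ((singleFunctorCompHomologyFunctorIso C q).app A).symm ≪≫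
      (homologyFunctor C q).mapIso e.symm ≪≫ (asIso ((homologyFunctor C q).map
      ((TStructure.t.truncGEπ q).app L))).symm ≪≫
      asIso ((homologyFunctor C q).map ((TStructure.t.truncLTι (q + 1)).app K))
  exact ⟨e ≪≫ (singleFunctor C q).mapIso e'⟩

variable (k : Type u) [Field k] [Linear k C] (X : C) (K : DerivedCategory C)
  [∀ Y : DerivedCategory C, Small.{u} ((singleFunctor C 0).obj X ⟶ Y)]

/-- The spectral object of the morphisms from `X` to the truncations of `K`. -/
noncomputable def homSpectralObject : Abelian.SpectralObject (ModuleCat.{u} k) EInt :=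
  letI := Functor.ShiftSequence.tautological
    (shrinkLinearCoyoneda k ((singleFunctor C 0).obj X)) ℤ
  (TStructure.t.spectralObject K).mapHomological
    (shrinkLinearCoyoneda k ((singleFunctor C 0).obj X))

/-- The terms of `homSpectralObject`. -/
noncomputable def homSpectralObjectEquiv {i j : EInt} (h : i ≤ j) (n : ℤ) :
    ((homSpectralObject k X K).H n).obj (mk₁ (homOfLE h)) ≃ₗ[k]
      ((singleFunctor C 0).obj X ⟶
        ((TStructure.t.eTruncGE.obj i).obj ((TStructure.t.eTruncLT.obj j).obj K))⟦n⟧) :=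
  shrinkLinearCoyonedaEquiv k ((singleFunctor C 0).obj X) _

lemma isZero_homSpectralObject {i j : EInt} (h : i ≤ j) (n : ℤ)
    (hf : ∀ f : ((singleFunctor C 0).obj X ⟶
        ((TStructure.t.eTruncGE.obj i).obj ((TStructure.t.eTruncLT.obj j).obj K))⟦n⟧), f = 0) :
    IsZero (((homSpectralObject k X K).H n).obj (mk₁ (homOfLE h))) :=
  isZero_shrinkLinearCoyoneda_obj k ((singleFunctor C 0).obj X) hf

/-- For `j ≤ 0` the truncation of `K` below `j` is zero. For `n < i`, a truncation `≥ i` shifted by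
`n` is in degrees `≥ 1` and receives no nonzero morphism from `X` placed in degree `0`. -/
instance [K.IsGE 0] : (homSpectralObject k X K).IsFirstQuadrant where
  isZero₁ i j hij hj n := by
    refine isZero_homSpectralObject k X K hij n fun f => IsZero.eq_of_tgt ?_ _ _
    exact Functor.map_isZero _ (Functor.map_isZero _
      (TStructure.t.isZero_eTruncLT_obj_obj K 0 j hj))
  isZero₂ i j hij n hi := by
    refine isZero_homSpectralObject k X K hij n fun f => ?_
    have h1 := TStructure.t.isGE_eTruncGE_obj_obj (n + 1) i (by
      induction i using WithBotTop.rec with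
      | bot => simp at hi
      | coe i => simpa using hi
      | top => simp) ((TStructure.t.eTruncLT.obj j).obj K)
    have h2 := TStructure.t.isGE_shift ((TStructure.t.eTruncGE.obj i).obj
      ((TStructure.t.eTruncLT.obj j).obj K)) (n + 1) n 1 (by lia)
    exact TStructure.t.zero f 0 1 (by lia)

/-- The morphisms from `X` to a shift of the truncation of `K` to a degree. -/
lemma nonempty_singleFunctor_hom_equiv [HasExt.{u} C] (p q : ℕ) :
    Nonempty (((singleFunctor C 0).obj X ⟶
        ((TStructure.t.truncGE (q : ℤ)).obj
          ((TStructure.t.truncLT ((q : ℤ) + 1)).obj K))⟦((p + q : ℕ) : ℤ)⟧) ≃ₗ[k]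
      Abelian.Ext.{u} X ((homologyFunctor C q).obj K) p) := by
  obtain ⟨e⟩ := nonempty_truncGE_truncLT_iso K q
  let A := (homologyFunctor C q).obj K
  let e' : ((TStructure.t.truncGE (q : ℤ)).obj
          ((TStructure.t.truncLT ((q : ℤ) + 1)).obj K))⟦((p + q : ℕ) : ℤ)⟧ ≅
      ((singleFunctor C 0).obj A)⟦(p : ℤ)⟧ :=
    (shiftFunctor _ _).mapIso e ≪≫
      -- Shifting degree `q` by `p + q`, or degree `0` by `p`, leads in both cases to degree `-p`.
      ((singleFunctors C).shiftIso ((p + q : ℕ) : ℤ) (-p) q (by simp)).app A ≪≫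
      (((singleFunctors C).shiftIso (p : ℤ) (-p) 0 (by simp)).app A).symm
  exact ⟨Linear.homCongr k (Iso.refl _) e' ≪≫ₗ
    (Abelian.Ext.homLinearEquiv (R := k)).symm⟩

/-- The `E₂`-terms of the spectral sequence of `homSpectralObject`. -/
lemma nonempty_homSpectralObject_page_two_iso [HasExt.{u} C] [K.IsGE 0] (p q : ℕ) :
    Nonempty (((homSpectralObject k X K).E₂SpectralSequenceNat.page 2 le_rfl).X (p, q) ≅
      ModuleCat.of k (Abelian.Ext.{u} X ((homologyFunctor C q).obj K) p)) := by
  obtain ⟨e⟩ := nonempty_singleFunctor_hom_equiv k X K p q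
  -- On the second page the term at `(p, q)` is `H^{p+q}(q ≤ q + 1)`, so only `H^q K` contributes.
  refine ⟨(homSpectralObject k X K).spectralSequenceFirstPageXIso
    Abelian.SpectralObject.coreE₂CohomologicalNat (p, q) ((q : ℤ) : EInt)
    (((q : ℤ) + 1 : ℤ) : EInt) rfl rfl ((p + q : ℕ) : ℤ) (by simp) ≪≫ ?_⟩
  exact ((homSpectralObjectEquiv k X K _ _).trans e).toModuleIso

end DerivedCategory

/-! ### Ext groups as cocycles of an injective resolution modulo coboundaries. -/

/-- Both targets are the quotient of `P` by the common kernel. This compares two descriptions of a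
cohomology group through one space of cocycles, and the formula for `e` keeps track of
representatives. -/
lemma LinearMap.exists_linearEquiv_of_surjective {k P V W : Type*} [Ring k] [AddCommGroup P]
    [Module k P] [AddCommGroup V] [Module k V] [AddCommGroup W] [Module k W]
    (π : P →ₗ[k] V) (ρ : P →ₗ[k] W) (hπ : Function.Surjective π) (hρ : Function.Surjective ρ)
    (h : ∀ x, π x = 0 ↔ ρ x = 0) : ∃ e : V ≃ₗ[k] W, ∀ x, e (π x) = ρ x := by
  have hk : LinearMap.ker π = LinearMap.ker ρ := Submodule.ext h
  refine ⟨(π.quotKerEquivOfSurjective hπ).symm ≪≫ₗ Submodule.quotEquivOfEq _ _ hk ≪≫ₗ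
    ρ.quotKerEquivOfSurjective hρ, fun x => ?_⟩
  have : (π.quotKerEquivOfSurjective hπ).symm (π x) = Submodule.Quotient.mk x := by
    rw [LinearEquiv.symm_apply_eq]
    rfl
  rw [LinearEquiv.trans_apply, LinearEquiv.trans_apply, this]
  rfl

section

universe v w

variable {C : Type v} [Category.{u} C] [Abelian C] (k : Type u) [Field k] [Linear k C]
  (J : CochainComplex C ℕ) (n : ℕ) (X : C)

namespace CochainComplex

/-- The morphisms from `X` to the cocycles of degree `n` of `J`. -/
noncomputable def cocyclesFrom : Submodule k (X ⟶ J.X n) :=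
  LinearMap.ker (Linear.rightComp k X (J.d n (n + 1)))

variable {X} in
/-- The morphisms to `J.X n` which factor through the differential. -/
def IsCoboundaryFrom (f : X ⟶ J.X n) : Prop :=
  f = 0 ∨ ∃ (m : ℕ) (_ : m + 1 = n) (g : X ⟶ J.X m), g ≫ J.d m n = f

end CochainComplex

open CochainComplex

/-- `DerivedCategory.ofCocycle` as a linear map. -/
noncomputable def DerivedCategory.ofCocycleLinear [HasDerivedCategory.{w} C] :
    cocyclesFrom k J n X →ₗ[k] (Q.obj ((CochainComplex.singleFunctor C 0).obj X) ⟶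
      (Q.obj (J.extend ComplexShape.embeddingUpNat))⟦(n : ℤ)⟧) where
  toFun f := ofCocycle J n f.1 f.2
  map_add' f g := ofCocycle_add J n f.1 g.1 f.2 g.2
  map_smul' r f := ofCocycle_smul J n r f.1 f.2

/-- Composition with isomorphisms in degree `0` on both sides does not affect vanishing. This
removes the comparison isomorphisms by which `extMk` differs from `ofCocycle`. -/
lemma CategoryTheory.ShiftedHom.mk₀_comp_comp_mk₀_eq_zero_iff {D : Type*} [Category* D]
    [Preadditive D] [HasShift D ℤ] {A A' B B' : D} (a : A' ⟶ A) [IsIso a] (b : B ⟶ B') [IsIso b]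
    (n : ℤ) (f : ShiftedHom A B n) :
    (ShiftedHom.mk₀ (0 : ℤ) rfl a).comp (f.comp (ShiftedHom.mk₀ (0 : ℤ) rfl b) (zero_add n))
      (add_zero n) = 0 ↔ f = 0 := by
  rw [ShiftedHom.mk₀_comp, ShiftedHom.comp_mk₀]
  constructor
  · intro h
    rw [← cancel_mono (b⟦n⟧'), ← cancel_epi a]
    exact h.trans (by rw [Limits.zero_comp, Limits.comp_zero])
  · intro h
    rw [h, Limits.zero_comp, Limits.comp_zero]

namespace CategoryTheory.InjectiveResolution

variable {X} {T : C} (I : InjectiveResolution T) [HasExt.{u} C]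

/-- Seen in the derived category, `extMk f` is `ofCocycle f` composed with the isomorphisms that
identify the sources and replace `T` by its resolution. The criterion for `ofCocycle` therefore
applies. -/
lemma extMk_eq_zero_iff_isCoboundaryFrom (f : X ⟶ I.cocomplex.X n)
    (hf : f ≫ I.cocomplex.d n (n + 1) = 0) :
    I.extMk f (n + 1) rfl hf = 0 ↔ IsCoboundaryFrom I.cocomplex n f := by
  let := HasDerivedCategory.standard C
  have hI : ∀ m, Injective (I.cocomplex.X m) := fun m => inferInstance
  rw [IsCoboundaryFrom, ← DerivedCategory.ofCocycle_eq_zero_iff I.cocomplex n f hf,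
    ← Abelian.Ext.homEquiv.injective.eq_iff]
  have h0 : (Abelian.Ext.homEquiv (0 : Abelian.Ext X T n)) = 0 :=
    map_zero (Abelian.Ext.homAddEquiv (X := X) (Y := T) (n := n))
  have h1 := I.extMk_hom f (n + 1) rfl hf
  change Abelian.Ext.homEquiv _ = _ at h1
  rw [h0, h1]
  have h2 : IsIso (DerivedCategory.Q.map I.ι') := inferInstance
  have h3 : IsIso ((DerivedCategory.singleFunctorIsoCompQ C 0).inv.app T) := inferInstance
  have h4 := @IsIso.comp_isIso _ _ _ _ _ (inv (DerivedCategory.Q.map I.ι'))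
    ((DerivedCategory.singleFunctorIsoCompQ C 0).inv.app T) inferInstance h3
  have h5 : IsIso ((DerivedCategory.singleFunctorIsoCompQ C 0).hom.app X) := inferInstance
  exact @ShiftedHom.mk₀_comp_comp_mk₀_eq_zero_iff _ _ _ _ _ _ _ _ _ h5 _ h4 (n : ℤ)
    (DerivedCategory.ofCocycle I.cocomplex n f hf)

/-- `InjectiveResolution.extMk` as a linear map. -/
noncomputable def extMkLinear (X : C) :
    cocyclesFrom k I.cocomplex n X →ₗ[k] Abelian.Ext.{u} X T n where
  toFun f := I.extMk f.1 (n + 1) rfl f.2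
  map_add' f g := (I.add_extMk f.1 g.1 (n + 1) rfl f.2 g.2).symm
  map_smul' r f := by
    -- The scalar `r` is treated as an endomorphism of the resolution lifting `r • 𝟙 T`, so that
    -- compatibility with scalars is an instance of naturality in `T`.
    let φ : Hom I I (r • 𝟙 T) :=
      { hom := r • 𝟙 _
        ι_f_zero_comp_hom_f_zero := by
          rw [CochainComplex.single₀_map_f_zero]
          change I.ι.f 0 ≫ (r • 𝟙 (I.cocomplex.X 0)) = (r • 𝟙 T) ≫ I.ι.f 0
          refine (Linear.comp_smul _ _ _ (I.ι.f 0) r (𝟙 (I.cocomplex.X 0))).trans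
            (Eq.trans ?_ (Linear.smul_comp _ _ _ r (𝟙 T) (I.ι.f 0)).symm)
          exact congrArg (r • ·) ((Category.comp_id _).trans (Category.id_comp _).symm) }
    have h := extMk_comp_mk₀ f.1 (n + 1) rfl f.2 φ
    rw [Abelian.Ext.smul_eq_comp_mk₀, RingHom.id_apply]
    refine Eq.trans ?_ h.symm
    congr 1
    simp [φ]

lemma extMkLinear_surjective (X : C) : Function.Surjective (I.extMkLinear k n X) := by
  intro α
  obtain ⟨f, hf, rfl⟩ := I.extMk_surjective α (n + 1) rfl
  exact ⟨⟨f, hf⟩, rfl⟩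

end CategoryTheory.InjectiveResolution

end

/-! ### The spectral sequence of an adjunction. -/

namespace CategoryTheory.Adjunction

universe v v' w

variable {C : Type v} [Category.{u} C] [Abelian C] {D : Type v'} [Category.{u} D] [Abelian D]
  (k : Type u) [Field k] [Linear k C] [Linear k D] {F : C ⥤ D} {G : D ⥤ C}
  [G.Additive] [G.Linear k] [F.PreservesMonomorphisms] [HasExt.{u} C] [HasExt.{u} D]

open _root_.DerivedCategory CochainComplex

/-- The cocycle of `G(J)` attached to a cocycle of `J`. -/
noncomputable def cocyclesFromMap (adj : F ⊣ G) (J : CochainComplex D ℕ) (n : ℕ) (X : C) :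
    cocyclesFrom k J n (F.obj X) →ₗ[k]
      cocyclesFrom k ((G.mapHomologicalComplex _).obj J) n X :=
  (Linear.leftComp k _ (adj.unit.app X) ∘ₗ G.mapLinearMap k).restrict (by
    intro f hf
    change (adj.unit.app X ≫ G.map f) ≫ G.map (J.d n (n + 1)) = 0
    rw [Category.assoc, ← G.map_comp]
    have : f ≫ J.d n (n + 1) = 0 := hf
    rw [this, G.map_zero, Limits.comp_zero])

lemma cocyclesFromMap_coe (adj : F ⊣ G) (J : CochainComplex D ℕ) (n : ℕ) (X : C)
    (f : cocyclesFrom k J n (F.obj X)) :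
    (cocyclesFromMap k adj J n X f).1 = adj.homEquiv _ _ f.1 :=
  (adj.homEquiv_unit ..).symm

/-- Transposition along the adjunction is natural in the target, so the transpose of a cocycle is
again a cocycle. -/
lemma cocyclesFromMap_surjective (adj : F ⊣ G) (J : CochainComplex D ℕ) (n : ℕ) (X : C) :
    Function.Surjective (cocyclesFromMap k adj J n X) := by
  intro f
  refine ⟨⟨(adj.homEquiv _ _).symm f.1, ?_⟩, Subtype.ext
    ((cocyclesFromMap_coe k adj J n X _).trans (Equiv.apply_symm_apply _ _))⟩
  change (adj.homEquiv _ _).symm f.1 ≫ J.d n (n + 1) = 0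
  have h : f.1 ≫ G.map (J.d n (n + 1)) = 0 := f.2
  refine (adj.homEquiv_naturality_right_symm f.1 (J.d n (n + 1))).symm.trans ?_
  refine (congrArg _ h).trans ?_
  rw [Equiv.symm_apply_eq]
  simp [adj.homEquiv_unit]

lemma isCoboundaryFrom_homEquiv_iff (adj : F ⊣ G) (J : CochainComplex D ℕ) (n : ℕ) (X : C)
    (f : F.obj X ⟶ J.X n) :
    IsCoboundaryFrom ((G.mapHomologicalComplex (ComplexShape.up ℕ)).obj J) n (X := X)
      (adj.homEquiv _ _ f) ↔ IsCoboundaryFrom J n f := by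
  have h0 : (adj.homEquiv X (J.X n) f : X ⟶ G.obj (J.X n)) = 0 ↔ f = 0 := by
    rw [← (adj.homEquiv X (J.X n)).injective.eq_iff]
    simp [adj.homEquiv_unit]
  refine or_congr h0 (exists_congr fun m => exists_congr fun hm => ?_)
  constructor
  · rintro ⟨g, hg⟩
    refine ⟨(adj.homEquiv _ _).symm g, ?_⟩
    refine (adj.homEquiv_naturality_right_symm g (J.d m n)).symm.trans ?_
    rw [Equiv.symm_apply_eq]
    exact hg
  · rintro ⟨g, rfl⟩
    exact ⟨adj.homEquiv _ _ g, (adj.homEquiv_naturality_right g (J.d m n)).symm⟩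

/-- This is the abutment. Both sides are quotients of the space of cocycles `F(X) ⟶ I^n`: the right
side directly, the left side after transposing to cocycles `X ⟶ G(I^n)`. Transposition matches the
coboundaries. -/
lemma nonempty_singleFunctor_hom_equiv_ext (adj : F ⊣ G) [HasDerivedCategory.{w} C] {T : D}
    (I : InjectiveResolution T) (n : ℕ) (X : C) :
    Nonempty ((Q.obj ((CochainComplex.singleFunctor C 0).obj X) ⟶
      (Q.obj (((G.mapHomologicalComplex _).obj I.cocomplex).extend
        ComplexShape.embeddingUpNat))⟦(n : ℤ)⟧) ≃ₗ[k] Abelian.Ext.{u} (F.obj X) T n) := by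
  let J := (G.mapHomologicalComplex (ComplexShape.up ℕ)).obj I.cocomplex
  -- A right adjoint of a functor that preserves monomorphisms preserves injectives.
  have hJ : ∀ m, Injective (J.X m) := fun m => adj.map_injective (I.cocomplex.X m) inferInstance
  obtain ⟨e, -⟩ := LinearMap.exists_linearEquiv_of_surjective
    (ofCocycleLinear k J n X ∘ₗ cocyclesFromMap k adj I.cocomplex n X)
    (I.extMkLinear k n (F.obj X))
    (Function.Surjective.comp (g := ofCocycleLinear k J n X) (fun α => by
      obtain ⟨f, hf, rfl⟩ := ofCocycle_surjective J n α
      exact ⟨⟨f, hf⟩, rfl⟩) (cocyclesFromMap_surjective k adj I.cocomplex n X))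
    (I.extMkLinear_surjective k n (F.obj X))
    (fun f => by
      refine (ofCocycle_eq_zero_iff J n _ (cocyclesFromMap k adj I.cocomplex n X f).2).trans
        (Iff.trans ?_ (I.extMk_eq_zero_iff_isCoboundaryFrom n f.1 f.2).symm)
      rw [← adj.isCoboundaryFrom_homEquiv_iff, ← cocyclesFromMap_coe k adj]
      rfl)
  exact ⟨e⟩

/-- The spectral sequence `Ext^p(X, R^qG(T)) ⇒ Ext^{p+q}(F(X), T)` of an adjunction `F ⊣ G` such
that `F` preserves monomorphisms. -/
theorem exists_spectralSequence (adj : F ⊣ G) [EnoughProjectives C] [EnoughInjectives D] (X : C) (T : D) :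
    ∃ E : E₂CohomologicalSpectralSequenceNat (ModuleCat.{u} k),
      (∀ p q : ℕ, Nonempty ((E.page 2 le_rfl).X (p, q) ≅
        ModuleCat.of k (Abelian.Ext.{u} X ((G.rightDerived q).obj T) p))) ∧
      SpectralSequenceConverges E (fun n => Abelian.Ext.{u} (F.obj X) T n) := by
  let := HasDerivedCategory.standard C
  let I := injectiveResolution T
  let J := (G.mapHomologicalComplex (ComplexShape.up ℕ)).obj I.cocomplex
  -- `K` plays the role of the total derived functor of `G` at `T`.
  let K : DerivedCategory C := Q.obj (J.extend ComplexShape.embeddingUpNat)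
  -- A projective resolution of `X` serves only to make the spaces of morphisms small enough for
  -- `ModuleCat.{u} k`.
  have : ∀ Y : DerivedCategory C, Small.{u} ((DerivedCategory.singleFunctor C 0).obj X ⟶ Y) :=
    small_singleFunctor_obj_hom (projectiveResolution X)
  have hK : K.IsGE 0 := inferInstance
  refine ⟨(homSpectralObject k X K).E₂SpectralSequenceNat, fun p q => ?_,
    Abelian.SpectralObject.spectralSequenceConverges _ _ fun n =>
      (homSpectralObjectEquiv k X K _ _).trans
        (nonempty_singleFunctor_hom_equiv_ext k adj I n X).some⟩
  obtain ⟨e⟩ := nonempty_homSpectralObject_page_two_iso k X K p q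
  let e' : (homologyFunctor C q).obj K ≅ (G.rightDerived q).obj T :=
    (homologyFunctorFactors C q).app _ ≪≫
      J.extendHomologyIso ComplexShape.embeddingUpNat rfl ≪≫ (I.isoRightDerivedObj G q).symm
  exact ⟨e ≪≫ ((Abelian.Ext.homLinearEquiv (R := k)).trans
    ((Linear.homCongr k (Iso.refl _) ((shiftFunctor _ (p : ℤ)).mapIso
      ((DerivedCategory.singleFunctor C 0).mapIso e'))).trans
      (Abelian.Ext.homLinearEquiv (R := k)).symm)).toModuleIso⟩

end CategoryTheory.Adjunction

/-! ### Cohomology of complexes of modules in terms of elements. -/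

namespace CochainComplex

variable {R : Type u} [Ring R] (J : CochainComplex (ModuleCat.{u} R) ℕ) (n : ℕ)

/-- The projection from the cocycles of a complex of modules to its cohomology. -/
noncomputable def toHomology : LinearMap.ker (J.d n (n + 1)).hom →ₗ[R] J.homology n :=
  (J.liftCycles (ModuleCat.ofHom (LinearMap.ker (J.d n (n + 1)).hom).subtype) (n + 1) (by simp)
    (by ext x; exact x.2) ≫ J.homologyπ n).hom

lemma iCycles_liftCycles_apply (z : LinearMap.ker (J.d n (n + 1)).hom) :
    (J.iCycles n).hom ((J.liftCycles
      (ModuleCat.ofHom (LinearMap.ker (J.d n (n + 1)).hom).subtype) (n + 1) (by simp)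
      (by ext x; exact x.2)).hom z) = z.1 :=
  congrArg (fun f => f.hom z) (J.liftCycles_i (ModuleCat.ofHom
    (LinearMap.ker (J.d n (n + 1)).hom).subtype) (n + 1) (by simp) (by ext x; exact x.2))

lemma toHomology_surjective : Function.Surjective (toHomology J n) := by
  intro y
  obtain ⟨c, rfl⟩ := (ModuleCat.epi_iff_surjective (J.homologyπ n)).1 inferInstance y
  let z : LinearMap.ker (J.d n (n + 1)).hom := ⟨(J.iCycles n).hom c,
    ConcreteCategory.congr_hom (J.iCycles_d n (n + 1)) c⟩
  refine ⟨z, congrArg (J.homologyπ n).hom ?_⟩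
  exact (ModuleCat.mono_iff_injective (J.iCycles n)).1 inferInstance
    (iCycles_liftCycles_apply J n z)

lemma toHomology_eq_zero_iff (z : LinearMap.ker (J.d n (n + 1)).hom) :
    toHomology J n z = 0 ↔
      z = 0 ∨ ∃ (m : ℕ) (_ : m + 1 = n) (y : J.X m), (J.d m n).hom y = z.1 := by
  -- The criterion is first proved with `prev n`, in which form it is exactness of `J^{prev n} ⟶ Z^n
  -- ⟶ H^n ⟶ 0`.
  have h : toHomology J n z = 0 ↔
      ∃ y : J.X ((ComplexShape.up ℕ).prev n), (J.d _ n).hom y = z.1 := by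
    have hex := ShortComplex.exact_of_g_is_cokernel
      (ShortComplex.mk _ _ (J.toCycles_comp_homologyπ _ n)) (J.homologyIsCokernel _ n rfl)
    rw [ShortComplex.moduleCat_exact_iff] at hex
    constructor
    · intro h
      obtain ⟨y, hy⟩ := hex _ h
      refine ⟨y, ?_⟩
      rw [← iCycles_liftCycles_apply]
      refine Eq.trans ?_ (congrArg (J.iCycles n).hom hy)
      exact congrArg (fun f => f.hom y) (J.toCycles_i _ n).symm
    · rintro ⟨y, hy⟩
      have : (J.toCycles _ n).hom y = (J.liftCycles
          (ModuleCat.ofHom (LinearMap.ker (J.d n (n + 1)).hom).subtype) (n + 1) (by simp)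
          (by ext x; exact x.2)).hom z := by
        apply (ModuleCat.mono_iff_injective (J.iCycles n)).1 inferInstance
        refine Eq.trans ?_ (iCycles_liftCycles_apply J n z).symm
        exact (congrArg (fun f => f.hom y) (J.toCycles_i _ n)).trans hy
      refine (congrArg (J.homologyπ n).hom this.symm).trans ?_
      exact congrArg (fun f => f.hom y) (J.toCycles_comp_homologyπ _ n)
  rw [h]
  constructor
  · rintro ⟨y, hy⟩
    obtain _ | m := n
    -- Degree `0` has no predecessor, so the differential from the default value of `prev 0` is
    -- zero.
    · left
      ext
      rw [← hy, J.shape _ _ (by simp)]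
      rfl
    · right
      revert y
      rw [CochainComplex.prev_nat_succ]
      exact fun y hy => ⟨m, rfl, y, hy⟩
  · rintro (rfl | ⟨m, rfl, y, hy⟩)
    · exact ⟨0, map_zero _⟩
    · rw [CochainComplex.prev_nat_succ]
      exact ⟨y, hy⟩

lemma homologyMap_toHomology {J J' : CochainComplex (ModuleCat.{u} R) ℕ} (φ : J ⟶ J') (n : ℕ)
    (z : LinearMap.ker (J.d n (n + 1)).hom) (z' : LinearMap.ker (J'.d n (n + 1)).hom)
    (hz : (φ.f n).hom z.1 = z'.1) :
    (HomologicalComplex.homologyMap φ n).hom (toHomology J n z) = toHomology J' n z' := by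
  refine (congrArg (fun f => f.hom (((J.liftCycles (ModuleCat.ofHom
    (LinearMap.ker (J.d n (n + 1)).hom).subtype) (n + 1) (by simp)
      (by ext x; exact x.2))).hom z)) (HomologicalComplex.homologyπ_naturality φ n)).trans ?_
  refine congrArg (J'.homologyπ n).hom ?_
  apply (ModuleCat.mono_iff_injective (J'.iCycles n)).1 inferInstance
  refine Eq.trans ?_ (iCycles_liftCycles_apply J' n z').symm
  refine (ConcreteCategory.congr_hom (HomologicalComplex.cyclesMap_i φ n) _).trans ?_
  refine Eq.trans ?_ hz
  exact congrArg (φ.f n).hom (iCycles_liftCycles_apply J n z)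

end CochainComplex

/-! ### Images of injective resolutions under exact functors. -/

namespace CategoryTheory.Functor

universe v v'

variable {C : Type v} [Category.{u} C] [Abelian C] {D : Type v'} [Category.{u} D] [Abelian D]
  (F : C ⥤ D) [F.Additive] [F.PreservesInjectiveObjects] [F.PreservesHomology]

/-- The image of an injective resolution by an exact functor which preserves injective objects. -/
noncomputable def mapInjectiveResolution {Z : C} (I : InjectiveResolution Z) :
    InjectiveResolution (F.obj Z) where
  cocomplex := (F.mapHomologicalComplex _).obj I.cocomplex
  injective n := F.injective_obj_of_injective (I.injective n)
  ι := (HomologicalComplex.singleMapHomologicalComplex _ _ _).inv.app _ ≫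
    (F.mapHomologicalComplex _).map I.ι
  quasiIso := inferInstance

/-- The image of a morphism of injective resolutions. -/
noncomputable def mapInjectiveResolutionHom {Z Z' : C} {I : InjectiveResolution Z}
    {I' : InjectiveResolution Z'} {g : Z ⟶ Z'} (φ : InjectiveResolution.Hom I I' g) :
    InjectiveResolution.Hom (F.mapInjectiveResolution I) (F.mapInjectiveResolution I')
      (F.map g) where
  hom := (F.mapHomologicalComplex _).map φ.hom
  ι_f_zero_comp_hom_f_zero := by
    -- The required equality is the degree `0` part of an equality of chain maps, which follows from
    -- naturality of the single-complex isomorphism and from `φ.ι_comp_hom`.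
    have h : (F.mapInjectiveResolution I).ι ≫ (F.mapHomologicalComplex _).map φ.hom =
        (CochainComplex.single₀ D).map (F.map g) ≫ (F.mapInjectiveResolution I').ι := by
      have h1 := (HomologicalComplex.singleMapHomologicalComplex F (ComplexShape.up ℕ) 0).inv.naturality g
      refine (Category.assoc _ _ _).trans ?_
      refine Eq.trans ?_ (Category.assoc _ _ _)
      refine Eq.trans ?_ (congrArg (· ≫ (F.mapHomologicalComplex _).map I'.ι) h1.symm)
      refine Eq.trans (congrArg (_ ≫ ·) ?_) (Category.assoc _ _ _).symm
      refine ((F.mapHomologicalComplex _).map_comp _ _).symm.trans ?_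
      refine Eq.trans ?_ ((F.mapHomologicalComplex _).map_comp _ _)
      exact congrArg ((F.mapHomologicalComplex _).map) φ.ι_comp_hom
    exact congrArg (fun f => f.f 0) h

end CategoryTheory.Functor

/-! ### Right derived functors in terms of cocycles. -/

namespace CategoryTheory.InjectiveResolution

lemma extMk_congr {C : Type*} [Category* C] [Abelian C] [HasExt C] {X Y : C}
    (I : InjectiveResolution Y) {n m : ℕ} {hm : n + 1 = m} {f g : X ⟶ I.cocomplex.X n}
    (h : f = g) (hf : f ≫ I.cocomplex.d n m = 0) (hg : g ≫ I.cocomplex.d n m = 0) :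
    I.extMk f m hm hf = I.extMk g m hm hg := by
  subst h
  rfl

variable {R S : Type u} [Ring R] [Ring S] (G : ModuleCat.{u} S ⥤ ModuleCat.{u} R) [G.Additive]
  {T T' : ModuleCat.{u} S} (I : InjectiveResolution T) (I' : InjectiveResolution T') (q : ℕ)

/-- The class in the right derived functor of a cocycle. -/
noncomputable def toRightDerived :
    LinearMap.ker (G.map (I.cocomplex.d q (q + 1))).hom →ₗ[R] (G.rightDerived q).obj T :=
  (I.isoRightDerivedObj G q).inv.hom ∘ₗ
    CochainComplex.toHomology ((G.mapHomologicalComplex (ComplexShape.up ℕ)).obj I.cocomplex) q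

lemma toRightDerived_surjective : Function.Surjective (I.toRightDerived G q) :=
  ((I.isoRightDerivedObj G q).symm.toLinearEquiv.surjective).comp
    (CochainComplex.toHomology_surjective _ q)

lemma toRightDerived_eq_zero_iff (z : LinearMap.ker (G.map (I.cocomplex.d q (q + 1))).hom) :
    I.toRightDerived G q z = 0 ↔ z.1 = 0 ∨ ∃ (m : ℕ) (_ : m + 1 = q)
      (y : G.obj (I.cocomplex.X m)), (G.map (I.cocomplex.d m q)).hom y = z.1 :=
  ((I.isoRightDerivedObj G q).symm.toLinearEquiv.map_eq_zero_iff).trans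
    ((CochainComplex.toHomology_eq_zero_iff
      ((G.mapHomologicalComplex (ComplexShape.up ℕ)).obj I.cocomplex) q z).trans (or_congr_left Subtype.ext_iff))

variable {I I'} in
/-- The image of a cocycle by a morphism of injective resolutions. -/
noncomputable def kerMap {g : T ⟶ T'} (φ : Hom I I' g)
    (z : LinearMap.ker (G.map (I.cocomplex.d q (q + 1))).hom) :
    LinearMap.ker (G.map (I'.cocomplex.d q (q + 1))).hom :=
  ⟨(G.map (φ.hom.f q)).hom z.1, by
    have h : G.map (φ.hom.f q) ≫ G.map (I'.cocomplex.d q (q + 1)) =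
        G.map (I.cocomplex.d q (q + 1)) ≫ G.map (φ.hom.f (q + 1)) := by
      rw [← G.map_comp, ← G.map_comp, φ.hom.comm]
    refine (ConcreteCategory.congr_hom h z.1).trans ?_
    exact (congrArg (G.map (φ.hom.f (q + 1))).hom z.2).trans (map_zero _)⟩

/-- The action of the derived functor on morphisms is computed on representatives by any lift of `g`
to the resolutions. -/
lemma rightDerived_map_toRightDerived {g : T ⟶ T'} (φ : Hom I I' g)
    (z : LinearMap.ker (G.map (I.cocomplex.d q (q + 1))).hom) :
    ((G.rightDerived q).map g).hom (I.toRightDerived G q z) =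
      I'.toRightDerived G q (kerMap G q φ z) := by
  refine (ConcreteCategory.congr_hom (isoRightDerivedObj_inv_naturality g I I' φ.hom
    φ.ι_f_zero_comp_hom_f_zero G q) (CochainComplex.toHomology _ q z)).trans ?_
  exact congrArg (I'.isoRightDerivedObj G q).inv.hom
    (CochainComplex.homologyMap_toHomology
      ((G.mapHomologicalComplex (ComplexShape.up ℕ)).map φ.hom) q z (kerMap G q φ z) rfl)

end CategoryTheory.InjectiveResolution

/-! ### Comparison of derived functors with Ext after restriction. -/

namespace ModuleCat

variable {k R S R' : Type u} [Field k] [Ring R] [Algebra k R] [Ring S] [Algebra k S] [Ring R']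
  [Algebra k R'] (G : ModuleCat.{u} S ⥤ ModuleCat.{u} R) [G.Additive]
  (U : ModuleCat.{u} S ⥤ ModuleCat.{u} R') [U.Additive] [U.PreservesInjectiveObjects]
  [U.PreservesHomology] (M : ModuleCat.{u} R') (η : ∀ T, G.obj T ≃ₗ[k] (M ⟶ U.obj T))

lemma comp_mapInjectiveResolution_d (hη : ∀ (T T' : ModuleCat.{u} S) (g : T ⟶ T') (x : G.obj T),
    η T' ((G.map g).hom x) = η T x ≫ U.map g) (q : ℕ)
    {T : ModuleCat.{u} S} (I : InjectiveResolution T)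
    (z : LinearMap.ker (G.map (I.cocomplex.d q (q + 1))).hom) :
    η (I.cocomplex.X q) z.1 ≫ (U.mapInjectiveResolution I).cocomplex.d q (q + 1) = 0 :=
  (hη _ _ _ z.1).symm.trans ((congrArg (η _) z.2).trans (map_zero _))

/-- Since `U` is exact and preserves injectives, `U(I)` is an injective resolution of `U(T)`. The
natural isomorphism `η` identifies the complex `G(I)` with `Hom(M, U(I))`. Hence both sides are the
same cocycles modulo the same coboundaries. -/
lemma exists_rightDerived_obj_equiv_ext
    (hη : ∀ (T T' : ModuleCat.{u} S) (g : T ⟶ T') (x : G.obj T),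
      η T' ((G.map g).hom x) = η T x ≫ U.map g) (q : ℕ)
    {T : ModuleCat.{u} S} (I : InjectiveResolution T) :
    ∃ e : (G.rightDerived q).obj T ≃ₗ[k] Abelian.Ext.{u} M (U.obj T) q,
      ∀ z, e (I.toRightDerived G q z) =
        (U.mapInjectiveResolution I).extMk (η (I.cocomplex.X q) z.1) (q + 1) rfl
          (comp_mapInjectiveResolution_d G U M η hη q I z) := by
  let ρ := (U.mapInjectiveResolution I).extMkLinear k q M ∘ₗ
      LinearMap.codRestrict _ ((η (I.cocomplex.X q)).toLinearMap ∘ₗ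
        (LinearMap.ker (G.map (I.cocomplex.d q (q + 1))).hom).subtype.restrictScalars k)
        (comp_mapInjectiveResolution_d G U M η hη q I)
  refine LinearMap.exists_linearEquiv_of_surjective
    ((I.toRightDerived G q).restrictScalars k) ρ (I.toRightDerived_surjective G q) ?_ ?_
  · refine ((U.mapInjectiveResolution I).extMkLinear_surjective k q M).comp fun f => ?_
    refine ⟨⟨(η _).symm f.1, ?_⟩, Subtype.ext ((η _).apply_symm_apply f.1)⟩
    change (G.map (I.cocomplex.d q (q + 1))).hom ((η (I.cocomplex.X q)).symm f.1) = 0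
    apply (η _).injective
    refine (hη _ _ _ _).trans (Eq.trans ?_ (map_zero _).symm)
    exact (congrArg (· ≫ U.map _) ((η _).apply_symm_apply f.1)).trans f.2
  · intro z
    refine (I.toRightDerived_eq_zero_iff G q z).trans (Iff.trans ?_
      ((U.mapInjectiveResolution I).extMk_eq_zero_iff_isCoboundaryFrom q
        (η (I.cocomplex.X q) z.1) (comp_mapInjectiveResolution_d G U M η hη q I z)).symm)
    refine or_congr (η _).map_eq_zero_iff.symm (exists_congr fun m => exists_congr fun hm => ?_)
    constructor
    · rintro ⟨y, hy⟩
      exact ⟨η _ y, (hη _ _ _ y).symm.trans (congrArg (η _) hy)⟩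
    · rintro ⟨y, hy⟩
      refine ⟨(η _).symm y, (η _).injective ?_⟩
      refine (hη _ _ _ _).trans ?_
      exact (congrArg (· ≫ U.map _) ((η _).apply_symm_apply y)).trans hy

/-- If the underlying vector space of an additive functor `G` is `Hom(M, U(-))`, for `U` an exact
functor which preserves injective objects, then that of its derived functors is `Ext(M, U(-))`. -/
theorem exists_rightDerived_equiv_ext
    (hη : ∀ (T T' : ModuleCat.{u} S) (g : T ⟶ T') (x : G.obj T),
      η T' ((G.map g).hom x) = η T x ≫ U.map g) (q : ℕ) :
    ∃ e : ∀ T, (G.rightDerived q).obj T ≃ₗ[k] Abelian.Ext.{u} M (U.obj T) q,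
      ∀ (T T' : ModuleCat.{u} S) (g : T ⟶ T') (x : (G.rightDerived q).obj T),
        e T' (((G.rightDerived q).map g).hom x) =
          (e T x).comp (Abelian.Ext.mk₀ (U.map g)) (add_zero q) := by
  -- The formula `he` on cocycles is kept along with `e`, so that naturality can be checked on
  -- representatives, using a lift of `g` between the chosen resolutions.
  choose e he using fun T =>
    exists_rightDerived_obj_equiv_ext G U M η hη q (injectiveResolution T)
  refine ⟨e, fun T T' g x => ?_⟩
  obtain ⟨z, rfl⟩ := (injectiveResolution T).toRightDerived_surjective G q x
  let φ : InjectiveResolution.Hom (injectiveResolution T) (injectiveResolution T') g :=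
    { hom := InjectiveResolution.desc g _ _
      ι_f_zero_comp_hom_f_zero := InjectiveResolution.desc_commutes_zero g _ _ }
  have h := InjectiveResolution.extMk_comp_mk₀ (η _ z.1) (q + 1) rfl
    (comp_mapInjectiveResolution_d G U M η hη q _ z) (U.mapInjectiveResolutionHom φ)
  refine (congrArg (e T') (InjectiveResolution.rightDerived_map_toRightDerived G _ _ q φ z)).trans
    ((he T' _).trans (Eq.trans ?_ (h.symm.trans (congrArg
      (fun a => a.comp (Abelian.Ext.mk₀ (U.map g)) (add_zero q)) (he T z)).symm)))
  exact InjectiveResolution.extMk_congr _ (hη _ _ _ z.1) _ _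

end ModuleCat

/-! ### Restriction of scalars is exact and, along free extensions, preserves injectives. -/

namespace ModuleCat

section

variable {R S : Type u} [Ring R] [Ring S] (i : R →+* S)

instance preservesHomology_restrictScalars : (restrictScalars.{u} i).PreservesHomology :=
  ((CategoryTheory.Functor.exact_tfae (restrictScalars.{u} i)).out 1 2).mp fun Z hZ => by
    rw [ShortComplex.ShortExact.moduleCat_exact_iff_function_exact] at hZ ⊢
    exact hZ

end

variable {k R S W : Type u} [Field k] [Ring R] [Algebra k R] [Ring S] [Algebra k S]
  [AddCommGroup W] [Module k W] (i : R →ₐ[k] S) (φ : W →ₗ[k] S)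

/-- If `S` is free as a right `R`-module, with basis coming from a vector space `W`, then the
restriction of scalars from `S` to `R` preserves injective modules. -/
lemma preservesInjectiveObjects_restrictScalars (e : W ⊗[k] R ≃ₗ[k] S)
    (he : ∀ w r, e (w ⊗ₜ r) = φ w * i r) :
    (restrictScalars.{u} i.toRingHom).PreservesInjectiveObjects where
  injective_obj {I} hI := ⟨fun {X Y} g f hf => by
    -- the embedding of `I` in a coextension of scalars is split
    let j := RestrictionCoextensionAdj.app' (algebraMap k S) I
    have hj : Mono (ofHom j) := by
      rw [mono_iff_injective]
      intro x y hxy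
      have h : CoextendScalars.equiv _ _ (j x) (1 : S) = CoextendScalars.equiv _ _ (j y) (1 : S) :=
        congrArg (fun z : (coextendScalars (algebraMap k S)).obj
          ((restrictScalars (algebraMap k S)).obj I) => CoextendScalars.equiv _ _ z (1 : S)) hxy
      change (1 : S) • x = (1 : S) • y at h
      simpa using h
    obtain ⟨ρ, hρ⟩ := hI.factors (𝟙 I) (ofHom j)
    have hρ' : ∀ x, ρ.hom (j x) = x := fun x => ConcreteCategory.congr_hom hρ x
    let fk : X →ₗ[k] Y := f.hom.restrictScalars k
    -- A retraction of `f` exists over the field `k`; it need not be `R`-linear.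
    obtain ⟨p, hp⟩ := fk.exists_leftInverse_of_injective
      (LinearMap.ker_eq_bot.2 ((mono_iff_injective f).1 hf))
    have hp' : ∀ x, p (f.hom x) = x := fun x => LinearMap.congr_fun hp x
    let gk : X →ₗ[k] I :=
      { toFun := fun x => g.hom x
        map_add' := fun x y => map_add g.hom x y
        map_smul' := fun c x => by
          have h1 : g.hom (c • x) = i (algebraMap k R c) • (show I from g.hom x) :=
            g.hom.map_smul (algebraMap k R c) x
          rw [AlgHom.commutes] at h1
          exact h1 }
    -- Through `e`, this is the map `S ⟶ I` with `φ(w) i(r) ↦ φ(w) g(p(r y))`. Freeness of `S` over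
    -- `R` makes it well defined, and multiplying `y` by `r` inside `p` makes up for the lack of
    -- `R`-linearity of `p`.
    let G : Y → W ⊗[k] R →ₗ[k] I := fun y => TensorProduct.lift (LinearMap.mk₂ k
      (fun w r => φ w • gk (p (r • y)))
      (fun w w' r => by simp [add_smul]) (fun c w r => by simp)
      (fun w r r' => by simp [add_smul]) (fun c w r => by simp [smul_comm _ c]))
    have hG : ∀ y w r, G y (w ⊗ₜ r) = φ w • gk (p (r • y)) := fun y w r => by simp [G]
    have hGadd : ∀ y y', G (y + y') = G y + G y' := fun y y' => by
      ext w r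
      simp [hG]
    -- The action of `S` on the coextension is by right translation of the argument, so this is
    -- `R`-linearity of `y ↦ G y`.
    have hGsmul : ∀ (r₀ : R) (y : Y) (s : S), G (r₀ • y) (e.symm s) = G y (e.symm (s * i r₀)) := by
      intro r₀ y s
      obtain ⟨t, rfl⟩ := e.surjective s
      induction t with
      | zero => simp
      | add t t' h h' =>
        simp only [map_add, LinearEquiv.symm_apply_apply, add_mul] at h h' ⊢
        rw [h, h']
      | tmul w r =>
        have : e (w ⊗ₜ r) * i r₀ = e (w ⊗ₜ (r * r₀)) := by simp [he, mul_assoc]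
        rw [this, LinearEquiv.symm_apply_apply, LinearEquiv.symm_apply_apply, hG, hG, mul_smul]
    -- At `f x` the retraction cancels, because `f` is `R`-linear. The result is the function `s ↦ s
    -- • g(x)`, which is `j (g x)`, and `ρ` sends it back to `g x`.
    have hGf : ∀ (x : X) (s : S), G (f.hom x) (e.symm s) = s • gk x := by
      intro x s
      obtain ⟨t, rfl⟩ := e.surjective s
      induction t with
      | zero => simp
      | add t t' h h' =>
        simp only [map_add, LinearEquiv.symm_apply_apply, add_smul] at h h' ⊢
        rw [h, h']
      | tmul w r =>
        rw [LinearEquiv.symm_apply_apply, hG, ← map_smul f.hom r x, hp', he, mul_smul]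
        congr 1
        exact g.hom.map_smul r x
    let Γ : Y → (coextendScalars (algebraMap k S)).obj ((restrictScalars (algebraMap k S)).obj I) :=
      fun y => (CoextendScalars.equiv _ _).symm
        { toFun := fun s : S => G y (e.symm s)
          map_add' := fun s s' : S =>
            (congrArg (G y) (map_add e.symm s s')).trans (map_add (G y) _ _)
          map_smul' := fun c (s : S) => by
            have : (algebraMap k S c * s) = c • s := (Algebra.smul_def c s).symm
            refine (congrArg (fun s => G y (e.symm s)) this).trans ?_
            rw [map_smul, map_smul]
            rfl }
    refine ⟨ofHom (Y := (restrictScalars i.toRingHom).obj I)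
      { toFun := fun y => ρ.hom (Γ y)
        map_add' := fun y y' => ?_
        map_smul' := fun r y => ?_ }, ?_⟩
    · refine Eq.trans (congrArg ρ.hom ?_) (map_add ρ.hom (Γ y) (Γ y'))
      exact (CoextendScalars.equiv _ _).injective
        (LinearMap.ext fun s : S => LinearMap.congr_fun (hGadd y y') _)
    · refine Eq.trans (congrArg ρ.hom ?_) (map_smul ρ.hom (i r) (Γ y))
      exact (CoextendScalars.equiv _ _).injective
        (LinearMap.ext fun s : S => hGsmul r y s)
    · ext x
      refine Eq.trans (congrArg ρ.hom ?_) (hρ' (gk x))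
      exact (CoextendScalars.equiv _ _).injective (LinearMap.ext fun s : S => hGf x s)⟩

end ModuleCat

/-! ### Cancellations with the inverse antipode in comodules. -/

namespace HopfAux

open Coalgebra HopfAlgebra

variable {k H : Type u} [Field k] [Ring H] [HopfAlgebra k H] [HasBijectiveAntipode k H]

/-- `∑ S⁻¹(h₂) h₁ = ε(h) 1`. -/
lemma sinv_mul_comul (h : H) : LinearMap.mul' k H (TensorProduct.comm k H H
    ((sinv k).lTensor H (comul (R := k) h))) = algebraMap k H (counit h) := by
  apply (HasBijectiveAntipode.bijective (k := k) (H := H)).1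
  have : ∀ w : H ⊗[k] H, antipode k (LinearMap.mul' k H (TensorProduct.comm k H H
      ((sinv k).lTensor H w))) = LinearMap.mul' k H ((antipode k).rTensor H w) := by
    intro w
    induction w with
    | zero => simp
    | add x y hx hy => simp only [map_add, hx, hy]
    | tmul g z => simp [antipode_mul_antidistrib]
  rw [this, mul_antipode_rTensor_comul_apply]
  simp [Algebra.algebraMap_eq_smul_one]

section comodule

variable {V E : Type u} [AddCommGroup V] [Module k V] [AddCommGroup E] [Module k E]
  {δ : V →ₗ[k] H ⊗[k] V}

/-- `∑ P(v₋₁ S⁻¹(v₋₂)) v₀ = P(1) v` in a comodule. -/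
lemma cancel_mul_sinv
    (hδ : ∀ v, TensorProduct.assoc k H H V ((comul (R := k)).rTensor V (δ v)) =
      δ.lTensor H (δ v))
    (hε : ∀ v, TensorProduct.lid k V ((counit (R := k) (A := H)).rTensor V (δ v)) = v)
    (P : H →ₗ[k] V →ₗ[k] E) (L : H ⊗[k] V →ₗ[k] E) (Q : H → H ⊗[k] V →ₗ[k] E)
    (hL : ∀ h v, L (h ⊗ₜ v) = Q h (δ v)) (hQ : ∀ h g v, Q h (g ⊗ₜ v) = P (g * sinv k h) v) (v : V) :
    L (δ v) = P 1 v := by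
  -- `Ψ` sends `h ⊗ g ⊗ v` to `P(g S⁻¹(h)) v`. The hypotheses on `L` and `Q` say that `L` is `Ψ`
  -- after a second coaction. Coassociativity then turns the two coactions into a comultiplication,
  -- where `mul_sinv` applies.
  let Ψ : H ⊗[k] (H ⊗[k] V) →ₗ[k] E := TensorProduct.lift P ∘ₗ
    (LinearMap.mul' k H ∘ₗ (TensorProduct.comm k H H).toLinearMap ∘ₗ (sinv k).rTensor H).rTensor V ∘ₗ (TensorProduct.assoc k H H V).symm.toLinearMap
  have h0 : ∀ u : H ⊗[k] V, L u = Ψ (δ.lTensor H u) := by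
    intro u
    induction u with
    | zero => simp
    | add x y hx hy => simp only [map_add, hx, hy]
    | tmul h d =>
      rw [hL, LinearMap.lTensor_tmul]
      generalize δ d = w
      induction w with
      | zero => simp
      | add x y hx hy => simp only [map_add, TensorProduct.tmul_add, hx, hy]
      | tmul g z => simp [Ψ, hQ]
  have h2 : ∀ u : H ⊗[k] V, Ψ (TensorProduct.assoc k H H V ((comul (R := k)).rTensor V u)) =
      P 1 (TensorProduct.lid k V ((counit (R := k) (A := H)).rTensor V u)) := by
    intro u
    induction u with
    | zero => simp
    | add x y hx hy => simp only [map_add, hx, hy]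
    | tmul h d =>
      have := mul_sinv (k := k) h
      simp [Ψ, this, Algebra.algebraMap_eq_smul_one]
  rw [h0, ← hδ, h2, hε]

/-- `∑ P(S⁻¹(v₋₁) v₋₂) v₀ = P(1) v` in a comodule. -/
lemma cancel_sinv_mul
    (hδ : ∀ v, TensorProduct.assoc k H H V ((comul (R := k)).rTensor V (δ v)) =
      δ.lTensor H (δ v))
    (hε : ∀ v, TensorProduct.lid k V ((counit (R := k) (A := H)).rTensor V (δ v)) = v)
    (P : H →ₗ[k] V →ₗ[k] E) (L : H ⊗[k] V →ₗ[k] E) (Q : H → H ⊗[k] V →ₗ[k] E)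
    (hL : ∀ h v, L (h ⊗ₜ v) = Q h (δ v)) (hQ : ∀ h g v, Q h (g ⊗ₜ v) = P (sinv k g * h) v) (v : V) :
    L (δ v) = P 1 v := by
  -- Here `h ⊗ g ⊗ v` is sent to `P(S⁻¹(g) h) v`, and the final cancellation is `sinv_mul_comul`.
  let Ψ : H ⊗[k] (H ⊗[k] V) →ₗ[k] E := TensorProduct.lift P ∘ₗ
    (LinearMap.mul' k H ∘ₗ (TensorProduct.comm k H H).toLinearMap ∘ₗ (sinv k).lTensor H).rTensor V ∘ₗ (TensorProduct.assoc k H H V).symm.toLinearMap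
  have h0 : ∀ u : H ⊗[k] V, L u = Ψ (δ.lTensor H u) := by
    intro u
    induction u with
    | zero => simp
    | add x y hx hy => simp only [map_add, hx, hy]
    | tmul h d =>
      rw [hL, LinearMap.lTensor_tmul]
      generalize δ d = w
      induction w with
      | zero => simp
      | add x y hx hy => simp only [map_add, TensorProduct.tmul_add, hx, hy]
      | tmul g z => simp [Ψ, hQ]
  have h2 : ∀ u : H ⊗[k] V, Ψ (TensorProduct.assoc k H H V ((comul (R := k)).rTensor V u)) =
      P 1 (TensorProduct.lid k V ((counit (R := k) (A := H)).rTensor V u)) := by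
    intro u
    induction u with
    | zero => simp
    | add x y hx hy => simp only [map_add, hx, hy]
    | tmul h d =>
      have := sinv_mul_comul (k := k) h
      simp [Ψ, this, Algebra.algebraMap_eq_smul_one]
  rw [h0, ← hδ, h2, hε]

end comodule

end HopfAux

/-! ### Freeness of `A # B` over `A` on the right and over `B` on the left. -/

namespace TakeuchiSmash

open HopfAux MulOpposite

section

variable {k H A B : Type u} [Field k] [Ring H] [HopfAlgebra k H]
  [Ring A] [Algebra k A] [HModuleAlgebra k H A] [Ring B] [Algebra k B] [HComoduleAlgebra k H B]

lemma inl_mul_inr (a : A) (b : B) :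
    inl k H A B a * inr k H A B b = ofTensor k H A B (a ⊗ₜ b) := by
  rw [← pair_inl_inr, pair_tmul]
  rfl

lemma induction_on {p : TakeuchiSmash k H A B → Prop} (s : TakeuchiSmash k H A B)
    (add : ∀ s t, p s → p t → p (s + t))
    (mul : ∀ a b, p (inl k H A B a * inr k H A B b)) : p s := by
  obtain ⟨x, rfl⟩ := (ofTensor k H A B).surjective s
  induction x with
  | zero => simpa using mul 0 0
  | add x y hx hy => rw [map_add]; exact add _ _ hx hy
  | tmul a b => rw [← inl_mul_inr]; exact mul a b

lemma inr_mul_inl_eq_ofTensor (a : A) (b : B) : inr k H A B b * inl k H A B a =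
    ofTensor k H A B (rT k H A B a (HComoduleAlgebra.coact (k := k) (H := H) b)) := by
  rw [inr_mul_inl, twist_eq, pair_inl_inr]

variable [HasBijectiveAntipode k H]

section

variable {E : Type u} [AddCommGroup E] [Module k E]

lemma coact_cancel_mul_sinv (P : H →ₗ[k] B →ₗ[k] E) (L : H ⊗[k] B →ₗ[k] E)
    (Q : H → H ⊗[k] B →ₗ[k] E)
    (hL : ∀ h b, L (h ⊗ₜ b) = Q h (HComoduleAlgebra.coact (k := k) (H := H) b))
    (hQ : ∀ h g b, Q h (g ⊗ₜ b) = P (g * sinv k h) b) (b : B) :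
    L (HComoduleAlgebra.coact (k := k) (H := H) b) = P 1 b :=
  cancel_mul_sinv (E := E) (δ := (HComoduleAlgebra.coact (k := k) (H := H) (B := B)).toLinearMap)
    (HComoduleAlgebra.coact_coassoc (k := k) (H := H) (B := B))
    (HComoduleAlgebra.coact_counit (k := k) (H := H) (B := B)) P L Q hL hQ b

lemma coact_cancel_sinv_mul (P : H →ₗ[k] B →ₗ[k] E) (L : H ⊗[k] B →ₗ[k] E)
    (Q : H → H ⊗[k] B →ₗ[k] E)
    (hL : ∀ h b, L (h ⊗ₜ b) = Q h (HComoduleAlgebra.coact (k := k) (H := H) b))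
    (hQ : ∀ h g b, Q h (g ⊗ₜ b) = P (sinv k g * h) b) (b : B) :
    L (HComoduleAlgebra.coact (k := k) (H := H) b) = P 1 b :=
  cancel_sinv_mul (E := E) (δ := (HComoduleAlgebra.coact (k := k) (H := H) (B := B)).toLinearMap)
    (HComoduleAlgebra.coact_coassoc (k := k) (H := H) (B := B))
    (HComoduleAlgebra.coact_counit (k := k) (H := H) (B := B)) P L Q hL hQ b

end

variable (k H A B) in
/-- The linear map `B ⊗ A → A ⊗ B`, `b ⊗ a ↦ ∑ (b₋₁ ⇀ a) ⊗ b₀`. -/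
noncomputable def swap : B ⊗[k] A →ₗ[k] A ⊗[k] B :=
  TensorProduct.lift (twist k H A B)

lemma swap_tmul (a : A) (b : B) : swap k H A B (b ⊗ₜ a) =
    rT k H A B a (HComoduleAlgebra.coact (k := k) (H := H) b) := by
  rw [swap, TensorProduct.lift.tmul, twist_eq]

variable (k H A B) in
/-- The linear map `h ⊗ b ↦ b ⊗ (S⁻¹(h) ⇀ a)`. -/
noncomputable def unswapAux : A →ₗ[k] H ⊗[k] B →ₗ[k] B ⊗[k] A :=
  (TensorProduct.uncurry (RingHom.id k) H B (B ⊗[k] A)) ∘ₗ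
    { toFun := fun a => (LinearMap.flip (TensorProduct.mk k B A)) ∘ₗ
        ((HModuleAlgebra.act (k := k) (H := H) (A := A)).toLinearMap.flip a ∘ₗ sinv k)
      map_add' := by intros; ext; simp
      map_smul' := by intros; ext; simp }

@[simp] lemma unswapAux_tmul (a : A) (b : B) (h : H) : unswapAux k H A B a (h ⊗ₜ b) =
    b ⊗ₜ HModuleAlgebra.act (k := k) (sinv k h) a := by
  simp [unswapAux]

variable (k H A B) in
/-- The linear map `A ⊗ B → B ⊗ A`, `a ⊗ b ↦ ∑ b₀ ⊗ (S⁻¹(b₋₁) ⇀ a)`. -/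
noncomputable def unswap : A ⊗[k] B →ₗ[k] B ⊗[k] A :=
  TensorProduct.lift ((unswapAux k H A B).compl₂
    (HComoduleAlgebra.coact (k := k) (H := H) (B := B)).toLinearMap)

@[simp] lemma unswap_tmul (a : A) (b : B) : unswap k H A B (a ⊗ₜ b) =
    unswapAux k H A B a (HComoduleAlgebra.coact (k := k) (H := H) b) := by
  simp [unswap]

/-- The composite is `∑ (b₋₁ S⁻¹(b₋₂) ⇀ a) ⊗ b₀`, which collapses to `a ⊗ b`. -/
lemma swap_unswap (a : A) (b : B) : swap k H A B (unswap k H A B (a ⊗ₜ b)) = a ⊗ₜ b := by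
  let P : H →ₗ[k] B →ₗ[k] A ⊗[k] B := (TensorProduct.mk k A B) ∘ₗ
    (HModuleAlgebra.act (k := k) (H := H) (A := A)).toLinearMap.flip a
  rw [unswap_tmul]
  refine (coact_cancel_mul_sinv P (swap k H A B ∘ₗ unswapAux k H A B a)
    (fun h => rT k H A B (HModuleAlgebra.act (k := k) (sinv k h) a)) ?_ ?_ b).trans ?_
  · intro h b
    simp [swap_tmul]
  · intro h g b
    simp [P]
  · simp [P]

/-- The composite is `∑ b₀ ⊗ (S⁻¹(b₋₁) b₋₂ ⇀ a)`, which collapses to `b ⊗ a`. -/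
lemma unswap_swap (a : A) (b : B) : unswap k H A B (swap k H A B (b ⊗ₜ a)) = b ⊗ₜ a := by
  let P : H →ₗ[k] B →ₗ[k] B ⊗[k] A := (TensorProduct.mk k B A).flip ∘ₗ
    (HModuleAlgebra.act (k := k) (H := H) (A := A)).toLinearMap.flip a
  rw [swap_tmul]
  refine (coact_cancel_sinv_mul P (unswap k H A B ∘ₗ rT k H A B a)
    (fun h => unswapAux k H A B (HModuleAlgebra.act (k := k) h a)) ?_ ?_ b).trans ?_
  · intro h b
    simp
  · intro h g b
    simp [P]
  · simp [P]

variable (k H A B) in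
/-- The linear isomorphism `B ⊗ A ≃ A # B`, `b ⊗ a ↦ (1 # b)(a # 1)`. -/
noncomputable def swapEquiv : B ⊗[k] A ≃ₗ[k] TakeuchiSmash k H A B :=
  (LinearEquiv.ofLinearMap (swap k H A B) (unswap k H A B)
    (TensorProduct.ext' fun a b => swap_unswap a b)
    (TensorProduct.ext' fun b a => unswap_swap a b) : B ⊗[k] A ≃ₗ[k] A ⊗[k] B).trans
    (ofTensor k H A B)

lemma swapEquiv_tmul (a : A) (b : B) :
    swapEquiv k H A B (b ⊗ₜ a) = inr k H A B b * inl k H A B a := by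
  rw [inr_mul_inl_eq_ofTensor, ← swap_tmul]
  rfl

variable (k H A B) in
/-- The linear isomorphism `A ⊗ Bᵒᵖ ≃ (A # B)ᵒᵖ` given by the multiplication of `(A # B)ᵒᵖ`. -/
noncomputable def opSwapEquiv : A ⊗[k] Bᵐᵒᵖ ≃ₗ[k] (TakeuchiSmash k H A B)ᵐᵒᵖ :=
  (TensorProduct.congr (LinearEquiv.refl k A) (opLinearEquiv k).symm).trans
    ((TensorProduct.comm k A B).trans ((swapEquiv k H A B).trans (opLinearEquiv k)))

lemma opSwapEquiv_tmul (a : A) (b : Bᵐᵒᵖ) :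
    opSwapEquiv k H A B (a ⊗ₜ b) =
      ((opLinearEquiv k).toLinearMap ∘ₗ (inl k H A B).toLinearMap) a *
        AlgHom.op (inr k H A B) b := by
  change op (swapEquiv k H A B (b.unop ⊗ₜ a)) = _
  rw [swapEquiv_tmul]
  rfl

end

/-! ### Left modules -/

section left

variable {k H A B : Type u} [Field k] [Ring H] [HopfAlgebra k H]
  [Ring A] [Algebra k A] [HModuleAlgebra k H A] [Ring B] [Algebra k B] [HComoduleAlgebra k H B]
  {M X T : Type u}
  [AddCommGroup M] [Module k M] [Module (TakeuchiSmash k H A H) M]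
  [IsScalarTower k (TakeuchiSmash k H A H) M]
  [AddCommGroup X] [Module k X] [Module B X] [IsScalarTower k B X]
  [AddCommGroup T] [Module k T] [Module (TakeuchiSmash k H A B) T]
  [IsScalarTower k (TakeuchiSmash k H A B) T]

variable (k H A B M X) in
/-- The action of `H ⊗ B` on `M ⊗ X`. -/
noncomputable def actHB (m : M) (x : X) : H ⊗[k] B →ₗ[k] M ⊗[k] X :=
  TensorProduct.map
    (((Algebra.lsmul k k M).toLinearMap ∘ₗ (inr k H A H).toLinearMap).flip m)
    ((Algebra.lsmul k k X).toLinearMap.flip x)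

@[simp] lemma actHB_tmul (m : M) (x : X) (h : H) (b : B) :
    actHB k H A B M X m x (h ⊗ₜ b) = (inr k H A H h • m) ⊗ₜ (b • x) := by
  simp [actHB]

lemma toTensor_inl (a : A) : toTensor k H A B (inl k H A B a) = inl k H A H a ⊗ₜ 1 := by
  refine (pair_tmul _ _ a 1).trans ?_
  simp only [AlgHom.toLinearMap_apply, map_one, mul_one]
  rfl

lemma toTensor_inr (b : B) : toTensor k H A B (inr k H A B b) =
    Algebra.TensorProduct.map (inr k H A H) (AlgHom.id k B) (HComoduleAlgebra.coact b) := by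
  refine (pair_tmul _ _ 1 b).trans ?_
  simp only [AlgHom.toLinearMap_apply, map_one, one_mul]
  rfl

lemma tensorRep_inl (a : A) (m : M) (x : X) :
    tensorRep k H A B M X (inl k H A B a) (m ⊗ₜ x) = (inl k H A H a • m) ⊗ₜ x := by
  simp [tensorRep, toTensor_inl, Module.endTensorEndAlgHom_apply]

lemma tensorRep_inr (b : B) (m : M) (x : X) :
    tensorRep k H A B M X (inr k H A B b) (m ⊗ₜ x) =
      actHB k H A B M X m x (HComoduleAlgebra.coact b) := by
  simp only [tensorRep, AlgHom.comp_apply, toTensor_inr]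
  generalize HComoduleAlgebra.coact (k := k) (H := H) b = u
  induction u with
  | zero => simp
  | add x y hx hy => simp only [map_add, LinearMap.add_apply, hx, hy]
  | tmul h d => simp [Module.endTensorEndAlgHom_apply]

variable [HasBijectiveAntipode k H]

/-- If `f` is linear over `1 # B`, then `x ↦ f(- ⊗ x)` is linear over `B`. -/
lemma homRepAux_of_linear (f : M ⊗[k] X →ₗ[k] T)
    (hf : ∀ b v, f (tensorRep k H A B M X (inr k H A B b) v) = inr k H A B b • f v)
    (b : B) (x : X) :
    homRepAux k H A B M T (HComoduleAlgebra.coact b) (f ∘ₗ (TensorProduct.mk k M X).flip x) =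
      f ∘ₗ (TensorProduct.mk k M X).flip (b • x) := by
  ext m
  -- `P(h, b) = f(h m ⊗ b x)`. Linearity of `f` turns `∑ b₀ f(S⁻¹(b₋₁) m ⊗ x)` into `∑ P(b₋₁
  -- S⁻¹(b₋₂), b₀)`.
  let P : H →ₗ[k] B →ₗ[k] T := TensorProduct.curry (f ∘ₗ actHB k H A B M X m x)
  refine (coact_cancel_mul_sinv P ((homRepAux k H A B M T).toLinearMap.flip
      (f ∘ₗ (TensorProduct.mk k M X).flip x) |> (LinearMap.applyₗ m).comp)
    (fun h => f ∘ₗ actHB k H A B M X (inr k H A H (sinv k h) • m) x) ?_ ?_ b).trans ?_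
  · intro h b
    simp [← hf, tensorRep_inr]
  · intro h g b
    simp [P, mul_smul]
  · simp [P]

/-- If `x ↦ f(- ⊗ x)` is linear over `B` with values in `Hom_A(M, T)`, then `f` is linear over
`A # B`. -/
lemma linear_of_homRepAux (f : M ⊗[k] X →ₗ[k] T)
    (hA : ∀ x, f ∘ₗ (TensorProduct.mk k M X).flip x ∈ homA k H A B M T)
    (hB : ∀ (b : B) (x : X),
      homRepAux k H A B M T (HComoduleAlgebra.coact b) (f ∘ₗ (TensorProduct.mk k M X).flip x) =
        f ∘ₗ (TensorProduct.mk k M X).flip (b • x))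
    (s : TakeuchiSmash k H A B) (v : M ⊗[k] X) : f (tensorRep k H A B M X s v) = s • f v := by
  have hinr : ∀ b v, f (tensorRep k H A B M X (inr k H A B b) v) = inr k H A B b • f v := by
    intro b v
    induction v with
    | zero => simp
    | add x y hx hy => simp only [map_add, hx, hy, smul_add]
    | tmul m x =>
      -- `P(h, b) = b f(h m ⊗ x)`. By `hB`, `∑ f(b₋₁ m ⊗ b₀ x)` becomes `∑ P(S⁻¹(b₋₁) b₋₂, b₀)`,
      -- which is `b f(m ⊗ x)`.
      let P : H →ₗ[k] B →ₗ[k] T := LinearMap.mk₂ k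
        (fun h b => inr k H A B b • f ((inr k H A H h • m) ⊗ₜ x))
        (by intros; simp [add_smul, TensorProduct.add_tmul])
        (by intro c h b; simp [← TensorProduct.smul_tmul', smul_comm _ c])
        (by intros; simp [add_smul]) (by intros; simp)
      have hP : ∀ h b, P h b = inr k H A B b • f ((inr k H A H h • m) ⊗ₜ x) := fun _ _ => rfl
      rw [tensorRep_inr]
      refine (coact_cancel_sinv_mul P (f ∘ₗ actHB k H A B M X m x)
        (fun h => (homRepAux k H A B M T).toLinearMap.flip
          (f ∘ₗ (TensorProduct.mk k M X).flip x) |>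
            (LinearMap.applyₗ (inr k H A H h • m)).comp) ?_ ?_ b).trans ?_
      · intro h b
        simp [hB]
      · intro h g b
        simp [hP, mul_smul]
      · simp [hP]
  have hinl : ∀ a v, f (tensorRep k H A B M X (inl k H A B a) v) = inl k H A B a • f v := by
    intro a v
    induction v with
    | zero => simp
    | add x y hx hy => simp only [map_add, hx, hy, smul_add]
    | tmul m x => rw [tensorRep_inl]; exact hA x a m
  induction s using induction_on with
  | add s t hs ht => rw [map_add, LinearMap.add_apply, map_add, hs, ht, add_smul]
  | mul a b => rw [map_mul, Module.End.mul_apply, hinl, hinr, mul_smul]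

end left
end TakeuchiSmash

/-! ### The adjunction for left modules. -/

namespace TakeuchiSmash

open HopfAux MulOpposite

section leftAdjunction

variable {k H A B : Type u} [Field k] [Ring H] [HopfAlgebra k H]
  [Ring A] [Algebra k A] [HModuleAlgebra k H A] [Ring B] [Algebra k B] [HComoduleAlgebra k H B]
  {M : ModuleCat.{u} (TakeuchiSmash k H A H)} {X : ModuleCat.{u} B}
  {T : ModuleCat.{u} (TakeuchiSmash k H A B)}

/-- The linear map on `M ⊗ X` underlying a morphism from `M # X`. -/
noncomputable def smashHomLinear (f : (smashFunctor k H A B M).obj X ⟶ T) : M ⊗[k] X →ₗ[k] T where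
  toFun v := f.hom v
  map_add' v w := map_add f.hom v w
  map_smul' c v := by
    -- `f` is only known to be `A # B`-linear. Since `tensorRep` is a map of `k`-algebras, the
    -- scalars of `A # B` act on `M ⊗ X` as those of `k`.
    have h1 : f.hom (tensorRep k H A B M X (algebraMap k _ c) v) =
      algebraMap k (TakeuchiSmash k H A B) c • f.hom v := f.hom.map_smul (algebraMap k _ c) v
    rw [AlgHom.commutes] at h1
    exact h1

lemma smashHomLinear_tensorRep (f : (smashFunctor k H A B M).obj X ⟶ T)
    (s : TakeuchiSmash k H A B) (v : M ⊗[k] X) :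
    smashHomLinear f (tensorRep k H A B M X s v) = s • smashHomLinear f v :=
  f.hom.map_smul s v

variable [HasBijectiveAntipode k H]

/-- The adjunct `x ↦ (m ↦ f (m # x))` of a morphism `f`. -/
noncomputable def smashAdjunct (f : (smashFunctor k H A B M).obj X ⟶ T) :
    X ⟶ (homFunctor k H A B M).obj T :=
  ModuleCat.ofHom (Y := HomModule k H A B M T)
    { toFun := fun x => (⟨smashHomLinear f ∘ₗ (TensorProduct.mk k M X).flip x, fun a m => by
        simp only [LinearMap.comp_apply, LinearMap.flip_apply, TensorProduct.mk_apply]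
        rw [← smashHomLinear_tensorRep, tensorRep_inl]⟩ : homA k H A B M T)
      map_add' := fun x y => Subtype.ext (by
        change smashHomLinear f ∘ₗ (TensorProduct.mk k M X).flip (x + y) =
          smashHomLinear f ∘ₗ (TensorProduct.mk k M X).flip x +
          smashHomLinear f ∘ₗ (TensorProduct.mk k M X).flip y
        rw [map_add, LinearMap.comp_add])
      map_smul' := fun b x => Subtype.ext
        (homRepAux_of_linear (smashHomLinear f)
          (fun b v => smashHomLinear_tensorRep f _ v) b x).symm }

/-- The `k`-linear map underlying a morphism to `Hom_A(M, T)`. -/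
noncomputable def homLinear (g : X ⟶ (homFunctor k H A B M).obj T) : X →ₗ[k] M →ₗ[k] T where
  toFun x := Subtype.val (p := (· ∈ homA k H A B M T)) (g.hom x)
  map_add' x y := congrArg (Subtype.val (p := (· ∈ homA k H A B M T))) (map_add g.hom x y)
  map_smul' c x := by
    refine (congrArg (Subtype.val (p := (· ∈ homA k H A B M T)))
      (g.hom.map_smul (algebraMap k B c) x)).trans ?_
    exact congrArg Subtype.val (LinearMap.congr_fun ((homRep k H A B M T).commutes c) (g.hom x))

lemma homLinear_smul (g : X ⟶ (homFunctor k H A B M).obj T) (b : B) (x : X) :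
    homLinear g (b • x) = homRepAux k H A B M T (HComoduleAlgebra.coact b) (homLinear g x) :=
  congrArg (Subtype.val (p := (· ∈ homA k H A B M T))) (g.hom.map_smul b x)

lemma lift_homLinear_flip_comp (g : X ⟶ (homFunctor k H A B M).obj T) (x : X) :
    TensorProduct.lift (homLinear g).flip ∘ₗ (TensorProduct.mk k M X).flip x = homLinear g x := by
  ext m
  simp

/-- The morphism `m # x ↦ g(x)(m)` whose adjunct is `g`. -/
noncomputable def smashCoadjunct (g : X ⟶ (homFunctor k H A B M).obj T) :
    (smashFunctor k H A B M).obj X ⟶ T :=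
  ModuleCat.ofHom (X := SmashModule k H A B M X)
    { toFun := fun v => TensorProduct.lift (homLinear g).flip v
      map_add' := fun v w => map_add (TensorProduct.lift (homLinear g).flip) v w
      map_smul' := fun s v => linear_of_homRepAux (TensorProduct.lift (homLinear g).flip)
        (fun x => by
          rw [lift_homLinear_flip_comp]
          exact Subtype.prop (p := (· ∈ homA k H A B M T)) (g.hom x))
        (fun b x => by rw [lift_homLinear_flip_comp, lift_homLinear_flip_comp, homLinear_smul])
        s v }

variable (k H A B M) in
/-- The functor `M # -` is left adjoint to `Hom_A(M, -)`. -/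
noncomputable def smashAdjunction : smashFunctor k H A B M ⊣ homFunctor k H A B M :=
  Adjunction.mkOfHomEquiv
    { homEquiv := fun X T =>
        { toFun := smashAdjunct
          invFun := smashCoadjunct
          left_inv := fun f => ModuleCat.hom_ext (LinearMap.ext fun v : M ⊗[k] X => by
            change TensorProduct.lift (homLinear (smashAdjunct f)).flip v = smashHomLinear f v
            exact LinearMap.congr_fun (f := TensorProduct.lift (homLinear (smashAdjunct f)).flip)
              (g := smashHomLinear f) (TensorProduct.ext' fun m x => rfl) v)
          right_inv := fun g => ModuleCat.hom_ext (LinearMap.ext fun x => Subtype.ext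
            (lift_homLinear_flip_comp g x)) }
      homEquiv_naturality_left_symm := fun {X X' T} f g =>
        ModuleCat.hom_ext (LinearMap.ext fun v : M ⊗[k] X => by
          change TensorProduct.lift (homLinear (f ≫ g)).flip v =
            TensorProduct.lift (homLinear g).flip ((f.hom.restrictScalars k).lTensor M v)
          exact LinearMap.congr_fun (f := TensorProduct.lift (homLinear (f ≫ g)).flip) (g := TensorProduct.lift (homLinear g).flip ∘ₗ
            (f.hom.restrictScalars k).lTensor M) (TensorProduct.ext' fun m x => rfl) v)
      homEquiv_naturality_right := fun {X T T'} f g => rfl }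

lemma smashAdjunction_homEquiv_eval (f : (smashFunctor k H A B M).obj X ⟶ T) (x : X) (m : M) :
    homEval k H A B M T (((smashAdjunction k H A B M).homEquiv X T f).hom x) m =
      f.hom (smashTmul k H A B M X m x) := by
  rw [smashAdjunction, Adjunction.mkOfHomEquiv_homEquiv]
  rfl

/-- `M` is flat over the field `k`. Through the adjunction, this makes `Hom_A(M, -)` preserve
injectives. -/
instance : (smashFunctor k H A B M).PreservesMonomorphisms where
  preserves {X X'} f hf := by
    rw [ModuleCat.mono_iff_injective] at hf ⊢
    exact Module.Flat.lTensor_preserves_injective_linearMap (M := M) (f.hom.restrictScalars k) hf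

/-- The scalars of `k` act on `Hom_A(M, T')` through `B`. As `homRep` is a map of `k`-algebras, this
is the pointwise action. -/
instance : (homFunctor k H A B M).Linear k where
  map_smul {T T'} g c := ModuleCat.hom_ext (LinearMap.ext fun f => Subtype.ext (by
    refine Eq.trans ?_ (congrArg Subtype.val (LinearMap.congr_fun
      ((homRep k H A B M T').commutes c) (((homFunctor k H A B M).map g).hom f))).symm
    rfl))

/-- The `k`-vector space underlying `Hom_A(M, T)` is the space of morphisms of `A`-modules. -/
noncomputable def homFunctorObjEquiv (M : ModuleCat.{u} (TakeuchiSmash k H A H))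
    (T : ModuleCat.{u} (TakeuchiSmash k H A B)) :
    (homFunctor k H A B M).obj T ≃ₗ[k] ((resA k H A H).obj M ⟶ (resA k H A B).obj T) where
  toFun f := ModuleCat.ofHom (X := (resA k H A H).obj M) (Y := (resA k H A B).obj T)
    { toFun := fun m => homEval k H A B M T f m
      map_add' := fun m m' => map_add (Subtype.val (p := (· ∈ homA k H A B M T)) f) m m'
      map_smul' := fun a m => Subtype.prop (p := (· ∈ homA k H A B M T)) f a m }
  invFun g := (⟨{ toFun := fun m => g.hom m
                  map_add' := fun m m' => map_add g.hom m m'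
                  map_smul' := fun c m => by
                    have h1 : g.hom (inl k H A H (algebraMap k A c) • (show M from m)) =
                      inl k H A B (algebraMap k A c) • (show T from g.hom m) :=
                      g.hom.map_smul (algebraMap k A c) m
                    rw [AlgHom.commutes, AlgHom.commutes] at h1
                    exact h1 }, fun a m => g.hom.map_smul a m⟩ : homA k H A B M T)
  left_inv f := rfl
  right_inv g := rfl
  map_add' f f' := rfl
  map_smul' c f := by
    have h1 : (c • f : (homFunctor k H A B M).obj T) = (c • (show homA k H A B M T from f) :) :=
      LinearMap.congr_fun ((homRep k H A B M T).commutes c) f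
    refine ModuleCat.hom_ext (LinearMap.ext fun m => ?_)
    refine (congrArg (fun z => homEval k H A B M T z m) h1).trans ?_
    -- The two `k`-structures on the values come from `A # B` and from `A`; they agree because `inl`
    -- is a map of `k`-algebras.
    change algebraMap k (TakeuchiSmash k H A B) c • homEval k H A B M T f m =
      inl k H A B (algebraMap k A c) • homEval k H A B M T f m
    rw [AlgHom.commutes]

lemma homFunctorObjEquiv_map {T T' : ModuleCat.{u} (TakeuchiSmash k H A B)} (g : T ⟶ T')
    (f : (homFunctor k H A B M).obj T) :
    homFunctorObjEquiv M T' (((homFunctor k H A B M).map g).hom f) =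
      homFunctorObjEquiv M T f ≫ (resA k H A B).map g := rfl

end leftAdjunction

end TakeuchiSmash

/-! ### The adjunction for right modules. -/

namespace TakeuchiSmash

open HopfAux MulOpposite

section right

variable {k H A B : Type u} [Field k] [Ring H] [HopfAlgebra k H]
  [Ring A] [Algebra k A] [HModuleAlgebra k H A] [Ring B] [Algebra k B] [HComoduleAlgebra k H B]
  {N Y T : Type u}
  [AddCommGroup N] [Module k N] [Module Aᵐᵒᵖ N] [IsScalarTower k Aᵐᵒᵖ N]
  [AddCommGroup Y] [Module k Y] [Module Bᵐᵒᵖ Y] [IsScalarTower k Bᵐᵒᵖ Y]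
  [RightHopfModule k H B Y]
  [AddCommGroup T] [Module k T] [Module (TakeuchiSmash k H A B)ᵐᵒᵖ T]
  [IsScalarTower k (TakeuchiSmash k H A B)ᵐᵒᵖ T]

lemma rightTensorRep_inl (a : A) (n : N) (y : Y) :
    rightTensorRep k H A B N Y (op (inl k H A B a)) (n ⊗ₜ y) =
      rightAux k H A N Y n a (RightHopfModule.coact (k := k) (H := H) (B := B) y) := by
  change (rmul k B Y 1).lTensor N (rightAux k H A N Y n a
    (RightHopfModule.coact (k := k) (H := H) (B := B) y)) = _
  have : rmul k B Y 1 = LinearMap.id := by ext; simp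
  rw [this, LinearMap.lTensor_id, LinearMap.id_apply]

lemma rightTensorRep_inr (b : B) (n : N) (y : Y) :
    rightTensorRep k H A B N Y (op (inr k H A B b)) (n ⊗ₜ y) = n ⊗ₜ (op b • y) := by
  change (rmul k B Y b).lTensor N (rightActA k H A B N Y 1 (n ⊗ₜ y)) = _
  rw [rightActA_one]
  simp

variable [HasBijectiveAntipode k H]

/-- If `f` is linear over `A # 1`, then `n ↦ f(n ⊗ -)` is linear over `A`. -/
lemma rightHomRepAux_of_linear (f : N ⊗[k] Y →ₗ[k] T)
    (hf : ∀ a v, f (rightTensorRep k H A B N Y (op (inl k H A B a)) v) =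
      op (inl k H A B a) • f v) (a : A) (n : N) :
    rightHomRepAux k H A B Y T a (f ∘ₗ TensorProduct.mk k N Y n) =
      f ∘ₗ TensorProduct.mk k N Y (op a • n) := by
  ext y
  -- `P(h, y) = f(n (h ⇀ a) ⊗ y)`. Linearity of `f` turns `∑ f(n ⊗ y₀)(S⁻¹(y₋₁) ⇀ a)` into `∑ P(y₋₁
  -- S⁻¹(y₋₂), y₀)`.
  let P : H →ₗ[k] Y →ₗ[k] T := TensorProduct.curry (f ∘ₗ rightAux k H A N Y n a)
  rw [rightHomRepAux_apply]
  refine (cancel_mul_sinv (RightHopfModule.coact_coassoc (k := k) (H := H) (B := B) (Y := Y))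
    (RightHopfModule.coact_counit (k := k) (H := H) (B := B) (Y := Y)) P
    (rightHomAux k H A B Y T a (f ∘ₗ TensorProduct.mk k N Y n))
    (fun h => f ∘ₗ rightAux k H A N Y n (HModuleAlgebra.act (k := k) (sinv k h) a))
    ?_ ?_ y).trans ?_
  · intro h y
    simp [← hf, rightTensorRep_inl]
  · intro h g y
    simp [P]
  · simp [P]

/-- If `n ↦ f(n ⊗ -)` is linear over `A` with values in `Hom_{B^op}(Y, T)`, then `f` is linear
over `A # B`. -/
lemma linear_of_rightHomRepAux (f : N ⊗[k] Y →ₗ[k] T)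
    (hB : ∀ n, f ∘ₗ TensorProduct.mk k N Y n ∈ homB k H A B Y T)
    (hA : ∀ (a : A) (n : N), rightHomRepAux k H A B Y T a (f ∘ₗ TensorProduct.mk k N Y n) =
      f ∘ₗ TensorProduct.mk k N Y (op a • n))
    (s : TakeuchiSmash k H A B) (v : N ⊗[k] Y) :
    f (rightTensorRep k H A B N Y (op s) v) = op s • f v := by
  have hinr : ∀ b v, f (rightTensorRep k H A B N Y (op (inr k H A B b)) v) =
      op (inr k H A B b) • f v := by
    intro b v
    induction v with
    | zero => simp
    | add x y hx hy => simp only [map_add, hx, hy, smul_add]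
    | tmul n y => rw [rightTensorRep_inr]; exact hB n b y
  have hinl : ∀ a v, f (rightTensorRep k H A B N Y (op (inl k H A B a)) v) =
      op (inl k H A B a) • f v := by
    intro a v
    induction v with
    | zero => simp
    | add x y hx hy => simp only [map_add, hx, hy, smul_add]
    | tmul n y =>
      -- `P(h, y) = f(n ⊗ y)(h ⇀ a)`. By `hA`, `∑ f(n (y₋₁ ⇀ a) ⊗ y₀)` becomes `∑ P(S⁻¹(y₋₁) y₋₂,
      -- y₀)`, which is `f(n ⊗ y) a`.
      let P : H →ₗ[k] Y →ₗ[k] T := LinearMap.mk₂ k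
        (fun h y => op (inl k H A B (HModuleAlgebra.act (k := k) h a)) • f (n ⊗ₜ y))
        (by intros; simp [add_smul]) (by intros; simp)
        (by intros; simp [TensorProduct.tmul_add])
        (by intro c h y; simp [smul_comm _ c])
      have hP : ∀ h y, P h y =
        op (inl k H A B (HModuleAlgebra.act (k := k) h a)) • f (n ⊗ₜ y) := fun _ _ => rfl
      rw [rightTensorRep_inl]
      refine (cancel_sinv_mul (RightHopfModule.coact_coassoc (k := k) (H := H) (B := B) (Y := Y))
        (RightHopfModule.coact_counit (k := k) (H := H) (B := B) (Y := Y)) P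
        (f ∘ₗ rightAux k H A N Y n a)
        (fun h => rightHomAux k H A B Y T (HModuleAlgebra.act (k := k) h a)
          (f ∘ₗ TensorProduct.mk k N Y n)) ?_ ?_ y).trans ?_
      · intro h y
        rw [← rightHomRepAux_apply, hA]
        simp
      · intro h g y
        simp [hP]
      · simp [hP]
  induction s using induction_on with
  | add s t hs ht => rw [MulOpposite.op_add, map_add, LinearMap.add_apply, map_add, hs, ht, add_smul]
  | mul a b => rw [MulOpposite.op_mul, map_mul, Module.End.mul_apply, hinr, hinl, mul_smul]

end right

section rightAdjunction

variable {k H A B : Type u} [Field k] [Ring H] [HopfAlgebra k H]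
  [Ring A] [Algebra k A] [HModuleAlgebra k H A] [Ring B] [Algebra k B] [HComoduleAlgebra k H B]
  {Y : Type u} [AddCommGroup Y] [Module k Y] [Module Bᵐᵒᵖ Y] [IsScalarTower k Bᵐᵒᵖ Y]
  [RightHopfModule k H B Y] {N : ModuleCat.{u} Aᵐᵒᵖ}
  {T : ModuleCat.{u} (TakeuchiSmash k H A B)ᵐᵒᵖ}

/-- The linear map on `N ⊗ Y` underlying a morphism from `N # Y`. -/
noncomputable def rightSmashHomLinear (f : (rightSmashFunctor k H A B Y).obj N ⟶ T) :
    N ⊗[k] Y →ₗ[k] T where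
  toFun v := f.hom v
  map_add' v w := map_add f.hom v w
  map_smul' c v := by
    have h1 : f.hom (rightTensorRep k H A B N Y (algebraMap k _ c) v) =
      algebraMap k (TakeuchiSmash k H A B)ᵐᵒᵖ c • f.hom v := f.hom.map_smul (algebraMap k _ c) v
    rw [AlgHom.commutes] at h1
    exact h1

lemma rightSmashHomLinear_tensorRep (f : (rightSmashFunctor k H A B Y).obj N ⟶ T)
    (s : (TakeuchiSmash k H A B)ᵐᵒᵖ) (v : N ⊗[k] Y) :
    rightSmashHomLinear f (rightTensorRep k H A B N Y s v) = s • rightSmashHomLinear f v :=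
  f.hom.map_smul s v

variable [HasBijectiveAntipode k H]

/-- The adjunct `n ↦ (y ↦ f (n # y))` of a morphism `f`. -/
noncomputable def rightSmashAdjunct (f : (rightSmashFunctor k H A B Y).obj N ⟶ T) :
    N ⟶ (rightHomFunctor k H A B Y).obj T :=
  ModuleCat.ofHom (Y := RightHomModule k H A B Y T)
    { toFun := fun n => (⟨rightSmashHomLinear f ∘ₗ TensorProduct.mk k N Y n, fun b y => by
        simp only [LinearMap.comp_apply, TensorProduct.mk_apply]
        rw [← rightSmashHomLinear_tensorRep, rightTensorRep_inr]⟩ : homB k H A B Y T)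
      map_add' := fun n n' => Subtype.ext (by
        change rightSmashHomLinear f ∘ₗ TensorProduct.mk k N Y (n + n') =
          rightSmashHomLinear f ∘ₗ TensorProduct.mk k N Y n +
          rightSmashHomLinear f ∘ₗ TensorProduct.mk k N Y n'
        rw [map_add, LinearMap.comp_add])
      map_smul' := fun a n => Subtype.ext
        (rightHomRepAux_of_linear (rightSmashHomLinear f)
          (fun a v => rightSmashHomLinear_tensorRep f _ v) a.unop n).symm }

/-- The `k`-linear map underlying a morphism to `Hom_{B^op}(Y, T)`. -/
noncomputable def rightHomLinear (g : N ⟶ (rightHomFunctor k H A B Y).obj T) :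
    N →ₗ[k] Y →ₗ[k] T where
  toFun n := Subtype.val (p := (· ∈ homB k H A B Y T)) (g.hom n)
  map_add' n n' := congrArg (Subtype.val (p := (· ∈ homB k H A B Y T))) (map_add g.hom n n')
  map_smul' c n := by
    refine (congrArg (Subtype.val (p := (· ∈ homB k H A B Y T)))
      (g.hom.map_smul (algebraMap k Aᵐᵒᵖ c) n)).trans ?_
    exact congrArg Subtype.val
      (LinearMap.congr_fun ((rightHomRep k H A B Y T).commutes c) (g.hom n))

lemma rightHomLinear_smul (g : N ⟶ (rightHomFunctor k H A B Y).obj T) (a : A) (n : N) :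
    rightHomLinear g (op a • n) = rightHomRepAux k H A B Y T a (rightHomLinear g n) :=
  congrArg (Subtype.val (p := (· ∈ homB k H A B Y T))) (g.hom.map_smul (op a) n)

lemma lift_rightHomLinear_comp (g : N ⟶ (rightHomFunctor k H A B Y).obj T) (n : N) :
    TensorProduct.lift (rightHomLinear g) ∘ₗ TensorProduct.mk k N Y n = rightHomLinear g n := by
  ext y
  simp

/-- The morphism `n # y ↦ g(n)(y)` whose adjunct is `g`. -/
noncomputable def rightSmashCoadjunct (g : N ⟶ (rightHomFunctor k H A B Y).obj T) :
    (rightSmashFunctor k H A B Y).obj N ⟶ T :=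
  ModuleCat.ofHom (X := RightSmashModule k H A B N Y)
    { toFun := fun v => TensorProduct.lift (rightHomLinear g) v
      map_add' := fun v w => map_add (TensorProduct.lift (rightHomLinear g)) v w
      map_smul' := fun s v => linear_of_rightHomRepAux (TensorProduct.lift (rightHomLinear g))
        (fun n => by
          rw [lift_rightHomLinear_comp]
          exact Subtype.prop (p := (· ∈ homB k H A B Y T)) (g.hom n))
        (fun a n => by
          rw [lift_rightHomLinear_comp, lift_rightHomLinear_comp, rightHomLinear_smul])
        s.unop v }

variable (k H A B Y) in
/-- The functor `- # Y` is left adjoint to `Hom_{B^op}(Y, -)`. -/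
noncomputable def rightSmashAdjunction :
    rightSmashFunctor k H A B Y ⊣ rightHomFunctor k H A B Y :=
  Adjunction.mkOfHomEquiv
    { homEquiv := fun N T =>
        { toFun := rightSmashAdjunct
          invFun := rightSmashCoadjunct
          left_inv := fun f => ModuleCat.hom_ext (LinearMap.ext fun v : N ⊗[k] Y => by
            change TensorProduct.lift (rightHomLinear (rightSmashAdjunct f)) v =
              rightSmashHomLinear f v
            exact LinearMap.congr_fun
              (f := TensorProduct.lift (rightHomLinear (rightSmashAdjunct f)))
              (g := rightSmashHomLinear f) (TensorProduct.ext' fun n y => rfl) v)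
          right_inv := fun g => ModuleCat.hom_ext (LinearMap.ext fun n => Subtype.ext
            (lift_rightHomLinear_comp g n)) }
      homEquiv_naturality_left_symm := fun {N N' T} f g =>
        ModuleCat.hom_ext (LinearMap.ext fun v : N ⊗[k] Y => by
          change TensorProduct.lift (rightHomLinear (f ≫ g)) v =
            TensorProduct.lift (rightHomLinear g) ((f.hom.restrictScalars k).rTensor Y v)
          exact LinearMap.congr_fun (f := TensorProduct.lift (rightHomLinear (f ≫ g)))
            (g := TensorProduct.lift (rightHomLinear g) ∘ₗ
              (f.hom.restrictScalars k).rTensor Y) (TensorProduct.ext' fun n y => rfl) v)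
      homEquiv_naturality_right := fun {N T T'} f g => rfl }

lemma rightSmashAdjunction_homEquiv_eval (f : (rightSmashFunctor k H A B Y).obj N ⟶ T)
    (n : N) (y : Y) :
    rightHomEval k H A B Y T (((rightSmashAdjunction k H A B Y).homEquiv N T f).hom n) y =
      f.hom (rightSmashTmul k H A B Y N n y) := by
  rw [rightSmashAdjunction, Adjunction.mkOfHomEquiv_homEquiv]
  rfl

/-- Flatness of `Y` over `k`; it makes `Hom_{B^op}(Y, -)` preserve injectives. -/
instance : (rightSmashFunctor k H A B Y).PreservesMonomorphisms where
  preserves {N N'} f hf := by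
    rw [ModuleCat.mono_iff_injective] at hf ⊢
    exact Module.Flat.rTensor_preserves_injective_linearMap (M := Y) (f.hom.restrictScalars k) hf

instance : (rightHomFunctor k H A B Y).Linear k where
  map_smul {T T'} g c := ModuleCat.hom_ext (LinearMap.ext fun f => Subtype.ext (by
    refine Eq.trans ?_ (congrArg Subtype.val (LinearMap.congr_fun
      ((rightHomRep k H A B Y T').commutes c) (((rightHomFunctor k H A B Y).map g).hom f))).symm
    rfl))

variable (Y) in
/-- The `k`-vector space underlying `Hom_{B^op}(Y, T)` is the space of morphisms of right
`B`-modules. -/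
noncomputable def rightHomFunctorObjEquiv (T : ModuleCat.{u} (TakeuchiSmash k H A B)ᵐᵒᵖ) :
    (rightHomFunctor k H A B Y).obj T ≃ₗ[k]
      (ModuleCat.of Bᵐᵒᵖ Y ⟶ (rightResB k H A B).obj T) where
  toFun f := ModuleCat.ofHom (Y := (rightResB k H A B).obj T)
    { toFun := fun y => rightHomEval k H A B Y T f y
      map_add' := fun y y' => map_add (Subtype.val (p := (· ∈ homB k H A B Y T)) f) y y'
      map_smul' := fun b y => Subtype.prop (p := (· ∈ homB k H A B Y T)) f b.unop y }
  invFun g := (⟨{ toFun := fun y => g.hom y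
                  map_add' := fun y y' => map_add g.hom y y'
                  map_smul' := fun c y => by
                    have h1 : g.hom (algebraMap k Bᵐᵒᵖ c • y) =
                      AlgHom.op (inr k H A B) (algebraMap k Bᵐᵒᵖ c) • (show T from g.hom y) :=
                      g.hom.map_smul (algebraMap k Bᵐᵒᵖ c) y
                    rw [AlgHom.commutes, algebraMap_smul] at h1
                    exact h1 }, fun b y => g.hom.map_smul (op b) y⟩ : homB k H A B Y T)
  left_inv f := rfl
  right_inv g := rfl
  map_add' f f' := rfl
  map_smul' c f := by
    have h1 : (c • f : (rightHomFunctor k H A B Y).obj T) =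
        (c • (show homB k H A B Y T from f) :) :=
      LinearMap.congr_fun ((rightHomRep k H A B Y T).commutes c) f
    refine ModuleCat.hom_ext (LinearMap.ext fun y => ?_)
    refine (congrArg (fun z => rightHomEval k H A B Y T z y) h1).trans ?_
    change algebraMap k (TakeuchiSmash k H A B)ᵐᵒᵖ c • rightHomEval k H A B Y T f y =
      AlgHom.op (inr k H A B) (algebraMap k Bᵐᵒᵖ c) • rightHomEval k H A B Y T f y
    rw [AlgHom.commutes]

lemma rightHomFunctorObjEquiv_map {T T' : ModuleCat.{u} (TakeuchiSmash k H A B)ᵐᵒᵖ} (g : T ⟶ T')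
    (f : (rightHomFunctor k H A B Y).obj T) :
    rightHomFunctorObjEquiv Y T' (((rightHomFunctor k H A B Y).map g).hom f) =
      rightHomFunctorObjEquiv Y T f ≫ (rightResB k H A B).map g := rfl

end rightAdjunction

end TakeuchiSmash

/-! ### Injective modules over `A # B` restrict to injective modules. -/

namespace TakeuchiSmash

open MulOpposite

variable (k H A B : Type u) [Field k] [Ring H] [HopfAlgebra k H] [HasBijectiveAntipode k H]
  [Ring A] [Algebra k A] [HModuleAlgebra k H A] [Ring B] [Algebra k B] [HComoduleAlgebra k H B]

/-- The products `(1 # b)(a # 1)` exhibit `A # B` as a free right `A`-module with basis coming from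
`B`. -/
instance preservesInjectiveObjects_resA : (resA k H A B).PreservesInjectiveObjects :=
  ModuleCat.preservesInjectiveObjects_restrictScalars (inl k H A B) (inr k H A B).toLinearMap
    (swapEquiv k H A B) (fun b a => swapEquiv_tmul a b)

/-- The same products exhibit `A # B` as a free left `B`-module with basis coming from `A`. In the
opposite algebra this is freeness on the right over `Bᵐᵒᵖ`. -/
instance preservesInjectiveObjects_rightResB : (rightResB k H A B).PreservesInjectiveObjects :=
  ModuleCat.preservesInjectiveObjects_restrictScalars (AlgHom.op (inr k H A B))
    ((opLinearEquiv k).toLinearMap ∘ₗ (inl k H A B).toLinearMap)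
    (opSwapEquiv k H A B) opSwapEquiv_tmul

end TakeuchiSmash

/-! ### The theorem: assembling the adjunctions, the Ext comparisons and the spectral sequences. -/

theorem mainTheorem6 (k H A B : Type u) [Field k] [Ring H] [HopfAlgebra k H]
    [HasBijectiveAntipode k H] [Ring A] [Algebra k A] [HModuleAlgebra k H A]
    [Ring B] [Algebra k B] [HComoduleAlgebra k H B] :
    -- left modules
    (∀ M : ModuleCat.{u} (TakeuchiSmash k H A H),
      -- the adjunction `M # - ⊣ Hom_A(M, -)` given by `f ↦ (x ↦ (m ↦ f (m # x)))`
      (∃ adj : TakeuchiSmash.smashFunctor k H A B M ⊣ TakeuchiSmash.homFunctor k H A B M,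
        ∀ (X : ModuleCat.{u} B) (T : ModuleCat.{u} (TakeuchiSmash k H A B))
          (f : (TakeuchiSmash.smashFunctor k H A B M).obj X ⟶ T) (x : X) (m : M),
          TakeuchiSmash.homEval k H A B M T ((adj.homEquiv X T f).hom x) m =
            f.hom (TakeuchiSmash.smashTmul k H A B M X m x)) ∧
      -- the underlying space of the `B`-module `Ext_A^q(M, T)` is `Ext_A^q(M, T)`
      (∀ q : ℕ, ∃ e : ∀ T : ModuleCat.{u} (TakeuchiSmash k H A B),
        (TakeuchiSmash.extModule k H A B M q).obj T ≃ₗ[k]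
          Abelian.Ext.{u} ((TakeuchiSmash.resA k H A H).obj M)
            ((TakeuchiSmash.resA k H A B).obj T) q,
        ∀ (T T' : ModuleCat.{u} (TakeuchiSmash k H A B)) (g : T ⟶ T')
          (x : (TakeuchiSmash.extModule k H A B M q).obj T),
          e T' (((TakeuchiSmash.extModule k H A B M q).map g).hom x) =
            (e T x).comp (Abelian.Ext.mk₀ ((TakeuchiSmash.resA k H A B).map g)) (add_zero q)) ∧
      -- the spectral sequence
      ∀ (X : ModuleCat.{u} B) (T : ModuleCat.{u} (TakeuchiSmash k H A B)),
        ∃ E : E₂CohomologicalSpectralSequenceNat (ModuleCat.{u} k),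
          (∀ p q : ℕ, Nonempty ((E.page 2 le_rfl).X (p, q) ≅
            ModuleCat.of k
              (Abelian.Ext.{u} X ((TakeuchiSmash.extModule k H A B M q).obj T) p))) ∧
          SpectralSequenceConverges E
            (fun n => Abelian.Ext.{u} ((TakeuchiSmash.smashFunctor k H A B M).obj X) T n)) ∧
    -- right modules
    (∀ (Y : Type u) [AddCommGroup Y] [Module k Y] [Module Bᵐᵒᵖ Y] [IsScalarTower k Bᵐᵒᵖ Y]
      [RightHopfModule k H B Y],
      -- the adjunction `- # Y ⊣ Hom_{B^op}(Y, -)` given by `f ↦ (n ↦ (y ↦ f (n # y)))`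
      (∃ adj : TakeuchiSmash.rightSmashFunctor k H A B Y ⊣
          TakeuchiSmash.rightHomFunctor k H A B Y,
        ∀ (N : ModuleCat.{u} Aᵐᵒᵖ) (T : ModuleCat.{u} (TakeuchiSmash k H A B)ᵐᵒᵖ)
          (f : (TakeuchiSmash.rightSmashFunctor k H A B Y).obj N ⟶ T) (n : N) (y : Y),
          TakeuchiSmash.rightHomEval k H A B Y T ((adj.homEquiv N T f).hom n) y =
            f.hom (TakeuchiSmash.rightSmashTmul k H A B Y N n y)) ∧
      -- the underlying space of the right `A`-module `Ext_{B^op}^q(Y, T)` is `Ext_{B^op}^q(Y, T)`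
      (∀ q : ℕ, ∃ e : ∀ T : ModuleCat.{u} (TakeuchiSmash k H A B)ᵐᵒᵖ,
        (TakeuchiSmash.rightExtModule k H A B Y q).obj T ≃ₗ[k]
          Abelian.Ext.{u} (ModuleCat.of Bᵐᵒᵖ Y) ((TakeuchiSmash.rightResB k H A B).obj T) q,
        ∀ (T T' : ModuleCat.{u} (TakeuchiSmash k H A B)ᵐᵒᵖ) (g : T ⟶ T')
          (x : (TakeuchiSmash.rightExtModule k H A B Y q).obj T),
          e T' (((TakeuchiSmash.rightExtModule k H A B Y q).map g).hom x) =
            (e T x).comp (Abelian.Ext.mk₀ ((TakeuchiSmash.rightResB k H A B).map g))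
              (add_zero q)) ∧
      -- the spectral sequence
      ∀ (N : ModuleCat.{u} Aᵐᵒᵖ) (T : ModuleCat.{u} (TakeuchiSmash k H A B)ᵐᵒᵖ),
        ∃ E : E₂CohomologicalSpectralSequenceNat (ModuleCat.{u} k),
          (∀ p q : ℕ, Nonempty ((E.page 2 le_rfl).X (p, q) ≅
            ModuleCat.of k
              (Abelian.Ext.{u} N ((TakeuchiSmash.rightExtModule k H A B Y q).obj T) p))) ∧
          SpectralSequenceConverges E
            (fun n => Abelian.Ext.{u} ((TakeuchiSmash.rightSmashFunctor k H A B Y).obj N) T n)) := by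
  refine ⟨fun M => ⟨⟨TakeuchiSmash.smashAdjunction k H A B M, fun X T f x m =>
      TakeuchiSmash.smashAdjunction_homEquiv_eval f x m⟩, fun q => ?_, fun X T => ?_⟩,
    fun Y _ _ _ _ _ => ⟨⟨TakeuchiSmash.rightSmashAdjunction k H A B Y, fun N T f n y =>
      TakeuchiSmash.rightSmashAdjunction_homEquiv_eval f n y⟩, fun q => ?_, fun N T => ?_⟩⟩
  · exact ModuleCat.exists_rightDerived_equiv_ext (TakeuchiSmash.homFunctor k H A B M)
      (TakeuchiSmash.resA k H A B) ((TakeuchiSmash.resA k H A H).obj M)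
      (TakeuchiSmash.homFunctorObjEquiv M)
      (fun _ _ g f => TakeuchiSmash.homFunctorObjEquiv_map g f) q
  · exact Adjunction.exists_spectralSequence k (TakeuchiSmash.smashAdjunction k H A B M) X T
  · exact ModuleCat.exists_rightDerived_equiv_ext (TakeuchiSmash.rightHomFunctor k H A B Y)
      (TakeuchiSmash.rightResB k H A B) (ModuleCat.of Bᵐᵒᵖ Y)
      (TakeuchiSmash.rightHomFunctorObjEquiv Y)
      (fun _ _ g f => TakeuchiSmash.rightHomFunctorObjEquiv_map g f) q
  · exact Adjunction.exists_spectralSequence k (TakeuchiSmash.rightSmashAdjunction k H A B Y) N T
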